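/- Consider, for $\varepsilon>0$, the boundary value problem (Lagerstrom's compressible model in dimension $n=2$) $$u''+\frac1r u'+\varepsilon u u'+u'^2=0\quad(r>1),\qquad u(1)=0,\quad u(\infty)=1 .$$ For every $\varepsilon>0$ it has exactly one solution $u_\varepsilon$ on $[1,\infty)$. Write $u$ also for this solution as a function of $\rho=\varepsilon r$ (so $\rho\ge\varepsilon$), and let $l=\log(1/\varepsilon)$, $\gamma$ Euler's constant, $E_1(\rho)=\int_\rho^\infty \tau^{-1}e^{-\tau}\,d\tau$. (i) For every $\varepsilon>0$ and $\rho\ge\varepsilon$ one has $0\le u<1$ and $0\le\frac{u-1}{e^u-e}\le1$, and there is exactly one constant $C=C(\varepsilon)$ with $$e^u-e=C\int_\infty^\rho\frac{e^{-\tau}}{\tau}\,e^{-J(\tau)}\,d\tau\quad(\rho\ge\varepsilon),\qquad J(\tau)=\int_\infty^\tau (u-1)\,d\sigma=\int_\infty^\tau\frac{u-1}{e^u-e}\,(e^u-e)\,d\sigma ,$$ where all integrals converge absolutely. Moreover $C>0$ and $|e^u-e|\le C E_1(\rho)$ for $\rho\ge\varepsilon$; the series $\sum_{m\ge0}\frac{(-J(\tau))^m}{m!}=e^{-J(\tau)}$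 converges uniformly for $\tau\ge\varepsilon$, and $$e^u-e=\sum_{m\ge0} C\int_\infty^\rho\frac{e^{-\tau}}{\tau}\,\frac{(-J(\tau))^m}{m!}\,d\tau$$ uniformly for $\rho\ge\varepsilon$. (ii) As $\varepsilon\to0^+$, $$C=\frac{e-1}{l}+\frac{A}{l^2}+\frac{B}{l^3}+O(l^{-4}),\qquad A=\frac{e-1}{e}(\gamma e+e-1),$$ where $B$ is the solution of $$B-A\gamma+\frac{(e-1)^2}{e}(\gamma+2\log2)-\frac{2A(e-1)}{e}+\frac{(e-1)^3}{2e^2}(3-4\log2)=0 .$$ (iii) (Inner expansion.) For each fixed $r\ge1$, as $\varepsilon\to0^+$, $$e^{u}-e=1-e+\frac{(e-1)\log r}{l}+\frac{\gamma(e-1)\log r}{l^2}+O(l^{-3}),$$ $$u=\log\Bigl\{1+\frac{e-1}{l}\log r+\frac{\gamma(e-1)}{l^2}\log r\Bigr\}+O(l^{-3}).$$ (iv) (Outer expansion.) For each fixed $\rho>0$, as $\varepsilon\to0^+$, $$e^u-e=-\frac{e-1}{l}\Bigl(1+\frac{\gamma+1-\frac1e}{l}\Bigr)E_1(\rho)+\frac{(e-1)^2}{e\,l^2}\bigl(2E_1(2\rho)-e^{-\rho}E_1(\rho)\bigr)+O(l^{-3}),$$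 $$u-1=-\frac{e-1}{e}\Bigl(1+\frac{\gamma+1-\frac1e}{l}\Bigr)\frac{E_1(\rho)}{l}+\frac{(e-1)^2}{e^2}\,\frac{2E_1(2\rho)-e^{-\rho}E_1(\rho)}{l^2}-\frac{(e-1)^2}{2e^2}\,\frac{E_1(\rho)^2}{l^2}+O(l^{-3}).$$ If $\gamma+1-\frac1e$ is replaced by $\gamma-1+\frac1e$ (the coefficient given by Hinch), the last expansion fails for every $\rho>0$. -/

import Mathlib

open Set Filter Topology Asymptotics

/-- `u` is a (classical) solution of the boundary value problem
`u'' + ((n - 1) / r) u' + ε u u' + k u'² = 0` for `r > 1`, `u(1) = 0`, `u(∞) = 1`: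
continuous on `[1, ∞)`, twice differentiable on `(1, ∞)`. -/
structure IsLagerstromSolution (k n ε : ℝ) (u : ℝ → ℝ) : Prop where
  continuousOn : ContinuousOn u (Ici 1)
  differentiableAt : ∀ r : ℝ, 1 < r → DifferentiableAt ℝ u r
  differentiableAt_deriv : ∀ r : ℝ, 1 < r → DifferentiableAt ℝ (deriv u) r
  ode : ∀ r : ℝ, 1 < r →
    deriv (deriv u) r + (n - 1) / r * deriv u r + ε * u r * deriv u r + k * (deriv u r) ^ 2 = 0
  at_one : u 1 = 0
  at_infty : Tendsto u atTop (𝓝 1)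

/-- The integral `∫_∞^ρ f(τ) dτ = -∫_ρ^∞ f(τ) dτ`. -/
noncomputable def integralFromInfty (f : ℝ → ℝ) (ρ : ℝ) : ℝ := -∫ τ in Ioi ρ, f τ

/-- The exponential integral `E₁(ρ) = ∫_ρ^∞ e^{-τ} / τ dτ`. -/
noncomputable def expIntE1 (ρ : ℝ) : ℝ := ∫ τ in Ioi ρ, Real.exp (-τ) / τ

/-- The rescaled function `ρ ↦ u(ρ / ε)`, i.e. `u` in the variable `ρ = ε r`. -/
noncomputable def rescale (ε : ℝ) (u : ℝ → ℝ) (ρ : ℝ) : ℝ := u (ρ / ε)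

/-- The exponent `∫_∞^τ (U(σ) - 1) dσ`. -/
noncomputable def tailExponent (U : ℝ → ℝ) (τ : ℝ) : ℝ :=
  integralFromInfty (fun σ => U σ - 1) τ

/-- The same exponent written in terms of `e^U - e`:
`∫_∞^τ ((U - 1) / (e^U - e)) (e^U - e) dσ`. -/
noncomputable def tailExponentExp (U : ℝ → ℝ) (τ : ℝ) : ℝ :=
  integralFromInfty
    (fun σ => (U σ - 1) / (Real.exp (U σ) - Real.exp 1) * (Real.exp (U σ) - Real.exp 1)) τ

/-- `l = log (1 / ε)`. -/
noncomputable def logInv (ε : ℝ) : ℝ := Real.log (1 / ε)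

/-- The coefficient `A = ((e - 1) / e) (γ e + e - 1)`. -/
noncomputable def coeffA : ℝ :=
  (Real.exp 1 - 1) / Real.exp 1 *
    (Real.eulerMascheroniConstant * Real.exp 1 + Real.exp 1 - 1)

/-- The coefficient `B`, the solution of
`B - A γ + ((e-1)²/e) (γ + 2 log 2) - 2 A (e-1)/e + ((e-1)³/(2e²)) (3 - 4 log 2) = 0`. -/
noncomputable def coeffB : ℝ :=
  coeffA * Real.eulerMascheroniConstant
    - (Real.exp 1 - 1) ^ 2 / Real.exp 1 * (Real.eulerMascheroniConstant + 2 * Real.log 2)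
    + 2 * coeffA * (Real.exp 1 - 1) / Real.exp 1
    - 1 / (2 * Real.exp 1 ^ 2) * (Real.exp 1 - 1) ^ 3 * (3 - 4 * Real.log 2)

/-- The two-term inner expansion of `e^u - e` at fixed `r`. -/
noncomputable def innerExpansion (r ε : ℝ) : ℝ :=
  1 - Real.exp 1 + (Real.exp 1 - 1) * Real.log r / logInv ε
    + Real.eulerMascheroniConstant * (Real.exp 1 - 1) * Real.log r / logInv ε ^ 2

/-- The outer expansion of `e^u - e` at fixed `ρ`, up to order `l⁻²`. -/
noncomputable def outerExpansionExp (ρ ε : ℝ) : ℝ :=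
  -((Real.exp 1 - 1) / logInv ε)
      * (1 + (Real.eulerMascheroniConstant + 1 - 1 / Real.exp 1) / logInv ε) * expIntE1 ρ
    + (Real.exp 1 - 1) ^ 2 / (Real.exp 1 * logInv ε ^ 2)
      * (2 * expIntE1 (2 * ρ) - Real.exp (-ρ) * expIntE1 ρ)

/-- The outer expansion of `u - 1` at fixed `ρ`, up to order `l⁻²`, with a constant `a` in the
second-order coefficient of `E₁(ρ)`. -/
noncomputable def outerExpansion (a ρ ε : ℝ) : ℝ :=
  -((Real.exp 1 - 1) / Real.exp 1) * (1 + a / logInv ε) * (expIntE1 ρ / logInv ε)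
    + (Real.exp 1 - 1) ^ 2 / Real.exp 1 ^ 2
      * ((2 * expIntE1 (2 * ρ) - Real.exp (-ρ) * expIntE1 ρ) / logInv ε ^ 2)
    - (Real.exp 1 - 1) ^ 2 / (2 * Real.exp 1 ^ 2) * (expIntE1 ρ ^ 2 / logInv ε ^ 2)

/-- The integral equation
`e^U(ρ) - e = C ∫_∞^ρ τ⁻¹ e^{-τ} exp(-∫_∞^τ ((U - 1)/(e^U - e)) (e^U - e) dσ) dτ`
for all `ρ ≥ ε`, all integrals being absolutely convergent. -/
def SatisfiesIntegralEq (ε C : ℝ) (U : ℝ → ℝ) : Prop :=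
  MeasureTheory.IntegrableOn
    (fun σ => (U σ - 1) / (Real.exp (U σ) - Real.exp 1) * (Real.exp (U σ) - Real.exp 1)) (Ioi ε) ∧
  MeasureTheory.IntegrableOn
    (fun τ => 1 / τ * Real.exp (-τ) * Real.exp (-tailExponentExp U τ)) (Ioi ε) ∧
  ∀ ρ : ℝ, ε ≤ ρ → Real.exp (U ρ) - Real.exp 1 =
    C * integralFromInfty (fun τ => 1 / τ * Real.exp (-τ) * Real.exp (-tailExponentExp U τ)) ρ

/-! In the variable `ρ = ε r` put `W = e^u`. The term `u'²` is absorbed by the exponential, and the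
equation becomes the first-order law `q' = -u q` for the flux `q = ρ W'`. Hence `q = C e^{-ρ}
e^{-J}` with `J(ρ) = ∫_ρ^∞ (1 - u)`. For the defect `F = e - W` this is the integral equation `F(ρ)
= C ∫_ρ^∞ τ⁻¹ e^{-τ} e^{-J}`, closed by `1 - u = tailRate F`, where `tailRate` is globally
1-Lipschitz. The boundary value `u = 0` reads `F(ε) = e - 1` and fixes `C`. `TailSolution` records
this problem.

Existence is by shooting in `C`. For fixed `C` the map on exponents `J` is a contraction in a
weighted sup norm, and its fixed point is Lipschitz in `C`. So `F(ε)` is continuous in `C`; it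
vanishes at `C = 0`, and the a priori bound `const_le` shows that it reaches `e - 1` for large `C`.
The intermediate value theorem gives a solution.

Uniqueness rests on the energy `q + ρ (W log W - W)`, whose derivative is `W log W - W`, strictly
increasing in `W ≥ 1`. It turns an ordering of two defects at a point into a strict ordering of the
fluxes (`flux_lt_of_F_lt`), which contradicts the behaviour of the difference at a positive maximum.

For the asymptotics, `0 ≤ J ≤ C` and `C = O(1/l)`, so the integral equation can be iterated in
powers of `C`. The iterates are explicit in `E₁`, with remainders uniform down to `ρ = ε`, because
`E₁`, `E₁²` and `E₁³` have bounded integrals. At `ρ = ε` an integration by parts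
(`abs_F_sub_boundary_le`) avoids losing a factor `E₁(ε) ~ l`. With `E₁(ε) = l - γ + O(ε)` the
boundary condition becomes a polynomial equation for `Y = C l` in the small parameter `1/l`, solved
by bootstrapping in `expansion_of_perturbed_root`. The inner and outer expansions follow by
substituting the result. Hinch's coefficient changes the outer expansion by a nonzero multiple of
`l⁻²`, so it cannot also be correct. -/

/-! ### Integrals over `(t, ∞)` as functions of `t`. -/

section TailIntegrals
open MeasureTheory

theorem setIntegral_Ioi_eq_interval_add {f : ℝ → ℝ} {a b : ℝ} (hab : a ≤ b)
    (hf : IntegrableOn f (Ioi a)) :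
    ∫ x in Ioi a, f x = (∫ x in a..b, f x) + ∫ x in Ioi b, f x :=
  (intervalIntegral.integral_interval_add_Ioi hf (hf.mono_set (Ioi_subset_Ioi hab))).symm

/-- The endpoint `a` is included although only integrability on the open ray is assumed; the
boundary value at `ρ = ε` and the limit of the logarithmic integral at `0` need this. -/
theorem continuousOn_setIntegral_Ioi {f : ℝ → ℝ} {a : ℝ} (hf : IntegrableOn f (Ioi a)) :
    ContinuousOn (fun t => ∫ x in Ioi t, f x) (Ici a) := by
  have h : ∀ b, a ≤ b → ContinuousOn (fun t => ∫ x in Ioi t, f x) (Icc a b) := by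
    intro b hab
    have h1 : ContinuousOn (fun t => ∫ x in a..t, f x) (Icc a b) := by
      have := intervalIntegral.continuousOn_primitive_interval
        (f := f) (μ := volume) (a := a) (b := b)
        (by
          rw [uIcc_of_le hab, integrableOn_Icc_iff_integrableOn_Ioc]
          exact hf.mono_set Ioc_subset_Ioi_self)
      rwa [uIcc_of_le hab] at this
    refine (continuousOn_const (c := ∫ x in Ioi a, f x) |>.sub h1).congr ?_
    intro t ht
    have := setIntegral_Ioi_eq_interval_add ht.1 hf
    simp only [Pi.sub_apply]
    linarith
  intro t ht
  have ht' : a ≤ t := ht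
  refine (h (t + 1) (by linarith) t ⟨ht, by linarith⟩).mono_of_mem_nhdsWithin ?_
  filter_upwards [self_mem_nhdsWithin, mem_nhdsWithin_of_mem_nhds (Iio_mem_nhds (lt_add_one t))]
    with y hy hy'
  exact ⟨hy, le_of_lt hy'⟩

theorem hasDerivAt_setIntegral_Ioi {f : ℝ → ℝ} {a t : ℝ} (hf : IntegrableOn f (Ioi a))
    (hc : ContinuousOn f (Ioi a)) (ht : a < t) :
    HasDerivAt (fun t => ∫ x in Ioi t, f x) (-f t) t := by
  have hint : IntervalIntegrable f volume a t :=
    (intervalIntegrable_iff_integrableOn_Ioc_of_le ht.le).2 (hf.mono_set Ioc_subset_Ioi_self)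
  have h1 : HasDerivAt (fun t => ∫ x in a..t, f x) (f t) t :=
    intervalIntegral.integral_hasDerivAt_right hint
      (hc.stronglyMeasurableAtFilter isOpen_Ioi t ht) (hc.continuousAt (Ioi_mem_nhds ht))
  have h2 := (hasDerivAt_const t (∫ x in Ioi a, f x)).sub h1
  rw [zero_sub] at h2
  refine h2.congr_of_eventuallyEq ?_
  filter_upwards [Ioi_mem_nhds ht] with y hy
  have := setIntegral_Ioi_eq_interval_add (le_of_lt hy) hf
  simp only [Pi.sub_apply]
  linarith

theorem tendsto_setIntegral_Ioi_atTop {f : ℝ → ℝ} {a : ℝ} (hf : IntegrableOn f (Ioi a)) :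
    Tendsto (fun t => ∫ x in Ioi t, f x) atTop (𝓝 0) := by
  have h := (tendsto_const_nhds (x := ∫ x in Ioi a, f x)).sub
    (intervalIntegral_tendsto_integral_Ioi a hf tendsto_id)
  rw [sub_self] at h
  refine h.congr' ?_
  filter_upwards [eventually_ge_atTop a] with t ht
  have := setIntegral_Ioi_eq_interval_add ht hf
  simp only [id]
  linarith

theorem abs_setIntegral_Ioi_le {f g : ℝ → ℝ} {a : ℝ} (hg : IntegrableOn g (Ioi a))
    (h : ∀ x, a < x → |f x| ≤ g x) : |∫ x in Ioi a, f x| ≤ ∫ x in Ioi a, g x := by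
  have := norm_integral_le_of_norm_le (f := f) hg
    ((ae_restrict_iff' measurableSet_Ioi).2 (ae_of_all _ fun x hx => by
      simpa using h x hx))
  simpa using this

theorem IntegrableOn.of_continuousOn_abs_le {f g : ℝ → ℝ} {a : ℝ} (hg : IntegrableOn g (Ioi a))
    (hf : ContinuousOn f (Ioi a)) (h : ∀ x, a < x → |f x| ≤ g x) : IntegrableOn f (Ioi a) := by
  refine Integrable.mono' hg (hf.aestronglyMeasurable measurableSet_Ioi) ?_
  exact (ae_restrict_iff' measurableSet_Ioi).2 (ae_of_all _ fun x hx => by simpa using h x hx)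

theorem setIntegral_Ioi_mono {f g : ℝ → ℝ} {a : ℝ} (hf : IntegrableOn f (Ioi a))
    (hg : IntegrableOn g (Ioi a)) (h : ∀ x, a < x → f x ≤ g x) :
    ∫ x in Ioi a, f x ≤ ∫ x in Ioi a, g x :=
  setIntegral_mono_on hf hg measurableSet_Ioi h

theorem setIntegral_Ioi_nonneg {f : ℝ → ℝ} {a : ℝ} (h : ∀ x, a < x → 0 ≤ f x) :
    0 ≤ ∫ x in Ioi a, f x := setIntegral_nonneg measurableSet_Ioi h

end TailIntegrals

/-! ### The exponential integral and closed forms of its iterated integrals. -/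

section ExpIntegral
open MeasureTheory

theorem continuousOn_exp_neg_div : ContinuousOn (fun τ : ℝ => Real.exp (-τ) / τ) (Ioi 0) := by
  refine ContinuousOn.div (by fun_prop) continuousOn_id ?_
  intro x hx
  exact (ne_of_gt hx)

theorem integrableOn_exp_neg (a : ℝ) : IntegrableOn (fun τ : ℝ => Real.exp (-τ)) (Ioi a) :=
  integrableOn_exp_neg_Ioi a

theorem integrableOn_exp_neg_div {a : ℝ} (ha : 0 < a) :
    IntegrableOn (fun τ : ℝ => Real.exp (-τ) / τ) (Ioi a) := by
  refine IntegrableOn.of_continuousOn_abs_le (g := fun τ => a⁻¹ * Real.exp (-τ))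
    ((integrableOn_exp_neg a).const_mul _)
    (continuousOn_exp_neg_div.mono (Ioi_subset_Ioi ha.le)) ?_
  intro x hx
  have hx0 : 0 < x := ha.trans hx
  rw [abs_of_nonneg (by positivity), div_eq_mul_inv, mul_comm]
  gcongr

theorem hasDerivAt_expIntE1 {t : ℝ} (ht : 0 < t) :
    HasDerivAt expIntE1 (-(Real.exp (-t) / t)) t :=
  hasDerivAt_setIntegral_Ioi (integrableOn_exp_neg_div (half_pos ht))
    (continuousOn_exp_neg_div.mono (Ioi_subset_Ioi (half_pos ht).le)) (half_lt_self ht)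

theorem continuousOn_expIntE1 : ContinuousOn expIntE1 (Ioi 0) := fun _ ht =>
  (hasDerivAt_expIntE1 ht).continuousAt.continuousWithinAt

theorem tendsto_expIntE1_atTop : Tendsto expIntE1 atTop (𝓝 0) :=
  tendsto_setIntegral_Ioi_atTop (integrableOn_exp_neg_div one_pos)

theorem expIntE1_nonneg {t : ℝ} (ht : 0 < t) : 0 ≤ expIntE1 t :=
  setIntegral_Ioi_nonneg fun x hx => by
    have : 0 < x := ht.trans hx
    positivity

theorem expIntE1_antitone {s t : ℝ} (hs : 0 < s) (hst : s ≤ t) : expIntE1 t ≤ expIntE1 s := by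
  refine setIntegral_mono_set (integrableOn_exp_neg_div hs) ?_
    (Ioi_subset_Ioi hst).eventuallyLE
  refine (ae_restrict_iff' measurableSet_Ioi).2 (ae_of_all _ fun x hx => ?_)
  have : 0 < x := hs.trans hx
  simp only [Pi.zero_apply]
  positivity

theorem mul_expIntE1_le {t : ℝ} (ht : 0 < t) : t * expIntE1 t ≤ Real.exp (-t) := by
  have h : expIntE1 t ≤ ∫ τ in Ioi t, t⁻¹ * Real.exp (-τ) := by
    refine setIntegral_Ioi_mono (integrableOn_exp_neg_div ht)
      ((integrableOn_exp_neg t).const_mul _) fun x hx => ?_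
    have hx0 : 0 < x := ht.trans hx
    rw [div_eq_mul_inv, mul_comm]
    gcongr
  rw [integral_const_mul, integral_exp_neg_Ioi] at h
  calc t * expIntE1 t ≤ t * (t⁻¹ * Real.exp (-t)) := by gcongr
    _ = Real.exp (-t) := by field_simp

theorem expIntE1_pos {t : ℝ} (ht : 0 < t) : 0 < expIntE1 t := by
  have hanti : StrictAntiOn expIntE1 (Ioi 0) := by
    refine strictAntiOn_of_deriv_neg (convex_Ioi 0) continuousOn_expIntE1 ?_
    intro x hx
    rw [interior_Ioi] at hx
    have hx0 : 0 < x := hx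
    rw [(hasDerivAt_expIntE1 hx0).deriv]
    have : 0 < Real.exp (-x) / x := by positivity
    linarith
  have := hanti (show t ∈ Ioi 0 from ht) (show t + 1 ∈ Ioi (0 : ℝ) from by
    simp only [mem_Ioi]; linarith) (lt_add_one t)
  exact (expIntE1_nonneg (by linarith)).trans_lt this

theorem tendsto_mul_expIntE1_atTop : Tendsto (fun t => t * expIntE1 t) atTop (𝓝 0) := by
  refine squeeze_zero' (g := fun t => Real.exp (-t)) ?_ ?_ ?_
  · filter_upwards [eventually_gt_atTop 0] with t ht
    exact mul_nonneg ht.le (expIntE1_nonneg ht)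
  · filter_upwards [eventually_gt_atTop 0] with t ht using mul_expIntE1_le ht
  · exact Real.tendsto_exp_neg_atTop_nhds_zero

/-- `∫_τ^∞ E₁`. -/
noncomputable def expIntTail (τ : ℝ) : ℝ := Real.exp (-τ) - τ * expIntE1 τ

/-- `∫_τ^∞ e^{-s} E₁(s) ds`. -/
noncomputable def expIntDamped (τ : ℝ) : ℝ := Real.exp (-τ) * expIntE1 τ - expIntE1 (2 * τ)

/-- `∫_ρ^∞ s⁻¹ e^{-s} ∫_s^∞ E₁ ds`. -/
noncomputable def expIntSecond (ρ : ℝ) : ℝ := 2 * expIntE1 (2 * ρ) - Real.exp (-ρ) * expIntE1 ρ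

/-- `∫_τ^∞ E₁²`. -/
noncomputable def expIntSq (τ : ℝ) : ℝ := 2 * expIntDamped τ - τ * expIntE1 τ ^ 2

theorem hasDerivAt_exp_neg (t : ℝ) : HasDerivAt (fun t => Real.exp (-t)) (-Real.exp (-t)) t := by
  simpa using (hasDerivAt_neg t).exp

theorem hasDerivAt_expIntE1_two_mul {t : ℝ} (ht : 0 < t) :
    HasDerivAt (fun t => expIntE1 (2 * t)) (-(Real.exp (-t) * Real.exp (-t) / t)) t := by
  have h := (hasDerivAt_expIntE1 (t := 2 * t) (by positivity)).comp t
    ((hasDerivAt_id t).const_mul 2)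
  refine h.congr_deriv ?_
  rw [← Real.exp_add, show -(2 * t) = -t + -t by ring]
  field_simp

theorem hasDerivAt_expIntTail {t : ℝ} (ht : 0 < t) :
    HasDerivAt expIntTail (-expIntE1 t) t := by
  have h := (hasDerivAt_exp_neg t).sub ((hasDerivAt_id t).mul (hasDerivAt_expIntE1 ht))
  refine h.congr_deriv ?_
  simp only [id]
  field_simp
  ring

theorem hasDerivAt_expIntDamped {t : ℝ} (ht : 0 < t) :
    HasDerivAt expIntDamped (-(Real.exp (-t) * expIntE1 t)) t := by
  have h := ((hasDerivAt_exp_neg t).mul (hasDerivAt_expIntE1 ht)).sub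
    (hasDerivAt_expIntE1_two_mul ht)
  refine h.congr_deriv ?_
  ring

theorem hasDerivAt_expIntSecond {t : ℝ} (ht : 0 < t) :
    HasDerivAt expIntSecond (-(Real.exp (-t) / t * expIntTail t)) t := by
  have h := ((hasDerivAt_expIntE1_two_mul ht).const_mul 2).sub
    ((hasDerivAt_exp_neg t).mul (hasDerivAt_expIntE1 ht))
  refine h.congr_deriv ?_
  rw [expIntTail]
  field_simp
  ring

theorem hasDerivAt_expIntSq {t : ℝ} (ht : 0 < t) :
    HasDerivAt expIntSq (-expIntE1 t ^ 2) t := by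
  have h := ((hasDerivAt_expIntDamped ht).const_mul 2).sub
    ((hasDerivAt_id t).mul ((hasDerivAt_expIntE1 ht).pow 2))
  refine h.congr_deriv ?_
  simp only [id, Pi.pow_apply]
  field_simp
  ring

theorem tendsto_expIntE1_two_mul_atTop : Tendsto (fun t => expIntE1 (2 * t)) atTop (𝓝 0) :=
  tendsto_expIntE1_atTop.comp (tendsto_id.const_mul_atTop two_pos)

theorem tendsto_exp_neg_mul_expIntE1 :
    Tendsto (fun t => Real.exp (-t) * expIntE1 t) atTop (𝓝 0) := by
  simpa using Real.tendsto_exp_neg_atTop_nhds_zero.mul tendsto_expIntE1_atTop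

theorem tendsto_expIntTail_atTop : Tendsto expIntTail atTop (𝓝 0) := by
  simpa using (show Tendsto expIntTail atTop (𝓝 (0 - 0)) from
    Real.tendsto_exp_neg_atTop_nhds_zero.sub tendsto_mul_expIntE1_atTop)

theorem tendsto_expIntDamped_atTop : Tendsto expIntDamped atTop (𝓝 0) := by
  simpa using (show Tendsto expIntDamped atTop (𝓝 (0 - 0)) from
    tendsto_exp_neg_mul_expIntE1.sub tendsto_expIntE1_two_mul_atTop)

theorem tendsto_expIntSecond_atTop : Tendsto expIntSecond atTop (𝓝 0) := by
  simpa using (show Tendsto expIntSecond atTop (𝓝 (2 * 0 - 0)) from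
    (tendsto_expIntE1_two_mul_atTop.const_mul 2).sub tendsto_exp_neg_mul_expIntE1)

theorem tendsto_expIntSq_atTop : Tendsto expIntSq atTop (𝓝 0) := by
  have h := (tendsto_expIntDamped_atTop.const_mul 2).sub
    (tendsto_mul_expIntE1_atTop.mul tendsto_expIntE1_atTop)
  simp only [mul_zero, sub_zero] at h
  refine h.congr fun t => ?_
  rw [expIntSq]
  ring

/-- A nonnegative function whose opposite has a primitive vanishing at infinity. -/
theorem integrableOn_and_integral_eq_of_primitive {G g : ℝ → ℝ}
    (hd : ∀ t, 0 < t → HasDerivAt G (-g t) t) (hg : ∀ t, 0 < t → 0 ≤ g t)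
    (hG : Tendsto G atTop (𝓝 0)) {a : ℝ} (ha : 0 < a) :
    IntegrableOn g (Ioi a) ∧ ∫ x in Ioi a, g x = G a := by
  have h1 : ∀ x ∈ Ici a, HasDerivAt G (-g x) x := fun x hx => hd x (ha.trans_le hx)
  have h2 : ∀ x ∈ Ioi a, -g x ≤ 0 := fun x hx => neg_nonpos.2 (hg x (ha.trans hx))
  have h3 := integrableOn_Ioi_deriv_of_nonpos' h1 h2 hG
  have h4 := integral_Ioi_of_hasDerivAt_of_nonpos' h1 h2 hG
  rw [integral_neg] at h4
  refine ⟨by simpa using h3.neg, by linarith⟩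

theorem expIntTail_integral {a : ℝ} (ha : 0 < a) :
    IntegrableOn expIntE1 (Ioi a) ∧ ∫ x in Ioi a, expIntE1 x = expIntTail a :=
  integrableOn_and_integral_eq_of_primitive (fun _ ht => hasDerivAt_expIntTail ht)
    (fun _ ht => expIntE1_nonneg ht) tendsto_expIntTail_atTop ha

theorem expIntTail_nonneg {a : ℝ} (ha : 0 < a) : 0 ≤ expIntTail a := by
  have := mul_expIntE1_le ha
  rw [expIntTail]
  linarith

theorem expIntTail_le_one {a : ℝ} (ha : 0 < a) : expIntTail a ≤ 1 := by
  have h1 := mul_nonneg ha.le (expIntE1_nonneg ha)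
  have h2 : Real.exp (-a) ≤ 1 := Real.exp_le_one_iff.2 (by linarith)
  rw [expIntTail]
  linarith

theorem expIntDamped_integral {a : ℝ} (ha : 0 < a) :
    IntegrableOn (fun t => Real.exp (-t) * expIntE1 t) (Ioi a) ∧
      ∫ x in Ioi a, Real.exp (-x) * expIntE1 x = expIntDamped a :=
  integrableOn_and_integral_eq_of_primitive (fun _ ht => hasDerivAt_expIntDamped ht)
    (fun _ ht => mul_nonneg (Real.exp_pos _).le (expIntE1_nonneg ht)) tendsto_expIntDamped_atTop ha

theorem expIntSecond_integral {a : ℝ} (ha : 0 < a) :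
    IntegrableOn (fun t => Real.exp (-t) / t * expIntTail t) (Ioi a) ∧
      ∫ x in Ioi a, Real.exp (-x) / x * expIntTail x = expIntSecond a :=
  integrableOn_and_integral_eq_of_primitive (fun _ ht => hasDerivAt_expIntSecond ht)
    (fun _ ht => mul_nonneg (by positivity) (expIntTail_nonneg ht)) tendsto_expIntSecond_atTop ha

theorem expIntSq_integral {a : ℝ} (ha : 0 < a) :
    IntegrableOn (fun t => expIntE1 t ^ 2) (Ioi a) ∧
      ∫ x in Ioi a, expIntE1 x ^ 2 = expIntSq a :=
  integrableOn_and_integral_eq_of_primitive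
    (fun _ ht => (hasDerivAt_expIntSq ht))
    (fun _ _ => sq_nonneg _) tendsto_expIntSq_atTop ha

theorem expIntDamped_le_one {a : ℝ} (ha : 0 < a) : expIntDamped a ≤ 1 := by
  rw [← (expIntDamped_integral ha).2]
  refine (setIntegral_Ioi_mono (expIntDamped_integral ha).1 (expIntTail_integral ha).1
    fun x hx => ?_).trans ((expIntTail_integral ha).2.trans_le (expIntTail_le_one ha))
  have hx0 : 0 < x := ha.trans hx
  exact mul_le_of_le_one_left (expIntE1_nonneg hx0) (Real.exp_le_one_iff.2 (by linarith))

theorem expIntSq_le_two {a : ℝ} (ha : 0 < a) : expIntSq a ≤ 2 := by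
  have h1 := expIntDamped_le_one ha
  have h2 := mul_nonneg ha.le (sq_nonneg (expIntE1 a))
  rw [expIntSq]
  linarith

/-- Integrating the derivative of `t E₁³` gives `∫ E₁³ = 3 ∫ e^{-t} E₁² - a E₁(a)³`. The point is a
bound uniform in `a`, although `E₁(a)` blows up as `a → 0`. -/
theorem expIntE1_cube_integral {a : ℝ} (ha : 0 < a) :
    IntegrableOn (fun t => expIntE1 t ^ 3) (Ioi a) ∧ ∫ x in Ioi a, expIntE1 x ^ 3 ≤ 6 := by
  have hsq := (expIntSq_integral ha).1
  have hint : IntegrableOn (fun t => expIntE1 t ^ 3) (Ioi a) := by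
    refine IntegrableOn.of_continuousOn_abs_le (hsq.const_mul (expIntE1 a))
      ((continuousOn_expIntE1.mono (Ioi_subset_Ioi ha.le)).pow 3) fun x hx => ?_
    have hx0 : 0 < x := ha.trans hx
    have h0 := expIntE1_nonneg hx0
    have h1 := expIntE1_antitone ha (le_of_lt hx)
    rw [abs_of_nonneg (by positivity), pow_succ, mul_comm]
    gcongr
  refine ⟨hint, ?_⟩
  have hint2 : IntegrableOn (fun t => Real.exp (-t) * expIntE1 t ^ 2) (Ioi a) := by
    refine IntegrableOn.of_continuousOn_abs_le hsq
      (ContinuousOn.mul (by fun_prop)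
        ((continuousOn_expIntE1.mono (Ioi_subset_Ioi ha.le)).pow 2)) fun x hx => ?_
    have hx0 : 0 < x := ha.trans hx
    rw [abs_of_nonneg (mul_nonneg (Real.exp_pos _).le (sq_nonneg _))]
    exact mul_le_of_le_one_left (sq_nonneg _) (Real.exp_le_one_iff.2 (by linarith))
  have hd : ∀ t ∈ Ici a, HasDerivAt (fun t => t * expIntE1 t ^ 3)
      (expIntE1 t ^ 3 - 3 * (Real.exp (-t) * expIntE1 t ^ 2)) t := by
    intro t ht
    have ht0 : 0 < t := ha.trans_le ht
    refine ((hasDerivAt_id t).mul ((hasDerivAt_expIntE1 ht0).pow 3)).congr_deriv ?_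
    simp only [id, Nat.cast_ofNat, Nat.add_one_sub_one, Pi.pow_apply]
    field_simp
    ring
  have hlim : Tendsto (fun t => t * expIntE1 t ^ 3) atTop (𝓝 0) := by
    have h := tendsto_mul_expIntE1_atTop.mul (tendsto_expIntE1_atTop.pow 2)
    rw [zero_mul] at h
    exact h.congr fun t => by ring
  have h := integral_Ioi_of_hasDerivAt_of_tendsto' hd (hint.sub (hint2.const_mul 3)) hlim
  rw [integral_sub hint (hint2.const_mul 3), integral_const_mul] at h
  have h1 : ∫ x in Ioi a, Real.exp (-x) * expIntE1 x ^ 2 ≤ 2 := by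
    refine (setIntegral_Ioi_mono hint2 hsq
      fun x hx => ?_).trans ((expIntSq_integral ha).2.trans_le (expIntSq_le_two ha))
    have hx0 : 0 < x := ha.trans hx
    exact mul_le_of_le_one_left (sq_nonneg _) (Real.exp_le_one_iff.2 (by linarith))
  have h2 : 0 ≤ a * expIntE1 a ^ 3 := mul_nonneg ha.le (pow_nonneg (expIntE1_nonneg ha) 3)
  linarith

end ExpIntegral

/-! ### Euler's constant and `E₁` near zero. -/

section EulerMascheroni
open MeasureTheory

/-- The integral is `Γ'(1)`, obtained by differentiating Euler's integral under the integral sign.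
-/
theorem integral_log_mul_exp_neg :
    ∫ t in Ioi (0 : ℝ), Real.log t * Real.exp (-t) = -Real.eulerMascheroniConstant := by
  have h1 := Complex.hasDerivAt_GammaIntegral (s := 1) (by simp)
  have h2 : HasDerivAt Complex.Gamma
      (∫ t : ℝ in Ioi 0, (t : ℂ) ^ ((1 : ℂ) - 1) * (Real.log t * Real.exp (-t))) 1 := by
    refine h1.congr_of_eventuallyEq ?_
    have : {s : ℂ | 0 < s.re} ∈ 𝓝 (1 : ℂ) :=
      (isOpen_lt continuous_const Complex.continuous_re).mem_nhds (by simp)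
    filter_upwards [this] with s hs using Complex.Gamma_eq_integral hs
  have h3 := h2.unique Complex.hasDerivAt_Gamma_one
  have h4 : (∫ t : ℝ in Ioi 0, (t : ℂ) ^ ((1 : ℂ) - 1) * (Real.log t * Real.exp (-t)))
      = ((∫ t in Ioi (0 : ℝ), Real.log t * Real.exp (-t) : ℝ) : ℂ) := by
    refine Eq.trans ?_ (integral_ofReal (𝕜 := ℂ))
    congr 1
    ext t
    simp
  rw [h4] at h3
  exact_mod_cast h3

/-- A function that is not integrable has integral `0` by convention, and this integral is `-γ ≠ 0`.
-/
theorem integrableOn_log_mul_exp_neg :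
    IntegrableOn (fun t => Real.log t * Real.exp (-t)) (Ioi (0 : ℝ)) := by
  refine Integrable.of_integral_ne_zero ?_
  rw [integral_log_mul_exp_neg]
  have := Real.one_half_lt_eulerMascheroniConstant
  intro h
  linarith

theorem tendsto_log_mul_exp_neg_atTop :
    Tendsto (fun t => Real.log t * Real.exp (-t)) atTop (𝓝 0) := by
  have h := Real.tendsto_pow_mul_exp_neg_atTop_nhds_zero 1
  refine squeeze_zero' (g := fun t => t ^ 1 * Real.exp (-t)) ?_ ?_ h
  · filter_upwards [eventually_ge_atTop 1] with t ht
    exact mul_nonneg (Real.log_nonneg ht) (Real.exp_pos _).le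
  · filter_upwards [eventually_ge_atTop 1] with t ht
    have := Real.log_le_sub_one_of_pos (lt_of_lt_of_le one_pos ht)
    rw [pow_one]
    gcongr
    linarith

theorem expIntE1_add_log_mul_exp_neg {t : ℝ} (ht : 0 < t) :
    expIntE1 t + Real.log t * Real.exp (-t) = ∫ s in Ioi t, Real.log s * Real.exp (-s) := by
  have hd : ∀ s ∈ Ici t, HasDerivAt (fun s => expIntE1 s + Real.log s * Real.exp (-s))
      (-(Real.log s * Real.exp (-s))) s := by
    intro s hs
    have hs0 : 0 < s := ht.trans_le hs
    refine ((hasDerivAt_expIntE1 hs0).add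
      ((Real.hasDerivAt_log hs0.ne').mul (hasDerivAt_exp_neg s))).congr_deriv ?_
    field_simp
    ring
  have hlim : Tendsto (fun s => expIntE1 s + Real.log s * Real.exp (-s)) atTop (𝓝 0) := by
    simpa using tendsto_expIntE1_atTop.add tendsto_log_mul_exp_neg_atTop
  have h := integral_Ioi_of_hasDerivAt_of_tendsto' hd
    (integrableOn_log_mul_exp_neg.mono_set (Ioi_subset_Ioi ht.le)).neg hlim
  rw [integral_neg] at h
  linarith

theorem tendsto_expIntE1_add_log :
    Tendsto (fun t => expIntE1 t + Real.log t + Real.eulerMascheroniConstant) (𝓝[>] 0) (𝓝 0) := by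
  have h1 : Tendsto (fun t => ∫ s in Ioi t, Real.log s * Real.exp (-s)) (𝓝[>] 0)
      (𝓝 (-Real.eulerMascheroniConstant)) := by
    rw [← integral_log_mul_exp_neg]
    exact ((continuousOn_setIntegral_Ioi integrableOn_log_mul_exp_neg) 0 self_mem_Ici).mono_left
      (nhdsWithin_mono _ Ioi_subset_Ici_self)
  have h2 : Tendsto (fun t => Real.log t * (1 - Real.exp (-t))) (𝓝[>] 0) (𝓝 0) := by
    have h3 : Tendsto (fun t => |Real.log t * t|) (𝓝[>] 0) (𝓝 0) := by
      have := (tendsto_log_mul_rpow_nhdsGT_zero one_pos).abs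
      simpa using this
    refine squeeze_zero_norm' ?_ h3
    filter_upwards [self_mem_nhdsWithin] with t ht
    have ht0 : 0 < t := ht
    have h4 := Real.add_one_le_exp (-t)
    have h5 : Real.exp (-t) ≤ 1 := Real.exp_le_one_iff.2 (by linarith)
    rw [Real.norm_eq_abs, abs_mul, abs_mul, abs_of_nonneg (sub_nonneg.2 h5), abs_of_pos ht0]
    gcongr
    linarith
  have h := (h1.add h2).add_const Real.eulerMascheroniConstant
  rw [add_zero, neg_add_cancel] at h
  refine h.congr' ?_
  filter_upwards [self_mem_nhdsWithin] with t ht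
  rw [← expIntE1_add_log_mul_exp_neg ht]
  ring

theorem monotoneOn_nonneg_of_tendsto {h : ℝ → ℝ} (hm : MonotoneOn h (Ioi 0))
    (h0 : Tendsto h (𝓝[>] 0) (𝓝 0)) {t : ℝ} (ht : 0 < t) : 0 ≤ h t := by
  refine le_of_tendsto h0 ?_
  filter_upwards [Ioo_mem_nhdsGT ht] with s hs
  exact hm hs.1 ht hs.2.le

/-- The derivative of `E₁ + log + γ` is `(1 - e^{-s})/s`, which lies in `[0, 1]`, and the function
tends to `0` at `0⁺`. This yields `E₁(ε) = l - γ + O(ε)`. -/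
theorem expIntE1_add_log_bounds {t : ℝ} (ht : 0 < t) :
    0 ≤ expIntE1 t + Real.log t + Real.eulerMascheroniConstant ∧
      expIntE1 t + Real.log t + Real.eulerMascheroniConstant ≤ t := by
  have hd : ∀ s, 0 < s → HasDerivAt
      (fun t => expIntE1 t + Real.log t + Real.eulerMascheroniConstant)
      ((1 - Real.exp (-s)) / s) s := by
    intro s hs
    refine (((hasDerivAt_expIntE1 hs).add (Real.hasDerivAt_log hs.ne')).add_const _).congr_deriv ?_
    field_simp
    ring
  have hE : ∀ s : ℝ, 0 < s → 0 ≤ (1 - Real.exp (-s)) / s ∧ (1 - Real.exp (-s)) / s ≤ 1 := by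
    intro s hs
    have h4 := Real.add_one_le_exp (-s)
    have h5 : Real.exp (-s) ≤ 1 := Real.exp_le_one_iff.2 (by linarith)
    exact ⟨div_nonneg (by linarith) hs.le, (div_le_one hs).2 (by linarith)⟩
  constructor
  · refine monotoneOn_nonneg_of_tendsto ?_ tendsto_expIntE1_add_log ht
    refine monotoneOn_of_deriv_nonneg (convex_Ioi 0)
      (fun s hs => (hd s hs).continuousAt.continuousWithinAt) ?_ ?_
    · rw [interior_Ioi]
      exact fun s hs => (hd s hs).differentiableAt.differentiableWithinAt
    · rw [interior_Ioi]
      intro s hs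
      rw [(hd s hs).deriv]
      exact (hE s hs).1
  · have hd' : ∀ s, 0 < s → HasDerivAt
        (fun t => t - (expIntE1 t + Real.log t + Real.eulerMascheroniConstant))
        (1 - (1 - Real.exp (-s)) / s) s := fun s hs => (hasDerivAt_id s).sub (hd s hs)
    have key := monotoneOn_nonneg_of_tendsto
      (h := fun t => t - (expIntE1 t + Real.log t + Real.eulerMascheroniConstant)) ?_ ?_ ht
    · linarith
    · refine monotoneOn_of_deriv_nonneg (convex_Ioi 0)
        (fun s hs => (hd' s hs).continuousAt.continuousWithinAt) ?_ ?_
      · rw [interior_Ioi]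
        exact fun s hs => (hd' s hs).differentiableAt.differentiableWithinAt
      · rw [interior_Ioi]
        intro s hs
        rw [(hd' s hs).deriv]
        linarith [(hE s hs).2]
    · have : Tendsto (fun t : ℝ => t) (𝓝[>] 0) (𝓝 0) := nhdsWithin_le_nhds
      simpa using this.sub tendsto_expIntE1_add_log

end EulerMascheroni

/-! ### Comparison by monotonicity and the limit at infinity. -/

section MonotoneLimits

theorem antitoneOn_Ici_of_hasDerivAt_nonpos {h h' : ℝ → ℝ} {a : ℝ} (hc : ContinuousOn h (Ici a))
    (hd : ∀ x, a < x → HasDerivAt h (h' x) x) (hneg : ∀ x, a < x → h' x ≤ 0) :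
    AntitoneOn h (Ici a) := by
  refine antitoneOn_of_deriv_nonpos (convex_Ici a) hc ?_ ?_
  · rw [interior_Ici]
    exact fun x hx => (hd x hx).differentiableAt.differentiableWithinAt
  · rw [interior_Ici]
    intro x hx
    rw [(hd x hx).deriv]
    exact hneg x hx

theorem nonneg_of_antitoneOn_of_tendsto {h : ℝ → ℝ} {a : ℝ} (hm : AntitoneOn h (Ici a))
    (h0 : Tendsto h atTop (𝓝 0)) {x : ℝ} (hx : a ≤ x) : 0 ≤ h x := by
  refine le_of_tendsto h0 ?_
  filter_upwards [eventually_ge_atTop x] with y hy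
  exact hm hx (hx.trans hy) hy

end MonotoneLimits

/-! ### The nonlinearity `1 - u` as a function of `F = e - e^u`. -/

section Rate

/-- The function `F ↦ 1 - log (e - F)`, extended by `1` to `F ≥ e - 1`: for `F = e - e^u` with
`u ≥ 0` it is `1 - u`. -/
noncomputable def tailRate (F : ℝ) : ℝ := 1 - Real.log (max 1 (Real.exp 1 - F))

theorem abs_log_sub_log_le {x y : ℝ} (hx : 1 ≤ x) (hy : 1 ≤ y) :
    |Real.log x - Real.log y| ≤ |x - y| := by
  have key : ∀ {x y : ℝ}, 1 ≤ x → 1 ≤ y → Real.log x - Real.log y ≤ |x - y| := by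
    intro x y hx hy
    have hx0 : 0 < x := by linarith
    have hy0 : 0 < y := by linarith
    rw [← Real.log_div hx0.ne' hy0.ne']
    have h1 := Real.log_le_sub_one_of_pos (div_pos hx0 hy0)
    have h2 : x / y - 1 = (x - y) / y := by field_simp
    have h3 : (x - y) / y ≤ |x - y| / y := by gcongr; exact le_abs_self _
    have h4 : |x - y| / y ≤ |x - y| := div_le_self (abs_nonneg _) hy
    linarith
  rw [abs_le]
  refine ⟨?_, key hx hy⟩
  have := key hy hx
  rw [abs_sub_comm] at this
  linarith

/-- The cutoff keeps the argument of the logarithm at least `1`, where `log` is 1-Lipschitz. The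
bound therefore holds for all real arguments, which frees the contraction argument from range
conditions. -/
theorem abs_tailRate_sub_le (a b : ℝ) : |tailRate a - tailRate b| ≤ |a - b| := by
  have h1 := abs_log_sub_log_le (le_max_left 1 (Real.exp 1 - b)) (le_max_left 1 (Real.exp 1 - a))
  have h2 := abs_max_sub_max_le_abs (Real.exp 1 - b) (Real.exp 1 - a) 1
  rw [max_comm _ 1, max_comm _ 1] at h2
  have h3 : tailRate a - tailRate b
      = Real.log (max 1 (Real.exp 1 - b)) - Real.log (max 1 (Real.exp 1 - a)) := by
    rw [tailRate, tailRate]; ring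
  rw [h3]
  refine (h1.trans h2).trans_eq ?_
  congr 1
  ring

theorem continuous_tailRate : Continuous tailRate := by
  unfold tailRate
  refine continuous_const.sub (Continuous.log (by fun_prop) fun x => ?_)
  have := le_max_left 1 (Real.exp 1 - x)
  intro h
  linarith

theorem tailRate_zero : tailRate 0 = 0 := by
  have : (1 : ℝ) ≤ Real.exp 1 := Real.one_le_exp zero_le_one
  simp [tailRate, this]

theorem tailRate_nonneg {F : ℝ} (hF : 0 ≤ F) : 0 ≤ tailRate F := by
  have h1 : max 1 (Real.exp 1 - F) ≤ Real.exp 1 :=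
    max_le (Real.one_le_exp zero_le_one) (by linarith)
  have h2 := Real.log_le_log (by positivity) h1
  rw [Real.log_exp] at h2
  rw [tailRate]
  linarith

theorem tailRate_le_one (F : ℝ) : tailRate F ≤ 1 := by
  have := Real.log_nonneg (le_max_left 1 (Real.exp 1 - F))
  rw [tailRate]
  linarith

theorem tailRate_le_self {F : ℝ} (hF : 0 ≤ F) : tailRate F ≤ F := by
  have := abs_tailRate_sub_le F 0
  rw [tailRate_zero, sub_zero, sub_zero, abs_of_nonneg hF] at this
  exact (le_abs_self _).trans this

theorem tailRate_of_le {F : ℝ} (hF : F ≤ Real.exp 1 - 1) :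
    tailRate F = 1 - Real.log (Real.exp 1 - F) := by
  rw [tailRate, max_eq_right (by linarith)]

end Rate

/-! ### The integral equation: regularity, flux, energy and a priori bounds. -/

section TailSolutions
open MeasureTheory

/-- The integral equation for `F = e - e^u`, with exponent `J`. -/
structure TailSolution (ε C : ℝ) (F J : ℝ → ℝ) : Prop where
  eps_pos : 0 < ε
  const_nonneg : 0 ≤ C
  integrable : IntegrableOn (fun σ => tailRate (F σ)) (Ioi ε)
  J_eq : ∀ τ, ε ≤ τ → J τ = ∫ σ in Ioi τ, tailRate (F σ)
  F_eq : ∀ ρ, ε ≤ ρ → F ρ = C * ∫ τ in Ioi ρ, Real.exp (-τ) / τ * Real.exp (-J τ)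

namespace TailSolution

variable {ε C : ℝ} {F J : ℝ → ℝ}

theorem F_nonneg (h : TailSolution ε C F J) {ρ : ℝ} (hρ : ε ≤ ρ) : 0 ≤ F ρ := by
  rw [h.F_eq ρ hρ]
  refine mul_nonneg h.const_nonneg (setIntegral_Ioi_nonneg fun x hx => ?_)
  have : 0 < x := h.eps_pos.trans (hρ.trans_lt hx)
  positivity

theorem J_nonneg (h : TailSolution ε C F J) {τ : ℝ} (hτ : ε ≤ τ) : 0 ≤ J τ := by
  rw [h.J_eq τ hτ]
  exact setIntegral_Ioi_nonneg fun x hx => tailRate_nonneg (h.F_nonneg (hτ.trans (le_of_lt hx)))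

theorem continuousOn_J (h : TailSolution ε C F J) : ContinuousOn J (Ici ε) :=
  (continuousOn_setIntegral_Ioi h.integrable).congr fun τ hτ => h.J_eq τ hτ

theorem exp_neg_J_le_one (h : TailSolution ε C F J) {τ : ℝ} (hτ : ε ≤ τ) :
    Real.exp (-J τ) ≤ 1 := Real.exp_le_one_iff.2 (neg_nonpos.2 (h.J_nonneg hτ))

theorem continuousOn_integrand (h : TailSolution ε C F J) :
    ContinuousOn (fun τ => Real.exp (-τ) / τ * Real.exp (-J τ)) (Ioi ε) :=
  (continuousOn_exp_neg_div.mono (Ioi_subset_Ioi h.eps_pos.le)).mul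
    (Real.continuous_exp.comp_continuousOn (h.continuousOn_J.mono Ioi_subset_Ici_self).neg)

theorem integrableOn_integrand (h : TailSolution ε C F J) :
    IntegrableOn (fun τ => Real.exp (-τ) / τ * Real.exp (-J τ)) (Ioi ε) := by
  refine IntegrableOn.of_continuousOn_abs_le (integrableOn_exp_neg_div h.eps_pos)
    h.continuousOn_integrand fun x hx => ?_
  have hx0 : 0 < x := h.eps_pos.trans hx
  rw [abs_of_nonneg (by positivity)]
  exact mul_le_of_le_one_right (by positivity) (h.exp_neg_J_le_one hx.le)

theorem continuousOn_F (h : TailSolution ε C F J) : ContinuousOn F (Ici ε) :=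
  (continuousOn_const.mul (continuousOn_setIntegral_Ioi h.integrableOn_integrand)).congr
    fun ρ hρ => h.F_eq ρ hρ

theorem F_le (h : TailSolution ε C F J) {ρ : ℝ} (hρ : ε ≤ ρ) : F ρ ≤ C * expIntE1 ρ := by
  rw [h.F_eq ρ hρ]
  refine mul_le_mul_of_nonneg_left ?_ h.const_nonneg
  refine setIntegral_Ioi_mono (h.integrableOn_integrand.mono_set (Ioi_subset_Ioi hρ))
    (integrableOn_exp_neg_div (h.eps_pos.trans_le hρ)) fun x hx => ?_
  have hx0 : 0 < x := h.eps_pos.trans (hρ.trans_lt hx)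
  exact mul_le_of_le_one_right (by positivity) (h.exp_neg_J_le_one (hρ.trans hx.le))

theorem tendsto_F (h : TailSolution ε C F J) : Tendsto F atTop (𝓝 0) := by
  refine squeeze_zero' (g := fun ρ => C * expIntE1 ρ) ?_ ?_ ?_
  · filter_upwards [eventually_ge_atTop ε] with ρ hρ using h.F_nonneg hρ
  · filter_upwards [eventually_ge_atTop ε] with ρ hρ using h.F_le hρ
  · simpa using tendsto_expIntE1_atTop.const_mul C

theorem tendsto_J (h : TailSolution ε C F J) : Tendsto J atTop (𝓝 0) := by
  refine (tendsto_setIntegral_Ioi_atTop h.integrable).congr' ?_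
  filter_upwards [eventually_ge_atTop ε] with τ hτ using (h.J_eq τ hτ).symm

/-- Combines `tailRate F ≤ F ≤ C E₁`. Since `∫ E₁ ≤ 1`, the exponent is at most `C` uniformly in
`ε`. -/
theorem J_le (h : TailSolution ε C F J) {τ : ℝ} (hτ : ε ≤ τ) : J τ ≤ C * expIntTail τ := by
  have hτ0 := h.eps_pos.trans_le hτ
  rw [h.J_eq τ hτ, ← (expIntTail_integral hτ0).2, ← integral_const_mul]
  refine setIntegral_Ioi_mono (h.integrable.mono_set (Ioi_subset_Ioi hτ))
    ((expIntTail_integral hτ0).1.const_mul C) fun x hx => ?_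
  have hx' := hτ.trans hx.le
  exact (tailRate_le_self (h.F_nonneg hx')).trans (h.F_le hx')

theorem J_le_const (h : TailSolution ε C F J) {τ : ℝ} (hτ : ε ≤ τ) : J τ ≤ C :=
  (h.J_le hτ).trans
    (mul_le_of_le_one_right h.const_nonneg (expIntTail_le_one (h.eps_pos.trans_le hτ)))

theorem continuousOn_rate (h : TailSolution ε C F J) :
    ContinuousOn (fun σ => tailRate (F σ)) (Ici ε) :=
  continuous_tailRate.comp_continuousOn h.continuousOn_F

theorem hasDerivAt_J (h : TailSolution ε C F J) {τ : ℝ} (hτ : ε < τ) :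
    HasDerivAt J (-tailRate (F τ)) τ := by
  refine (hasDerivAt_setIntegral_Ioi h.integrable
    (h.continuousOn_rate.mono Ioi_subset_Ici_self) hτ).congr_of_eventuallyEq ?_
  filter_upwards [Ioi_mem_nhds hτ] with y hy using h.J_eq y (le_of_lt hy)

/-- The flux `ρ (e^u)'`. -/
noncomputable def flux (C : ℝ) (J : ℝ → ℝ) (ρ : ℝ) : ℝ := C * Real.exp (-(ρ + J ρ))

theorem hasDerivAt_F (h : TailSolution ε C F J) {ρ : ℝ} (hρ : ε < ρ) :
    HasDerivAt F (-(flux C J ρ / ρ)) ρ := by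
  have h1 := (hasDerivAt_setIntegral_Ioi h.integrableOn_integrand
    h.continuousOn_integrand hρ).const_mul C
  refine (h1.congr_of_eventuallyEq ?_).congr_deriv ?_
  · filter_upwards [Ioi_mem_nhds hρ] with y hy using h.F_eq y (le_of_lt hy)
  · rw [flux, neg_add, Real.exp_add]
    ring

theorem hasDerivAt_flux (h : TailSolution ε C F J) {ρ : ℝ} (hρ : ε < ρ) :
    HasDerivAt (flux C J) (-((1 - tailRate (F ρ)) * flux C J ρ)) ρ := by
  have h1 := (((hasDerivAt_id ρ).add (h.hasDerivAt_J hρ)).neg.exp).const_mul C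
  refine h1.congr_deriv ?_
  simp only [flux, Pi.neg_apply, Pi.add_apply, id]
  ring

theorem continuousOn_flux (h : TailSolution ε C F J) : ContinuousOn (flux C J) (Ici ε) :=
  continuousOn_const.mul (Real.continuous_exp.comp_continuousOn
    (continuousOn_id.add h.continuousOn_J).neg)

theorem flux_nonneg (h : TailSolution ε C F J) (ρ : ℝ) : 0 ≤ flux C J ρ :=
  mul_nonneg h.const_nonneg (Real.exp_pos _).le

theorem antitoneOn_F (h : TailSolution ε C F J) : AntitoneOn F (Ici ε) :=
  antitoneOn_Ici_of_hasDerivAt_nonpos h.continuousOn_F (fun _ hx => h.hasDerivAt_F hx)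
    fun x hx => neg_nonpos.2 (div_nonneg (h.flux_nonneg x) (h.eps_pos.trans hx).le)

theorem antitoneOn_flux (h : TailSolution ε C F J) : AntitoneOn (flux C J) (Ici ε) :=
  antitoneOn_Ici_of_hasDerivAt_nonpos h.continuousOn_flux (fun _ hx => h.hasDerivAt_flux hx)
    fun x _ => neg_nonpos.2 (mul_nonneg (sub_nonneg.2 (tailRate_le_one _)) (h.flux_nonneg x))

theorem tendsto_flux (h : TailSolution ε C F J) : Tendsto (flux C J) atTop (𝓝 0) := by
  refine squeeze_zero' (g := fun ρ => C * Real.exp (-ρ)) ?_ ?_ ?_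
  · exact Eventually.of_forall h.flux_nonneg
  · filter_upwards [eventually_ge_atTop ε] with ρ hρ
    have := h.J_nonneg hρ
    have := h.const_nonneg
    rw [flux]
    gcongr
    linarith
  · simpa using Real.tendsto_exp_neg_atTop_nhds_zero.const_mul C

/-- The quantity `ρ (e^u)' + ρ (u - 1) e^u`, whose derivative is `(u - 1) e^u`. -/
noncomputable def energy (C : ℝ) (F J : ℝ → ℝ) (ρ : ℝ) : ℝ :=
  flux C J ρ + ρ * ((Real.exp 1 - F ρ) * Real.log (Real.exp 1 - F ρ) - (Real.exp 1 - F ρ))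

theorem F_le_of_left (h : TailSolution ε C F J) (h1 : F ε ≤ Real.exp 1 - 1) {ρ : ℝ}
    (hρ : ε ≤ ρ) : F ρ ≤ Real.exp 1 - 1 :=
  (h.antitoneOn_F self_mem_Ici hρ hρ).trans h1

theorem continuousOn_energy (h : TailSolution ε C F J) (h1 : F ε ≤ Real.exp 1 - 1) :
    ContinuousOn (energy C F J) (Ici ε) := by
  have hW : ContinuousOn (fun ρ => Real.exp 1 - F ρ) (Ici ε) :=
    continuousOn_const.sub h.continuousOn_F
  refine h.continuousOn_flux.add (continuousOn_id.mul ((hW.mul (hW.log fun x hx => ?_)).sub hW))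
  have := h.F_le_of_left h1 hx
  intro h0
  linarith

/-- The flux contributes `-u q` and the derivative of `W log W - W` contributes `ρ W' log W = q u`;
these cancel. The condition on `F ε` makes the cutoff in `tailRate` inactive. -/
theorem hasDerivAt_energy (h : TailSolution ε C F J) (h1 : F ε ≤ Real.exp 1 - 1) {ρ : ℝ}
    (hρ : ε < ρ) : HasDerivAt (energy C F J)
      ((Real.exp 1 - F ρ) * Real.log (Real.exp 1 - F ρ) - (Real.exp 1 - F ρ)) ρ := by
  have hF := h.F_le_of_left h1 hρ.le
  have hρ0 : 0 < ρ := h.eps_pos.trans hρ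
  have hW0 : Real.exp 1 - F ρ ≠ 0 := by
    intro h0
    linarith
  have hW := (h.hasDerivAt_F hρ).const_sub (Real.exp 1)
  have h2 := (h.hasDerivAt_flux hρ).add
    ((hasDerivAt_id ρ).mul ((hW.mul (hW.log hW0)).sub hW))
  refine h2.congr_deriv ?_
  rw [tailRate_of_le hF]
  simp only [id, Pi.mul_apply, Pi.sub_apply]
  field_simp
  ring

theorem tendsto_energy (h : TailSolution ε C F J) (h1 : F ε ≤ Real.exp 1 - 1) :
    Tendsto (energy C F J) atTop (𝓝 0) := by
  have h2 : Tendsto (fun ρ => ρ * ((Real.exp 1 - F ρ) * Real.log (Real.exp 1 - F ρ)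
      - (Real.exp 1 - F ρ))) atTop (𝓝 0) := by
    refine squeeze_zero_norm' (a := fun ρ => Real.exp 1 * C * (ρ * expIntE1 ρ)) ?_ ?_
    · filter_upwards [eventually_ge_atTop ε] with ρ hρ
      have hF := h.F_le_of_left h1 hρ
      have hF0 := h.F_nonneg hρ
      have h3 := tailRate_le_self hF0
      have h4 := tailRate_nonneg hF0
      rw [tailRate_of_le hF] at h3 h4
      have hρ0 : 0 < ρ := h.eps_pos.trans_le hρ
      have h5 : (Real.exp 1 - F ρ) * Real.log (Real.exp 1 - F ρ) - (Real.exp 1 - F ρ)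
          = -((Real.exp 1 - F ρ) * (1 - Real.log (Real.exp 1 - F ρ))) := by ring
      rw [h5, Real.norm_eq_abs, abs_mul, abs_neg, abs_of_pos hρ0,
        abs_of_nonneg (mul_nonneg (by linarith) h4)]
      have h6 : (Real.exp 1 - F ρ) * (1 - Real.log (Real.exp 1 - F ρ))
          ≤ Real.exp 1 * (C * expIntE1 ρ) :=
        mul_le_mul (by linarith) (h3.trans (h.F_le hρ)) h4 (Real.exp_pos _).le
      calc _ ≤ ρ * (Real.exp 1 * (C * expIntE1 ρ)) := by gcongr
        _ = _ := by ring
    · simpa using tendsto_mul_expIntE1_atTop.const_mul (Real.exp 1 * C)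
  simpa using (show Tendsto (energy C F J) atTop (𝓝 (0 + 0)) from h.tendsto_flux.add h2)

/-- With `W = e - F ≥ 1`, the derivative of `energy - J` is `-(W - 1)(1 - log W) ≤ 0` and its limit
is `0`, so `J ≤ energy`; and `energy ≤ flux` because `log W ≤ 1`. -/
theorem J_le_flux (h : TailSolution ε C F J) (h1 : F ε ≤ Real.exp 1 - 1) {ρ : ℝ} (hρ : ε ≤ ρ) :
    J ρ ≤ flux C J ρ := by
  have hlog : ∀ x, ε ≤ x → 0 ≤ 1 - Real.log (Real.exp 1 - F x) := by
    intro x hx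
    have := tailRate_nonneg (h.F_nonneg hx)
    rwa [tailRate_of_le (h.F_le_of_left h1 hx)] at this
  have h2 : AntitoneOn (fun ρ => energy C F J ρ - J ρ) (Ici ε) := by
    refine antitoneOn_Ici_of_hasDerivAt_nonpos ((h.continuousOn_energy h1).sub h.continuousOn_J)
      (fun x hx => (h.hasDerivAt_energy h1 hx).sub (h.hasDerivAt_J hx)) fun x hx => ?_
    have h3 := hlog x hx.le
    have h4 := h.F_le_of_left h1 hx.le
    rw [tailRate_of_le h4]
    nlinarith
  have h5 : Tendsto (fun ρ => energy C F J ρ - J ρ) atTop (𝓝 0) := by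
    simpa using (h.tendsto_energy h1).sub h.tendsto_J
  have h6 := nonneg_of_antitoneOn_of_tendsto h2 h5 hρ
  have h7 : energy C F J ρ ≤ flux C J ρ := by
    have h3 := hlog ρ hρ
    have h4 := h.F_le_of_left h1 hρ
    have h8 : 0 ≤ ρ * ((Real.exp 1 - F ρ) * (1 - Real.log (Real.exp 1 - F ρ))) :=
      mul_nonneg (h.eps_pos.trans_le hρ).le (mul_nonneg (by linarith) h3)
    rw [energy]
    linarith
  linarith

/-- The flux decreases, so `-F' ≥ flux(b)/ρ` on `[ε, b]`; integrate this. -/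
theorem flux_mul_log_le (h : TailSolution ε C F J) {b : ℝ} (hb : ε ≤ b) :
    flux C J b * Real.log (b / ε) ≤ F ε := by
  have hb0 : 0 < b := h.eps_pos.trans_le hb
  have h1 : AntitoneOn (fun ρ => F ρ + flux C J b * Real.log ρ) (Icc ε b) := by
    refine antitoneOn_of_deriv_nonpos (convex_Icc ε b) ?_ ?_ ?_
    · refine (h.continuousOn_F.mono Icc_subset_Ici_self).add (continuousOn_const.mul ?_)
      exact Real.continuousOn_log.mono fun x hx => (h.eps_pos.trans_le hx.1).ne'
    · rw [interior_Icc]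
      intro x hx
      exact ((h.hasDerivAt_F hx.1).add ((Real.hasDerivAt_log
        (h.eps_pos.trans hx.1).ne').const_mul _)).differentiableAt.differentiableWithinAt
    · rw [interior_Icc]
      intro x hx
      have hx0 := h.eps_pos.trans hx.1
      have hd : HasDerivAt (fun ρ => F ρ + flux C J b * Real.log ρ)
          (-(flux C J x / x) + flux C J b * x⁻¹) x :=
        (h.hasDerivAt_F hx.1).add ((Real.hasDerivAt_log hx0.ne').const_mul _)
      rw [hd.deriv]
      have h2 := h.antitoneOn_flux hx.1.le hb hx.2.le
      have h3 : flux C J b / x ≤ flux C J x / x := by gcongr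
      rw [← div_eq_mul_inv]
      linarith
  have h2 := h1 (left_mem_Icc.2 hb) (right_mem_Icc.2 hb) hb
  have h3 := h.F_nonneg hb
  rw [Real.log_div hb0.ne' h.eps_pos.ne']
  simp only at h2
  linarith

/-- Write `C = flux(b) e^{b + J(b)}`. The logarithmic bound controls `flux(b)`, and then `J(b) ≤
flux(b)` controls the exponential. It is used with `b = ε + 1` to bracket the shooting parameter and
with `b = 1` to get `C = O(1/l)`. -/
theorem const_le (h : TailSolution ε C F J) (h1 : F ε ≤ Real.exp 1 - 1) {b : ℝ} (hb : ε < b) :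
    C ≤ (Real.exp 1 - 1) / Real.log (b / ε) *
      Real.exp (b + (Real.exp 1 - 1) / Real.log (b / ε)) := by
  have h2 := (h.flux_mul_log_le hb.le).trans h1
  have hlog : 0 < Real.log (b / ε) := Real.log_pos ((one_lt_div h.eps_pos).2 hb)
  have h3 := (le_div_iff₀ hlog).2 h2
  have h4 := (h.J_le_flux h1 hb.le).trans h3
  have h5 : C = flux C J b * Real.exp (b + J b) := by
    rw [flux, mul_assoc, ← Real.exp_add, neg_add_cancel, Real.exp_zero, mul_one]
  have h6 := (h.flux_nonneg b).trans h3
  calc C = flux C J b * Real.exp (b + J b) := h5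
    _ ≤ _ := by gcongr

end TailSolution

end TailSolutions

/-! ### Uniqueness by comparison of energies. -/

section Uniqueness
open MeasureTheory

/-- Only difference quotients from the left enter, so nothing is needed to the right of `b`. -/
theorem deriv_nonpos_of_min_right {D : ℝ → ℝ} {d a b : ℝ} (hab : a < b) (hd : HasDerivAt D d b)
    (hmin : ∀ y ∈ Icc a b, D b ≤ D y) : d ≤ 0 := by
  have h1 : IsLocalMinOn D (Icc a b) b := IsMinOn.localize fun y hy => hmin y hy
  have h2 := h1.hasFDerivWithinAt_nonneg (y := a - b) hd.hasFDerivAt.hasFDerivWithinAt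
    (mem_posTangentConeAt_of_segment_subset (by
      rw [add_sub_cancel, segment_symm, segment_eq_Icc hab.le]))
  simp only [ContinuousLinearMap.toSpanSingleton_apply, smul_eq_mul] at h2
  by_contra hpos
  push Not at hpos
  nlinarith

theorem mul_log_sub_self_strictMono {x y : ℝ} (hx : 1 ≤ x) (hxy : x < y) :
    x * Real.log x - x < y * Real.log y - y := by
  have hmono : StrictMonoOn (fun w => w * Real.log w - w) (Ici 1) := by
    refine strictMonoOn_of_deriv_pos (convex_Ici 1) ?_ ?_
    · exact (Real.continuous_mul_log.sub continuous_id).continuousOn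
    · rw [interior_Ici]
      intro w hw
      have hw1 : 1 < w := hw
      have hd : HasDerivAt (fun w => w * Real.log w - w) (Real.log w + 1 - 1) w :=
        (Real.hasDerivAt_mul_log (by linarith)).sub (hasDerivAt_id w)
      rw [hd.deriv]
      have := Real.log_pos hw1
      linarith
  exact hmono hx (hx.trans hxy.le) hxy

namespace TailSolution

variable {ε C₁ C₂ : ℝ} {F₁ F₂ J₁ J₂ : ℝ → ℝ}

theorem energy_antitoneOn_sub (h₁ : TailSolution ε C₁ F₁ J₁) (h₂ : TailSolution ε C₂ F₂ J₂)
    (hF₁ : F₁ ε ≤ Real.exp 1 - 1) (hF₂ : F₂ ε ≤ Real.exp 1 - 1) {s : Set ℝ} (hs : Convex ℝ s)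
    (hsub : s ⊆ Ioi ε) (hle : ∀ y ∈ s, F₂ y ≤ F₁ y) :
    AntitoneOn (fun ρ => energy C₁ F₁ J₁ ρ - energy C₂ F₂ J₂ ρ) s := by
  have hd : ∀ y ∈ s, HasDerivAt (fun ρ => energy C₁ F₁ J₁ ρ - energy C₂ F₂ J₂ ρ)
      (((Real.exp 1 - F₁ y) * Real.log (Real.exp 1 - F₁ y) - (Real.exp 1 - F₁ y)) -
        ((Real.exp 1 - F₂ y) * Real.log (Real.exp 1 - F₂ y) - (Real.exp 1 - F₂ y))) y :=
    fun y hy => (h₁.hasDerivAt_energy hF₁ (hsub hy)).sub (h₂.hasDerivAt_energy hF₂ (hsub hy))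
  refine antitoneOn_of_deriv_nonpos hs (fun y hy => (hd y hy).continuousAt.continuousWithinAt)
    (fun y hy => (hd y (interior_subset hy)).differentiableAt.differentiableWithinAt)
    fun y hy => ?_
  have hy' := interior_subset hy
  rw [(hd y hy').deriv]
  have h3 := hle y hy'
  have h4 := h₁.F_le_of_left hF₁ (le_of_lt (hsub hy'))
  rcases h3.eq_or_lt with h5 | h5
  · rw [h5, sub_self]
  · have := mul_log_sub_self_strictMono (x := Real.exp 1 - F₁ y) (y := Real.exp 1 - F₂ y)
      (by linarith) (by linarith)
    linarith

/-- While `F₂ ≤ F₁`, the energy difference is nonincreasing. Followed to infinity, or to the first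
zero of `F₁ - F₂`, it ends nonnegative, so it is nonnegative at `x`. There `W log W - W` is strictly
smaller for the first solution, so its flux must be strictly larger. -/
theorem flux_lt_of_F_lt (h₁ : TailSolution ε C₁ F₁ J₁) (h₂ : TailSolution ε C₂ F₂ J₂)
    (hF₁ : F₁ ε ≤ Real.exp 1 - 1) (hF₂ : F₂ ε ≤ Real.exp 1 - 1) {x : ℝ} (hx : ε < x)
    (hlt : F₂ x < F₁ x) : flux C₂ J₂ x < flux C₁ J₁ x := by
  have hx0 : 0 < x := h₁.eps_pos.trans hx
  have key : 0 ≤ energy C₁ F₁ J₁ x - energy C₂ F₂ J₂ x := by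
    by_cases hall : ∀ y, x ≤ y → F₂ y ≤ F₁ y
    · refine nonneg_of_antitoneOn_of_tendsto (h₁.energy_antitoneOn_sub h₂ hF₁ hF₂ (convex_Ici x)
        (fun y hy => hx.trans_le hy) hall) ?_ le_rfl
      simpa using (h₁.tendsto_energy hF₁).sub (h₂.tendsto_energy hF₂)
    · push Not at hall
      obtain ⟨y₀, hxy₀, hy₀⟩ := hall
      have hcont : ContinuousOn (fun y => F₁ y - F₂ y) (Ici x) :=
        (h₁.continuousOn_F.sub h₂.continuousOn_F).mono (Ici_subset_Ici.2 hx.le)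
      have hzero : ∀ w, x ≤ w → F₁ w < F₂ w → ∃ v ∈ Icc x w, F₁ v - F₂ v = 0 := by
        intro w hxw hw
        exact intermediate_value_Icc' hxw (hcont.mono Icc_subset_Ici_self)
          ⟨by linarith, by linarith⟩
      have hcomp : IsCompact (Icc x y₀ ∩ (fun y => F₁ y - F₂ y) ⁻¹' {0}) :=
        isCompact_Icc.of_isClosed_subset
          ((hcont.mono Icc_subset_Ici_self).preimage_isClosed_of_isClosed
          isClosed_Icc isClosed_singleton) inter_subset_left
      obtain ⟨v, hv, hv0⟩ := hzero y₀ hxy₀ hy₀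
      -- The first zero of `F₁ - F₂` after `x`; before it the difference cannot be negative, by the
      -- intermediate value theorem.
      obtain ⟨z, hz, hzmin⟩ := hcomp.exists_isLeast ⟨v, hv, hv0⟩
      have hz0 : F₁ z - F₂ z = 0 := hz.2
      have hxz : x < z := by
        rcases hz.1.1.eq_or_lt with h | h
        · rw [← h] at hz0
          linarith
        · exact h
      have hpos : ∀ y ∈ Icc x z, F₂ y ≤ F₁ y := by
        intro y hy
        by_contra hcon
        push Not at hcon
        obtain ⟨v, hv, hv0⟩ := hzero y hy.1 hcon
        have h3 := hzmin ⟨⟨hv.1, hv.2.trans (hy.2.trans hz.1.2)⟩, hv0⟩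
        have h4 : y = z := le_antisymm hy.2 (h3.trans hv.2)
        rw [h4] at hcon
        linarith
      have hanti := h₁.energy_antitoneOn_sub h₂ hF₁ hF₂ (convex_Icc x z)
        (fun y hy => hx.trans_le hy.1) hpos
      have h5 := hanti (left_mem_Icc.2 hxz.le) (right_mem_Icc.2 hxz.le) hxz.le
      have hεz : ε < z := hx.trans hxz
      -- The difference descends to `0` at `z`, which orders the fluxes there; where the defects
      -- agree, the energies differ by the fluxes alone.
      have h6 := deriv_nonpos_of_min_right (D := fun y => F₁ y - F₂ y) hxz
        ((h₁.hasDerivAt_F hεz).sub (h₂.hasDerivAt_F hεz)) (fun y hy => by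
          have := hpos y hy
          linarith)
      have h7 : F₁ z = F₂ z := by linarith
      have h8 : flux C₂ J₂ z / z ≤ flux C₁ J₁ z / z := by linarith
      rw [div_le_div_iff_of_pos_right (hx0.trans hxz)] at h8
      have h9 : energy C₁ F₁ J₁ z - energy C₂ F₂ J₂ z = flux C₁ J₁ z - flux C₂ J₂ z := by
        rw [energy, energy, h7]
        ring
      simp only at h5
      linarith
  have h3 := h₁.F_le_of_left hF₁ hx.le
  have h4 := mul_log_sub_self_strictMono (x := Real.exp 1 - F₁ x) (y := Real.exp 1 - F₂ x)
    (by linarith) (by linarith)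
  have h5 := mul_lt_mul_of_pos_left h4 hx0
  rw [energy, energy] at key
  linarith

/-- At a positive maximum `m` of `F₁ - F₂` on `[ε, x]` the left derivative is nonnegative, so `flux₁
≤ flux₂` at `m`, against the strict inequality of `flux_lt_of_F_lt`. -/
theorem F_le_of_eq_left (h₁ : TailSolution ε C₁ F₁ J₁) (h₂ : TailSolution ε C₂ F₂ J₂)
    (hF₁ : F₁ ε = Real.exp 1 - 1) (hF₂ : F₂ ε = Real.exp 1 - 1) {x : ℝ} (hx : ε ≤ x) :
    F₁ x ≤ F₂ x := by
  by_contra hcon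
  push Not at hcon
  obtain ⟨m, hm, hmax⟩ := isCompact_Icc.exists_isMaxOn (nonempty_Icc.2 hx)
    ((h₁.continuousOn_F.sub h₂.continuousOn_F).mono Icc_subset_Ici_self)
  have hmx : F₁ x - F₂ x ≤ F₁ m - F₂ m := hmax (right_mem_Icc.2 hx)
  have hεm : ε < m := by
    rcases hm.1.eq_or_lt with h | h
    · rw [← h, hF₁, hF₂] at hmx
      linarith
    · exact h
  have h3 := deriv_nonpos_of_min_right (D := fun y => F₂ y - F₁ y) hεm
    ((h₂.hasDerivAt_F hεm).sub (h₁.hasDerivAt_F hεm)) (fun y hy => by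
      have : F₁ y - F₂ y ≤ F₁ m - F₂ m := hmax ⟨hy.1, hy.2.trans hm.2⟩
      linarith)
  have h4 := h₁.flux_lt_of_F_lt h₂ hF₁.le hF₂.le hεm (by linarith)
  have h5 := (div_lt_div_iff_of_pos_right (h₁.eps_pos.trans hεm)).2 h4
  linarith

theorem F_eq_of_eq_left (h₁ : TailSolution ε C₁ F₁ J₁) (h₂ : TailSolution ε C₂ F₂ J₂)
    (hF₁ : F₁ ε = Real.exp 1 - 1) (hF₂ : F₂ ε = Real.exp 1 - 1) {x : ℝ} (hx : ε ≤ x) :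
    F₁ x = F₂ x :=
  le_antisymm (h₁.F_le_of_eq_left h₂ hF₁ hF₂ hx) (h₂.F_le_of_eq_left h₁ hF₂ hF₁ hx)

end TailSolution

end Uniqueness

/-! ### Existence: a weighted contraction, then shooting in `C`. -/

section Existence
open MeasureTheory BoundedContinuousFunction

/-- The right-hand side of the integral equation for `e - e^u` with exponent `|J|`. -/
noncomputable def tailProfile (C : ℝ) (J : ℝ → ℝ) (ρ : ℝ) : ℝ :=
  C * ∫ τ in Ioi ρ, Real.exp (-τ) / τ * Real.exp (-|J τ|)

/-- The exponent produced by the exponent `|J|`, continued by a constant to the left of `ε`. -/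
noncomputable def nextExponent (ε C : ℝ) (J : ℝ → ℝ) (τ : ℝ) : ℝ :=
  ∫ σ in Ioi (max τ ε), tailRate (tailProfile C J σ)

variable {ε C K : ℝ} {J J₁ J₂ : ℝ → ℝ}

theorem exp_neg_exp_primitive (hK : 0 < K) {a : ℝ} (ha : 0 < a) :
    IntegrableOn (fun s => Real.exp (-s) * Real.exp (K * Real.exp (-s))) (Ioi a) ∧
      ∫ s in Ioi a, Real.exp (-s) * Real.exp (K * Real.exp (-s))
        = (Real.exp (K * Real.exp (-a)) - 1) / K := by
  refine integrableOn_and_integral_eq_of_primitive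
    (G := fun a => (Real.exp (K * Real.exp (-a)) - 1) / K) (fun t _ => ?_)
      (fun _ _ => by positivity)
    ?_ ha
  · refine ((((hasDerivAt_exp_neg t).const_mul K).exp.sub_const 1).div_const K).congr_deriv ?_
    field_simp
  · have h := (((Real.continuous_exp.tendsto _).comp
      (Real.tendsto_exp_neg_atTop_nhds_zero.const_mul K)).sub_const 1).div_const K
    simpa [Function.comp_def] using h

theorem abs_exp_neg_abs_sub_le (a b : ℝ) : |Real.exp (-|a|) - Real.exp (-|b|)| ≤ |a - b| := by
  have key : ∀ x y : ℝ, 0 ≤ x → x ≤ y → |Real.exp (-x) - Real.exp (-y)| ≤ y - x := by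
    intro x y hx hxy
    have h1 : Real.exp (-y) ≤ Real.exp (-x) := Real.exp_le_exp.2 (by linarith)
    have h2 : Real.exp (-y) = Real.exp (-x) * Real.exp (-(y - x)) := by
      rw [← Real.exp_add]; congr 1; ring
    have h3 := Real.add_one_le_exp (-(y - x))
    have h4 : Real.exp (-x) ≤ 1 := Real.exp_le_one_iff.2 (by linarith)
    have h5 : 0 < Real.exp (-x) := Real.exp_pos _
    rw [abs_of_nonneg (by linarith), h2]
    nlinarith
  refine le_trans ?_ (abs_abs_sub_abs_le a b)
  rcases le_total |a| |b| with h | h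
  · rw [abs_sub_comm |a|, abs_of_nonneg (sub_nonneg.2 h)]
    exact key _ _ (abs_nonneg _) h
  · rw [abs_of_nonneg (sub_nonneg.2 h), abs_sub_comm]
    exact key _ _ (abs_nonneg _) h

theorem continuousOn_profile_integrand (hJ : Continuous J) :
    ContinuousOn (fun τ => Real.exp (-τ) / τ * Real.exp (-|J τ|)) (Ioi 0) :=
  continuousOn_exp_neg_div.mul (by fun_prop)

theorem integrableOn_profile_integrand (hJ : Continuous J) {a : ℝ} (ha : 0 < a) :
    IntegrableOn (fun τ => Real.exp (-τ) / τ * Real.exp (-|J τ|)) (Ioi a) := by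
  refine IntegrableOn.of_continuousOn_abs_le (integrableOn_exp_neg_div ha)
    ((continuousOn_profile_integrand hJ).mono (Ioi_subset_Ioi ha.le)) fun x hx => ?_
  have hx0 : 0 < x := ha.trans hx
  rw [abs_of_nonneg (by positivity)]
  exact mul_le_of_le_one_right (by positivity)
    (Real.exp_le_one_iff.2 (neg_nonpos.2 (abs_nonneg _)))

theorem profile_integral_bounds (hJ : Continuous J) {a : ℝ} (ha : 0 < a) :
    0 ≤ ∫ τ in Ioi a, Real.exp (-τ) / τ * Real.exp (-|J τ|) ∧
      ∫ τ in Ioi a, Real.exp (-τ) / τ * Real.exp (-|J τ|) ≤ expIntE1 a := by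
  constructor
  · refine setIntegral_Ioi_nonneg fun x hx => ?_
    have hx0 : 0 < x := ha.trans hx
    positivity
  · refine setIntegral_Ioi_mono (integrableOn_profile_integrand hJ ha)
      (integrableOn_exp_neg_div ha) fun x hx => ?_
    have hx0 : 0 < x := ha.trans hx
    exact mul_le_of_le_one_right (by positivity)
      (Real.exp_le_one_iff.2 (neg_nonpos.2 (abs_nonneg _)))

theorem tailProfile_nonneg (hC : 0 ≤ C) (hJ : Continuous J) {a : ℝ} (ha : 0 < a) :
    0 ≤ tailProfile C J a := mul_nonneg hC (profile_integral_bounds hJ ha).1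

theorem tailProfile_le (hC : 0 ≤ C) (hJ : Continuous J) {a : ℝ} (ha : 0 < a) :
    tailProfile C J a ≤ C * expIntE1 a :=
  mul_le_mul_of_nonneg_left (profile_integral_bounds hJ ha).2 hC

theorem continuousOn_tailProfile (hJ : Continuous J) {a : ℝ} (ha : 0 < a) :
    ContinuousOn (tailProfile C J) (Ici a) :=
  continuousOn_const.mul (continuousOn_setIntegral_Ioi (integrableOn_profile_integrand hJ ha))

theorem integrableOn_rate_tailProfile (hC : 0 ≤ C) (hJ : Continuous J) {a : ℝ} (ha : 0 < a) :
    IntegrableOn (fun σ => tailRate (tailProfile C J σ)) (Ioi a) := by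
  refine IntegrableOn.of_continuousOn_abs_le ((expIntTail_integral ha).1.const_mul C)
    ((continuous_tailRate.comp_continuousOn (continuousOn_tailProfile hJ ha)).mono
      Ioi_subset_Ici_self) fun x hx => ?_
  have hx0 := ha.trans hx
  have h0 := tailProfile_nonneg hC hJ hx0
  rw [abs_of_nonneg (tailRate_nonneg h0)]
  exact (tailRate_le_self h0).trans (tailProfile_le hC hJ hx0)

theorem nextExponent_nonneg (hε : 0 < ε) (hC : 0 ≤ C) (hJ : Continuous J) (τ : ℝ) :
    0 ≤ nextExponent ε C J τ :=
  setIntegral_Ioi_nonneg fun _ hx => tailRate_nonneg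
    (tailProfile_nonneg hC hJ (hε.trans ((le_max_right _ _).trans_lt hx)))

theorem nextExponent_le (hε : 0 < ε) (hC : 0 ≤ C) (hJ : Continuous J) (τ : ℝ) :
    nextExponent ε C J τ ≤ C := by
  have ha : 0 < max τ ε := hε.trans_le (le_max_right _ _)
  calc nextExponent ε C J τ ≤ ∫ σ in Ioi (max τ ε), C * expIntE1 σ := by
        refine setIntegral_Ioi_mono (integrableOn_rate_tailProfile hC hJ ha)
          ((expIntTail_integral ha).1.const_mul C) fun x hx => ?_
        have hx0 := ha.trans hx
        exact (tailRate_le_self (tailProfile_nonneg hC hJ hx0)).trans (tailProfile_le hC hJ hx0)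
    _ = C * expIntTail (max τ ε) := by rw [integral_const_mul, (expIntTail_integral ha).2]
    _ ≤ C := mul_le_of_le_one_right hC (expIntTail_le_one ha)

theorem continuous_nextExponent (hε : 0 < ε) (hC : 0 ≤ C) (hJ : Continuous J) :
    Continuous (nextExponent ε C J) :=
  (continuousOn_setIntegral_Ioi (integrableOn_rate_tailProfile hC hJ hε)).comp_continuous
    (by fun_prop) fun τ => mem_Ici.2 (le_max_right τ ε)

/-- The weight `exp (K e^{-s})` is chosen so that `e^{-s}` times it has an elementary primitive with
a factor `1/K`; `1/s ≤ 1/ε` removes the singular factor. -/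
theorem abs_tailProfile_sub_le (hε : 0 < ε) (hC : 0 ≤ C) (hK : 0 < K) (hJ₁ : Continuous J₁)
    (hJ₂ : Continuous J₂) {d : ℝ}
    (hd : ∀ s, ε ≤ s → |J₁ s - J₂ s| ≤ d * Real.exp (K * Real.exp (-s))) {σ : ℝ} (hσ : ε ≤ σ) :
    |tailProfile C J₁ σ - tailProfile C J₂ σ|
      ≤ C * (d / ε) * ((Real.exp (K * Real.exp (-σ)) - 1) / K) := by
  have hσ0 := hε.trans_le hσ
  have hp := exp_neg_exp_primitive hK hσ0
  rw [tailProfile, tailProfile, ← mul_sub, abs_mul, abs_of_nonneg hC, mul_assoc]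
  refine mul_le_mul_of_nonneg_left ?_ hC
  rw [← integral_sub (integrableOn_profile_integrand hJ₁ hσ0)
    (integrableOn_profile_integrand hJ₂ hσ0), ← hp.2, ← integral_const_mul]
  refine abs_setIntegral_Ioi_le (hp.1.const_mul _) fun x hx => ?_
  have hεx : ε ≤ x := hσ.trans hx.le
  have hx0 := hε.trans_le hεx
  have hdx := hd x hεx
  have h1 := (abs_exp_neg_abs_sub_le (J₁ x) (J₂ x)).trans hdx
  rw [← mul_sub, abs_mul, abs_of_nonneg (by positivity)]
  calc Real.exp (-x) / x * |Real.exp (-|J₁ x|) - Real.exp (-|J₂ x|)|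
      ≤ Real.exp (-x) / ε * (d * Real.exp (K * Real.exp (-x))) := by gcongr
    _ = d / ε * (Real.exp (-x) * Real.exp (K * Real.exp (-x))) := by ring

theorem exp_sub_one_le_mul_exp (y : ℝ) : Real.exp y - 1 ≤ y * Real.exp y := by
  have h1 := Real.add_one_le_exp (-y)
  have h2 : Real.exp (-y) * Real.exp y = 1 := by rw [← Real.exp_add]; simp
  nlinarith [Real.exp_pos y]

/-- Two integrations against the weight reproduce it: the first gives `(e^y - 1)/K` with `y = K
e^{-s}`, and `e^y - 1 ≤ y e^y` restores the integrable factor `e^{-s}` for the second. The net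
factor `C/(εK)` is small when `K` is large, whatever `C` and `ε` are. -/
theorem abs_nextExponent_sub_le (hε : 0 < ε) (hC : 0 ≤ C) (hK : 0 < K) (hJ₁ : Continuous J₁)
    (hJ₂ : Continuous J₂) {d : ℝ} (hd0 : 0 ≤ d)
    (hd : ∀ s, ε ≤ s → |J₁ s - J₂ s| ≤ d * Real.exp (K * Real.exp (-s))) (τ : ℝ) :
    |nextExponent ε C J₁ τ - nextExponent ε C J₂ τ|
      ≤ C / (ε * K) * d * Real.exp (K * Real.exp (-max τ ε)) := by
  have hεa : ε ≤ max τ ε := le_max_right _ _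
  have ha : 0 < max τ ε := hε.trans_le hεa
  have hp := exp_neg_exp_primitive hK ha
  rw [nextExponent, nextExponent, ← integral_sub (integrableOn_rate_tailProfile hC hJ₁ ha)
    (integrableOn_rate_tailProfile hC hJ₂ ha)]
  calc _ ≤ ∫ s in Ioi (max τ ε), C * (d / ε) * (Real.exp (-s) * Real.exp (K * Real.exp (-s))) := by
        refine abs_setIntegral_Ioi_le (hp.1.const_mul _) fun x hx => ?_
        refine (abs_tailRate_sub_le _ _).trans
          ((abs_tailProfile_sub_le hε hC hK hJ₁ hJ₂ hd (hεa.trans hx.le)).trans ?_)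
        refine mul_le_mul_of_nonneg_left ?_ (by positivity)
        rw [div_le_iff₀ hK]
        have := exp_sub_one_le_mul_exp (K * Real.exp (-x))
        linarith
    _ = C * (d / ε) * ((Real.exp (K * Real.exp (-max τ ε)) - 1) / K) := by
        rw [integral_const_mul, hp.2]
    _ ≤ C * (d / ε) * (Real.exp (K * Real.exp (-max τ ε)) / K) := by
        gcongr
        linarith
    _ = _ := by field_simp

theorem abs_nextExponent_sub_const_le (hε : 0 < ε) {C₁ C₂ : ℝ} (hC₁ : 0 ≤ C₁) (hC₂ : 0 ≤ C₂)
    (hJ : Continuous J) (τ : ℝ) :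
    |nextExponent ε C₁ J τ - nextExponent ε C₂ J τ| ≤ |C₁ - C₂| := by
  have ha : 0 < max τ ε := hε.trans_le (le_max_right _ _)
  rw [nextExponent, nextExponent, ← integral_sub (integrableOn_rate_tailProfile hC₁ hJ ha)
    (integrableOn_rate_tailProfile hC₂ hJ ha)]
  calc _ ≤ ∫ s in Ioi (max τ ε), |C₁ - C₂| * expIntE1 s := by
        refine abs_setIntegral_Ioi_le ((expIntTail_integral ha).1.const_mul _) fun x hx => ?_
        have hb := profile_integral_bounds hJ (ha.trans hx)
        refine (abs_tailRate_sub_le _ _).trans ?_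
        rw [tailProfile, tailProfile, ← sub_mul, abs_mul, abs_of_nonneg hb.1]
        exact mul_le_mul_of_nonneg_left hb.2 (abs_nonneg _)
    _ = |C₁ - C₂| * expIntTail (max τ ε) := by
        rw [integral_const_mul, (expIntTail_integral ha).2]
    _ ≤ |C₁ - C₂| := mul_le_of_le_one_right (abs_nonneg _) (expIntTail_le_one ha)

/-- The weight that makes the exponent map a contraction. -/
noncomputable def exponentWeight (ε K τ : ℝ) : ℝ := Real.exp (K * Real.exp (-max τ ε))

theorem continuous_exponentWeight : Continuous (exponentWeight ε K) := by
  unfold exponentWeight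
  fun_prop

theorem one_le_exponentWeight (hK : 0 < K) (τ : ℝ) : 1 ≤ exponentWeight ε K τ :=
  Real.one_le_exp (by positivity)

/-- The exponent map in weighted form. -/
noncomputable def exponentMap (hε : 0 < ε) (hC : 0 ≤ C) (hK : 0 < K) (G : ℝ →ᵇ ℝ) : ℝ →ᵇ ℝ :=
  BoundedContinuousFunction.ofNormedAddCommGroup
    (fun τ => nextExponent ε C (fun s => exponentWeight ε K s * G s) τ / exponentWeight ε K τ)
    ((continuous_nextExponent hε hC (continuous_exponentWeight.mul G.continuous)).div
      continuous_exponentWeight fun τ => (one_pos.trans_le (one_le_exponentWeight hK τ)).ne')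
    C (fun τ => by
      have hJ : Continuous fun s => exponentWeight ε K s * G s :=
        continuous_exponentWeight.mul G.continuous
      have h0 := nextExponent_nonneg hε hC hJ τ
      have h1 := nextExponent_le hε hC hJ τ
      have h2 := one_le_exponentWeight (ε := ε) hK τ
      rw [Real.norm_eq_abs, abs_of_nonneg (div_nonneg h0 (zero_le_one.trans h2))]
      exact (div_le_self h0 h2).trans h1)

theorem exponentMap_apply (hε : 0 < ε) (hC : 0 ≤ C) (hK : 0 < K) (G : ℝ →ᵇ ℝ) (τ : ℝ) :
    exponentMap hε hC hK G τ =
      nextExponent ε C (fun s => exponentWeight ε K s * G s) τ / exponentWeight ε K τ := rfl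

theorem abs_weight_mul_sub_le (hK : 0 < K) (G₁ G₂ : ℝ →ᵇ ℝ) (s : ℝ) (hs : ε ≤ s) :
    |exponentWeight ε K s * G₁ s - exponentWeight ε K s * G₂ s|
      ≤ dist G₁ G₂ * Real.exp (K * Real.exp (-s)) := by
  have h1 := BoundedContinuousFunction.dist_coe_le_dist (f := G₁) (g := G₂) s
  rw [Real.dist_eq] at h1
  have h2 := one_le_exponentWeight (ε := ε) hK s
  rw [← mul_sub, abs_mul, abs_of_nonneg (zero_le_one.trans h2), mul_comm]
  have h3 : exponentWeight ε K s = Real.exp (K * Real.exp (-s)) := by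
    rw [exponentWeight, max_eq_left hs]
  rw [h3]
  gcongr

theorem exponentMap_contracting (hε : 0 < ε) (hC : 0 ≤ C) (hK : 0 < K) (hCK : 2 * C ≤ ε * K) :
    ContractingWith (1 / 2) (exponentMap hε hC hK) := by
  refine ⟨by norm_num, LipschitzWith.of_dist_le_mul fun G₁ G₂ => ?_⟩
  refine (BoundedContinuousFunction.dist_le (by positivity)).2 fun τ => ?_
  have h1 := abs_nextExponent_sub_le hε hC hK (continuous_exponentWeight.mul G₁.continuous)
    (continuous_exponentWeight.mul G₂.continuous) dist_nonneg
    (abs_weight_mul_sub_le hK G₁ G₂) τ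
  have hw := one_pos.trans_le (one_le_exponentWeight (ε := ε) hK τ)
  rw [Real.dist_eq, exponentMap_apply, exponentMap_apply, ← sub_div, abs_div, abs_of_pos hw,
    div_le_iff₀ hw]
  refine h1.trans ?_
  have h2 : C / (ε * K) ≤ 1 / 2 := by
    rw [div_le_div_iff₀ (by positivity) two_pos]
    linarith
  rw [exponentWeight]
  simp only [NNReal.coe_div, NNReal.coe_one, NNReal.coe_ofNat]
  gcongr

theorem dist_exponentMap_le (hε : 0 < ε) {C₁ C₂ : ℝ} (hC₁ : 0 ≤ C₁) (hC₂ : 0 ≤ C₂) (hK : 0 < K)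
    (G : ℝ →ᵇ ℝ) : dist (exponentMap hε hC₁ hK G) (exponentMap hε hC₂ hK G) ≤ |C₁ - C₂| := by
  refine (BoundedContinuousFunction.dist_le (abs_nonneg _)).2 fun τ => ?_
  have hJ : Continuous fun s => exponentWeight ε K s * G s :=
    continuous_exponentWeight.mul G.continuous
  have h1 := abs_nextExponent_sub_const_le hε hC₁ hC₂ hJ τ
  have h2 := one_le_exponentWeight (ε := ε) hK τ
  have hw := one_pos.trans_le h2
  rw [Real.dist_eq, exponentMap_apply, exponentMap_apply, ← sub_div, abs_div, abs_of_pos hw]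
  exact (div_le_self (abs_nonneg _) h2).trans h1

/-- The map was defined with `|J|` so that its integrals are bounded for every continuous `J`. A
fixed point is an integral of a nonnegative function, so the absolute value disappears. -/
theorem tailSolution_of_fixedPoint (hε : 0 < ε) (hC : 0 ≤ C) (hK : 0 < K) {G : ℝ →ᵇ ℝ}
    (hG : exponentMap hε hC hK G = G) :
    TailSolution ε C (tailProfile C fun s => exponentWeight ε K s * G s)
      (fun s => exponentWeight ε K s * G s) := by
  have hJ : Continuous fun s => exponentWeight ε K s * G s :=
    continuous_exponentWeight.mul G.continuous
  have hfix : ∀ τ, exponentWeight ε K τ * G τ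
      = nextExponent ε C (fun s => exponentWeight ε K s * G s) τ := by
    intro τ
    have hw := one_pos.trans_le (one_le_exponentWeight (ε := ε) hK τ)
    have h1 := exponentMap_apply hε hC hK G τ
    rw [hG] at h1
    rw [h1, mul_div_cancel₀ _ hw.ne']
  refine ⟨hε, hC, integrableOn_rate_tailProfile hC hJ hε, fun τ hτ => ?_, fun ρ _ => ?_⟩
  · rw [hfix τ, nextExponent, max_eq_left hτ]
  · rw [tailProfile]
    congr 2
    ext τ
    rw [abs_of_nonneg]
    rw [hfix τ]
    exact nextExponent_nonneg hε hC hJ τ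

theorem exists_tailSolution (hε : 0 < ε) :
    ∃ (C : ℝ) (F J : ℝ → ℝ), TailSolution ε C F J ∧ F ε = Real.exp 1 - 1 := by
  set q := (Real.exp 1 - 1) / Real.log ((ε + 1) / ε) with hq
  -- By `const_le` with `b = ε + 1`, any solution with `F(ε) ≤ e - 1` has `C ≤ M - 1`; hence `C = M`
  -- overshoots.
  set M := q * Real.exp (ε + 1 + q) + 1 with hM
  have he : 1 < Real.exp 1 := Real.one_lt_exp_iff.2 one_pos
  have hlog : 0 < Real.log ((ε + 1) / ε) :=
    Real.log_pos ((one_lt_div hε).2 (lt_add_one ε))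
  have hq0 : 0 < q := div_pos (by linarith) hlog
  have hM0 : 0 < M := by positivity
  -- One weight giving contraction factor `1/2` for all `C ∈ [0, M]`, so that fixed points for
  -- different `C` live in the same norm.
  set K := 2 * M / ε with hKdef
  have hK : 0 < K := by positivity
  have hεK : ε * K = 2 * M := by rw [hKdef]; field_simp
  have hcontr : ∀ x : Icc (0 : ℝ) M, ContractingWith (1 / 2) (exponentMap hε x.2.1 hK) :=
    fun x => exponentMap_contracting hε x.2.1 hK (by rw [hεK]; linarith [x.2.2])
  let G : Icc (0 : ℝ) M → (ℝ →ᵇ ℝ) := fun x => (hcontr x).fixedPoint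
  have hG : ∀ x, exponentMap hε x.2.1 hK (G x) = G x := fun x => (hcontr x).fixedPoint_isFixedPt
  -- The factor `2` is `1/(1 - 1/2)`: the maps are 1-Lipschitz in `C`.
  have hdist : ∀ x y, dist (G x) (G y) ≤ 2 * |(x : ℝ) - y| := by
    intro x y
    have h := (hcontr x).dist_fixedPoint_fixedPoint_of_dist_le' _ (hG x) (hG y)
      (fun G => dist_exponentMap_le hε x.2.1 y.2.1 hK G)
    norm_num at h
    linarith
  let Φ : Icc (0 : ℝ) M → ℝ := fun x => tailProfile x (fun s => exponentWeight ε K s * G x s) ε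
  have hsol : ∀ x : Icc (0 : ℝ) M, TailSolution ε x
      (tailProfile x fun s => exponentWeight ε K s * G x s) fun s => exponentWeight ε K s * G x s :=
    fun x => tailSolution_of_fixedPoint hε x.2.1 hK (hG x)
  have hJc : ∀ x, Continuous fun s => exponentWeight ε K s * G x s :=
    fun x => continuous_exponentWeight.mul (G x).continuous
  set L := expIntE1 ε + M * (2 / ε) * ((Real.exp (K * Real.exp (-ε)) - 1) / K) with hL
  have hexp : 0 ≤ (Real.exp (K * Real.exp (-ε)) - 1) / K :=
    div_nonneg (sub_nonneg.2 (Real.one_le_exp (by positivity))) hK.le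
  have hL0 : 0 ≤ L := add_nonneg (expIntE1_nonneg hε) (by positivity)
  have hlip : ∀ x y, |Φ x - Φ y| ≤ L * |(x : ℝ) - y| := by
    intro x y
    have h1 := abs_tailProfile_sub_le hε x.2.1 hK (hJc x) (hJc y)
      (d := 2 * |(x : ℝ) - y|) (fun s hs => (abs_weight_mul_sub_le hK (G x) (G y) s hs).trans
        (mul_le_mul_of_nonneg_right (hdist x y) (Real.exp_pos _).le)) le_rfl
    have h2 : |tailProfile x (fun s => exponentWeight ε K s * G y s) ε
        - tailProfile y (fun s => exponentWeight ε K s * G y s) ε|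
        ≤ |(x : ℝ) - y| * expIntE1 ε := by
      have hb := profile_integral_bounds (hJc y) hε
      rw [tailProfile, tailProfile, ← sub_mul, abs_mul, abs_of_nonneg hb.1]
      exact mul_le_mul_of_nonneg_left hb.2 (abs_nonneg _)
    have h3 : (x : ℝ) * (2 * |(x : ℝ) - y| / ε) * ((Real.exp (K * Real.exp (-ε)) - 1) / K)
        ≤ M * (2 * |(x : ℝ) - y| / ε) * ((Real.exp (K * Real.exp (-ε)) - 1) / K) := by
      have := x.2.2
      gcongr
    calc |Φ x - Φ y| ≤ _ + _ := abs_sub_le _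
          (tailProfile x (fun s => exponentWeight ε K s * G y s) ε) _
      _ ≤ M * (2 * |(x : ℝ) - y| / ε) * ((Real.exp (K * Real.exp (-ε)) - 1) / K)
          + |(x : ℝ) - y| * expIntE1 ε := add_le_add (h1.trans h3) h2
      _ = L * |(x : ℝ) - y| := by rw [hL]; ring
  have hcont : Continuous Φ := by
    refine LipschitzWith.continuous (K := ⟨L, hL0⟩) (LipschitzWith.of_dist_le_mul fun x y => ?_)
    rw [Real.dist_eq, Subtype.dist_eq, Real.dist_eq]
    exact hlip x y
  have hzero : Φ ⟨0, left_mem_Icc.2 hM0.le⟩ ≤ Real.exp 1 - 1 := by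
    simp only [Φ, tailProfile, zero_mul]
    linarith
  have hbig : Real.exp 1 - 1 ≤ Φ ⟨M, right_mem_Icc.2 hM0.le⟩ := by
    by_contra hcon
    push Not at hcon
    have := (hsol ⟨M, right_mem_Icc.2 hM0.le⟩).const_le hcon.le (lt_add_one ε)
    rw [← hq] at this
    linarith
  have hpre : IsPreconnected (univ : Set (Icc (0 : ℝ) M)) := by
    have : PreconnectedSpace (Icc (0 : ℝ) M) :=
      Subtype.preconnectedSpace isPreconnected_Icc
    exact isPreconnected_univ
  obtain ⟨x, -, hx⟩ := hpre.intermediate_value (mem_univ _) (mem_univ _) hcont.continuousOn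
    ⟨hzero, hbig⟩
  exact ⟨x, _, _, hsol x, hx⟩

end Existence

/-! ### Equivalence of the boundary value problem and the integral equation. -/

section Reduction
open MeasureTheory

theorem eq_of_hasDerivAt_zero_Ioi {h h' : ℝ → ℝ} {a : ℝ} (hd : ∀ x, a < x → HasDerivAt h (h' x) x)
    (h0 : ∀ x, a < x → h' x = 0) {x y : ℝ} (hx : a < x) (hy : a < y) : h x = h y := by
  refine isOpen_Ioi.is_const_of_deriv_eq_zero isPreconnected_Ioi
    (fun z hz => (hd z hz).differentiableAt.differentiableWithinAt) (fun z hz => ?_) hx hy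
  rw [(hd z hz).deriv, h0 z hz]
  rfl

/-- Data of a solution in the variable `ρ`, with flux `q = ρ (e^U)'`. -/
structure ScaledSolution (ε : ℝ) (U q : ℝ → ℝ) : Prop where
  eps_pos : 0 < ε
  continuousOn : ContinuousOn U (Ici ε)
  hasDerivAt : ∀ ρ, ε < ρ → HasDerivAt U (q ρ / (ρ * Real.exp (U ρ))) ρ
  hasDerivAt_flux : ∀ ρ, ε < ρ → HasDerivAt q (-(U ρ * q ρ)) ρ
  left : U ε = 0
  tendsto : Tendsto U atTop (𝓝 1)

/-- With dimension `n = 2` and `k = 1`, differentiating `ρ U' e^U` collects the `1/r` term and the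
quadratic term, leaving only `-U q`. -/
theorem IsLagerstromSolution.scaledSolution {ε : ℝ} {u : ℝ → ℝ} (hε : 0 < ε)
    (hu : IsLagerstromSolution 1 2 ε u) :
    ScaledSolution ε (rescale ε u)
      (fun ρ => ρ * (deriv u (ρ / ε) / ε) * Real.exp (rescale ε u ρ)) := by
  have hdiv : ∀ ρ, HasDerivAt (fun ρ : ℝ => ρ / ε) (1 / ε) ρ := fun ρ =>
    (hasDerivAt_id ρ).div_const ε
  have h1 : ∀ ρ, ε < ρ → 1 < ρ / ε := fun ρ hρ => (one_lt_div hε).2 hρ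
  have hU : ∀ ρ, ε < ρ → HasDerivAt (rescale ε u) (deriv u (ρ / ε) / ε) ρ := by
    intro ρ hρ
    refine (((hu.differentiableAt _ (h1 ρ hρ)).hasDerivAt).comp ρ (hdiv ρ)).congr_deriv ?_
    ring
  refine ⟨hε, ?_, fun ρ hρ => ?_, fun ρ hρ => ?_, ?_, ?_⟩
  · refine hu.continuousOn.comp (by fun_prop) fun ρ hρ => ?_
    exact (one_le_div hε).2 hρ
  · refine (hU ρ hρ).congr_deriv ?_
    have := (hε.trans hρ).ne'
    field_simp
  · have hρ0 := (hε.trans hρ).ne'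
    have hp := (((hu.differentiableAt_deriv _ (h1 ρ hρ)).hasDerivAt).comp ρ (hdiv ρ)).div_const ε
    refine (((hasDerivAt_id ρ).mul hp).mul (hU ρ hρ).exp).congr_deriv ?_
    have hode := hu.ode _ (h1 ρ hρ)
    simp only [id, Function.comp_apply, Pi.mul_apply]
    have h3 : deriv (deriv u) (ρ / ε) = -((2 - 1) / (ρ / ε) * deriv u (ρ / ε)
      + ε * u (ρ / ε) * deriv u (ρ / ε) + 1 * deriv u (ρ / ε) ^ 2) := by linarith
    rw [h3, rescale]
    field_simp
    ring
  · rw [rescale, div_self hε.ne', hu.at_one]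
  · exact hu.at_infty.comp (tendsto_id.atTop_div_const hε)

namespace ScaledSolution

variable {ε : ℝ} {U q : ℝ → ℝ}

/-- The product `q exp (∫ U)` is constant, so `q` has one sign. If it were nonpositive, `U` would be
nonincreasing from `0` and could not tend to `1`. -/
theorem flux_pos (h : ScaledSolution ε U q) {ρ : ℝ} (hρ : ε < ρ) : 0 < q ρ := by
  have hI : ∀ x, ε < x → HasDerivAt (fun x => ∫ t in ε..x, U t) (U x) x := by
    intro x hx
    have hc : ContinuousOn U (Ioi ε) := h.continuousOn.mono Ioi_subset_Ici_self
    exact intervalIntegral.integral_hasDerivAt_right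
      ((h.continuousOn.mono Icc_subset_Ici_self).intervalIntegrable_of_Icc hx.le)
      (hc.stronglyMeasurableAtFilter isOpen_Ioi x hx) (hc.continuousAt (Ioi_mem_nhds hx))
  have hconst : ∀ x, ε < x → q x * Real.exp (∫ t in ε..x, U t)
      = q ρ * Real.exp (∫ t in ε..ρ, U t) := fun x hx =>
    eq_of_hasDerivAt_zero_Ioi (h := fun x => q x * Real.exp (∫ t in ε..x, U t))
      (fun y hy => (h.hasDerivAt_flux y hy).mul (hI y hy).exp) (fun y _ => by ring) hx hρ
  by_contra hneg
  push Not at hneg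
  have hq : ∀ x, ε < x → q x ≤ 0 := by
    intro x hx
    have h1 := hconst x hx
    have h2 : q ρ * Real.exp (∫ t in ε..ρ, U t) ≤ 0 :=
      mul_nonpos_of_nonpos_of_nonneg hneg (Real.exp_pos _).le
    rw [← h1] at h2
    exact nonpos_of_mul_nonpos_left h2 (Real.exp_pos _)
  have hanti : AntitoneOn U (Ici ε) :=
    antitoneOn_Ici_of_hasDerivAt_nonpos h.continuousOn h.hasDerivAt fun x hx =>
      div_nonpos_of_nonpos_of_nonneg (hq x hx)
        (mul_nonneg (h.eps_pos.trans hx).le (Real.exp_pos _).le)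
  have h1 : (1 : ℝ) ≤ 0 := by
    refine le_of_tendsto h.tendsto ?_
    filter_upwards [eventually_ge_atTop ε] with x hx
    rw [← h.left]
    exact hanti self_mem_Ici hx hx
  linarith

theorem strictMonoOn (h : ScaledSolution ε U q) : StrictMonoOn U (Ici ε) := by
  refine strictMonoOn_of_deriv_pos (convex_Ici ε) h.continuousOn ?_
  rw [interior_Ici]
  intro x hx
  rw [(h.hasDerivAt x hx).deriv]
  exact div_pos (h.flux_pos hx) (mul_pos (h.eps_pos.trans hx) (Real.exp_pos _))

theorem nonneg (h : ScaledSolution ε U q) {ρ : ℝ} (hρ : ε ≤ ρ) : 0 ≤ U ρ := by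
  rw [← h.left]
  exact h.strictMonoOn.monotoneOn self_mem_Ici hρ hρ

theorem lt_one (h : ScaledSolution ε U q) {ρ : ℝ} (hρ : ε ≤ ρ) : U ρ < 1 := by
  have hρ' : ε ≤ ρ + 1 := by linarith
  refine (h.strictMonoOn hρ hρ' (lt_add_one ρ)).trans_le (ge_of_tendsto h.tendsto ?_)
  filter_upwards [eventually_ge_atTop (ρ + 1)] with x hx
  exact h.strictMonoOn.monotoneOn hρ' (hρ'.trans hx) hx

theorem tailRate_eq (h : ScaledSolution ε U q) {ρ : ℝ} (hρ : ε ≤ ρ) :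
    tailRate (Real.exp 1 - Real.exp (U ρ)) = 1 - U ρ := by
  have := Real.one_le_exp (h.nonneg hρ)
  rw [tailRate_of_le (by linarith)]
  simp

theorem hasDerivAt_defect (h : ScaledSolution ε U q) {ρ : ℝ} (hρ : ε < ρ) :
    HasDerivAt (fun ρ => Real.exp 1 - Real.exp (U ρ)) (-(q ρ / ρ)) ρ := by
  refine ((h.hasDerivAt ρ hρ).exp.const_sub (Real.exp 1)).congr_deriv ?_
  have := (h.eps_pos.trans hρ).ne'
  field_simp

theorem tendsto_defect (h : ScaledSolution ε U q) :
    Tendsto (fun ρ => Real.exp 1 - Real.exp (U ρ)) atTop (𝓝 0) := by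
  simpa using (((Real.continuous_exp.tendsto 1).comp h.tendsto).const_sub (Real.exp 1))

theorem continuousOn_defect (h : ScaledSolution ε U q) :
    ContinuousOn (fun ρ => Real.exp 1 - Real.exp (U ρ)) (Ici ε) :=
  continuousOn_const.sub (Real.continuous_exp.comp_continuousOn h.continuousOn)

/-- Mere convergence `U → 1` bootstraps to exponential decay: once `U ≥ 1/2`, `q e^{x/2}` is
nonincreasing, so `q`, then the defect, then `1 - U` are `O(e^{-x/2})`. This makes `J` well defined.
-/
theorem integrableOn_one_sub (h : ScaledSolution ε U q) :
    IntegrableOn (fun ρ => 1 - U ρ) (Ioi ε) := by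
  obtain ⟨R₀, hR₀⟩ := eventually_atTop.1
    (h.tendsto.eventually (lt_mem_nhds (by norm_num : (1 / 2 : ℝ) < 1)))
  set R := max (max R₀ 1) (ε + 1) with hR
  have hR₀R : R₀ ≤ R := (le_max_left _ _).trans (le_max_left _ _)
  have h1R : 1 ≤ R := (le_max_right _ _).trans (le_max_left _ _)
  have hεR : ε < R := (lt_add_one ε).trans_le (le_max_right _ _)
  have hexp : ∀ c x : ℝ, HasDerivAt (fun x => Real.exp (c * x)) (Real.exp (c * x) * c) x := by
    intro c x
    simpa using ((hasDerivAt_id x).const_mul c).exp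
  have hq : AntitoneOn (fun x => q x * Real.exp (1 / 2 * x)) (Ici R) := by
    refine antitoneOn_Ici_of_hasDerivAt_nonpos
      (fun x hx => (h.hasDerivAt_flux x (hεR.trans_le hx)).continuousAt.continuousWithinAt.mul
        (hexp _ x).continuousAt.continuousWithinAt)
      (fun x hx => (h.hasDerivAt_flux x (hεR.trans hx)).mul (hexp _ x)) fun x hx => ?_
    have h1 := hR₀ x (hR₀R.trans hx.le)
    have h2 : 0 < q x * Real.exp (1 / 2 * x) := mul_pos (h.flux_pos (hεR.trans hx)) (Real.exp_pos _)
    nlinarith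
  -- The factor `2` comes from integrating `e^{-x/2}`; `R ≥ 1` allows `q x / x ≤ q x`.
  set B := 2 * (q R * Real.exp (1 / 2 * R)) with hB
  have hdef : ∀ x, R ≤ x → Real.exp 1 - Real.exp (U x) ≤ B * Real.exp (-(1 / 2) * x) := by
    intro x hx
    have hm : AntitoneOn (fun x => B * Real.exp (-(1 / 2) * x) - (Real.exp 1 - Real.exp (U x)))
        (Ici R) := by
      refine antitoneOn_Ici_of_hasDerivAt_nonpos
        (ContinuousOn.sub (by fun_prop) (h.continuousOn_defect.mono (Ici_subset_Ici.2 hεR.le)))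
        (fun x hx => ((hexp _ x).const_mul B).sub (h.hasDerivAt_defect (hεR.trans hx)))
        fun x hx => ?_
      have hxR : R ≤ x := le_of_lt hx
      have h1 := hq self_mem_Ici hxR hxR
      have h2 := h.flux_pos (hεR.trans hx)
      have h3 : q x / x ≤ q x := div_le_self h2.le (h1R.trans hxR)
      have h4 : q x = q x * Real.exp (1 / 2 * x) * Real.exp (-(1 / 2) * x) := by
        rw [mul_assoc, ← Real.exp_add]
        norm_num
      have h5 : q x * Real.exp (1 / 2 * x) * Real.exp (-(1 / 2) * x)
          ≤ q R * Real.exp (1 / 2 * R) * Real.exp (-(1 / 2) * x) :=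
        mul_le_mul_of_nonneg_right h1 (Real.exp_pos _).le
      rw [hB]
      linarith
    have hlim : Tendsto (fun x => B * Real.exp (-(1 / 2) * x) - (Real.exp 1 - Real.exp (U x)))
        atTop (𝓝 0) := by
      have h1 : Tendsto (fun x : ℝ => Real.exp (-(1 / 2) * x)) atTop (𝓝 0) :=
        Real.tendsto_exp_atBot.comp (tendsto_id.const_mul_atTop_of_neg (by norm_num))
      simpa using (h1.const_mul B).sub h.tendsto_defect
    have := nonneg_of_antitoneOn_of_tendsto hm hlim hx
    linarith
  have h1 : IntegrableOn (fun ρ => 1 - U ρ) (Ioi R) := by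
    refine IntegrableOn.of_continuousOn_abs_le
      ((exp_neg_integrableOn_Ioi R (by norm_num : (0 : ℝ) < 1 / 2)).const_mul B)
      ((continuousOn_const.sub h.continuousOn).mono fun x hx => (hεR.trans hx).le) fun x hx => ?_
    have hεx : ε ≤ x := (hεR.trans hx).le
    have h2 := h.lt_one hεx
    rw [abs_of_nonneg (by linarith), ← h.tailRate_eq hεx]
    exact (tailRate_le_self (sub_nonneg.2 (Real.exp_le_exp.2 h2.le))).trans (hdef x hx.le)
  have h2 : IntegrableOn (fun ρ => 1 - U ρ) (Ioc ε R) :=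
    ((continuousOn_const.sub (h.continuousOn.mono Icc_subset_Ici_self)).integrableOn_Icc).mono_set
      Ioc_subset_Icc_self
  rw [← Ioc_union_Ioi_eq_Ioi hεR.le]
  exact h2.union h1

theorem tailExponent_eq (U : ℝ → ℝ) (τ : ℝ) :
    tailExponent U τ = ∫ σ in Ioi τ, (1 - U σ) := by
  rw [tailExponent, integralFromInfty, ← integral_neg]
  congr 1
  ext σ
  ring

/-- The constant of the integral equation is the first integral `q(x) exp (x + J(x))`; integrating
`F' = -q/ρ` from infinity gives the equation. -/
theorem exists_tailSolution (h : ScaledSolution ε U q) :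
    ∃ C, 0 < C ∧
      TailSolution ε C (fun ρ => Real.exp 1 - Real.exp (U ρ)) (tailExponent U) := by
  have hJ : ∀ x, ε < x → HasDerivAt (tailExponent U) (-(1 - U x)) x := by
    intro x hx
    rw [show tailExponent U = fun τ => ∫ σ in Ioi τ, (1 - U σ) from funext (tailExponent_eq U)]
    exact hasDerivAt_setIntegral_Ioi h.integrableOn_one_sub
      ((continuousOn_const.sub h.continuousOn).mono Ioi_subset_Ici_self) hx
  set a := ε + 1 with ha
  have hεa : ε < a := lt_add_one ε
  set C := q a * Real.exp (a + tailExponent U a) with hC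
  have hC0 : 0 < C := mul_pos (h.flux_pos hεa) (Real.exp_pos _)
  have hconst : ∀ x, ε < x → q x * Real.exp (x + tailExponent U x) = C := fun x hx =>
    eq_of_hasDerivAt_zero_Ioi (h := fun x => q x * Real.exp (x + tailExponent U x))
      (fun y hy => (h.hasDerivAt_flux y hy).mul (((hasDerivAt_id y).add (hJ y hy)).exp))
      (fun y _ => by simp only [Pi.add_apply, id]; ring) hx hεa
  have hq : ∀ x, ε < x → q x / x = C * (Real.exp (-x) / x * Real.exp (-tailExponent U x)) := by
    intro x hx
    have h1 : Real.exp (-x) * Real.exp (-tailExponent U x) * Real.exp (x + tailExponent U x)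
        = 1 := by
      rw [← Real.exp_add, ← Real.exp_add, Real.exp_eq_one_iff]
      ring
    calc q x / x = q x / x * (Real.exp (-x) * Real.exp (-tailExponent U x)
          * Real.exp (x + tailExponent U x)) := by rw [h1, mul_one]
      _ = (q x * Real.exp (x + tailExponent U x))
          * (Real.exp (-x) / x * Real.exp (-tailExponent U x)) := by ring
      _ = _ := by rw [hconst x hx]
  refine ⟨C, hC0, h.eps_pos, hC0.le, ?_, fun τ hτ => ?_, fun ρ hρ => ?_⟩
  · exact h.integrableOn_one_sub.congr_fun (fun x hx => (h.tailRate_eq (le_of_lt hx)).symm)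
      measurableSet_Ioi
  · rw [tailExponent_eq]
    exact setIntegral_congr_fun measurableSet_Ioi fun x hx =>
      (h.tailRate_eq (hτ.trans (le_of_lt hx))).symm
  · have h1 := integral_Ioi_of_hasDerivAt_of_nonpos (a := ρ)
      ((h.continuousOn_defect ρ hρ).mono (Ici_subset_Ici.2 hρ))
      (fun x hx => h.hasDerivAt_defect (hρ.trans_lt hx))
      (fun x hx => neg_nonpos.2 (div_nonneg (h.flux_pos (hρ.trans_lt hx)).le
        (h.eps_pos.trans (hρ.trans_lt hx)).le)) h.tendsto_defect
    rw [integral_neg, zero_sub, neg_inj] at h1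
    rw [← h1, ← integral_const_mul]
    exact setIntegral_congr_fun measurableSet_Ioi fun x hx => hq x (hρ.trans_lt hx)

end ScaledSolution

/-- Since `F` decreases from `e - 1`, the argument `e - F` stays at least `1`; the cutoff never acts
and the logarithm is smooth there. -/
theorem TailSolution.isLagerstromSolution {ε C : ℝ} {F J : ℝ → ℝ} (h : TailSolution ε C F J)
    (hF : F ε = Real.exp 1 - 1) :
    IsLagerstromSolution 1 2 ε (fun r => Real.log (Real.exp 1 - F (ε * r))) := by
  have hε := h.eps_pos
  have hle : ∀ r, 1 ≤ r → ε ≤ ε * r := fun r hr => le_mul_of_one_le_right hε.le hr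
  have hlt : ∀ r, 1 < r → ε < ε * r := fun r hr => lt_mul_of_one_lt_right hε hr
  have hW : ∀ r, 1 ≤ r → 1 ≤ Real.exp 1 - F (ε * r) := by
    intro r hr
    have := h.F_le_of_left hF.le (hle r hr)
    linarith
  have hmul : ∀ r, HasDerivAt (fun r : ℝ => ε * r) ε r := fun r => by
    simpa using (hasDerivAt_id r).const_mul ε
  have hdW : ∀ r, 1 < r → HasDerivAt (fun r => Real.exp 1 - F (ε * r))
      (TailSolution.flux C J (ε * r) / r) r := by
    intro r hr
    refine (((h.hasDerivAt_F (hlt r hr)).comp r (hmul r)).const_sub _).congr_deriv ?_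
    field_simp
  have hd : ∀ r, 1 < r → HasDerivAt (fun r => Real.log (Real.exp 1 - F (ε * r)))
      (TailSolution.flux C J (ε * r) / r / (Real.exp 1 - F (ε * r))) r := by
    intro r hr
    have := hW r hr.le
    exact (hdW r hr).log (by linarith)
  have hd2 : ∀ r, 1 < r → HasDerivAt (deriv fun r => Real.log (Real.exp 1 - F (ε * r)))
      (-(ε * Real.log (Real.exp 1 - F (ε * r)) *
          (TailSolution.flux C J (ε * r) / r / (Real.exp 1 - F (ε * r))))
        - 1 / r * (TailSolution.flux C J (ε * r) / r / (Real.exp 1 - F (ε * r)))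
        - (TailSolution.flux C J (ε * r) / r / (Real.exp 1 - F (ε * r))) ^ 2) r := by
    intro r hr
    have hr0 : r ≠ 0 := by linarith
    have hW0 : Real.exp 1 - F (ε * r) ≠ 0 := by
      have := hW r hr.le
      intro h0
      linarith
    have h1 := ((((h.hasDerivAt_flux (hlt r hr)).comp r (hmul r)).div (hasDerivAt_id r) hr0).div
      (hdW r hr) hW0)
    refine (h1.congr_of_eventuallyEq ?_).congr_deriv ?_
    · filter_upwards [Ioi_mem_nhds hr] with s hs
      exact (hd s hs).deriv
    · have h2 := tailRate_of_le (h.F_le_of_left hF.le (hle r hr.le))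
      simp only [id, Function.comp_apply, Pi.div_apply]
      rw [h2]
      field_simp
      ring
  refine ⟨?_, fun r hr => (hd r hr).differentiableAt, fun r hr => (hd2 r hr).differentiableAt,
    fun r hr => ?_, ?_, ?_⟩
  · refine ContinuousOn.log (continuousOn_const.sub (h.continuousOn_F.comp (by fun_prop)
      fun r hr => hle r hr)) fun r hr => ?_
    have := hW r hr
    intro h0
    linarith
  · rw [(hd r hr).deriv, (hd2 r hr).deriv]
    ring
  · simp [hF]
  · have h1 : Tendsto (fun r => Real.exp 1 - F (ε * r)) atTop (𝓝 (Real.exp 1 - 0)) :=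
      (h.tendsto_F.comp (tendsto_id.const_mul_atTop hε)).const_sub _
    rw [sub_zero] at h1
    have h2 := h1.log (Real.exp_pos 1).ne'
    rwa [Real.log_exp] at h2

end Reduction

/-! ### Iterated approximations in powers of `C`, uniform down to `ρ = ε`. -/

section Estimates
open MeasureTheory

theorem IntegrableOn.fun_sub {f g : ℝ → ℝ} {s : Set ℝ} (hf : IntegrableOn f s)
    (hg : IntegrableOn g s) : IntegrableOn (fun x => f x - g x) s := hf.sub hg

theorem tailRate_eq_neg_log {F : ℝ} (h1 : F ≤ Real.exp 1 - 1) :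
    tailRate F = -Real.log (1 - F / Real.exp 1) := by
  have he := Real.exp_pos 1
  have h2 : 1 - F / Real.exp 1 = (Real.exp 1 - F) / Real.exp 1 := by field_simp
  rw [tailRate_of_le h1, h2, Real.log_div (by linarith) he.ne', Real.log_exp]
  ring

/-- Taylor series of `-log (1 - x)` at `x = F/e`. The remainder has denominator `1 - x ≥ 1/e`, which
costs one factor `e` and is absorbed by `e^{n+2}`. -/
theorem tailRate_expansion {F : ℝ} (h0 : 0 ≤ F) (h1 : F ≤ Real.exp 1 - 1) (n : ℕ) :
    |tailRate F - ∑ i ∈ Finset.range (n + 1), (F / Real.exp 1) ^ (i + 1) / (i + 1)|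
      ≤ F ^ (n + 2) := by
  have he : 1 ≤ Real.exp 1 := Real.one_le_exp zero_le_one
  have he0 := Real.exp_pos 1
  have hx0 : 0 ≤ F / Real.exp 1 := div_nonneg h0 he0.le
  have hx1 : 1 / Real.exp 1 ≤ 1 - F / Real.exp 1 := by
    rw [div_le_iff₀ he0, sub_mul, div_mul_cancel₀ _ he0.ne']
    linarith
  have hx2 : F / Real.exp 1 < 1 := by
    have : 0 < 1 / Real.exp 1 := by positivity
    linarith
  have h2 := Real.abs_log_sub_add_sum_range_le (x := F / Real.exp 1)
    (by rwa [abs_of_nonneg hx0]) (n + 1)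
  rw [tailRate_eq_neg_log h1, ← abs_neg, abs_of_nonneg hx0] at *
  rw [show -(-Real.log (1 - F / Real.exp 1)
      - ∑ i ∈ Finset.range (n + 1), (F / Real.exp 1) ^ (i + 1) / ((i : ℝ) + 1))
      = ∑ i ∈ Finset.range (n + 1), (F / Real.exp 1) ^ (i + 1) / ((i : ℝ) + 1)
        + Real.log (1 - F / Real.exp 1) by ring]
  rw [abs_neg] at h2
  refine h2.trans ?_
  calc (F / Real.exp 1) ^ (n + 1 + 1) / (1 - F / Real.exp 1)
      ≤ (F / Real.exp 1) ^ (n + 1 + 1) / (1 / Real.exp 1) := by gcongr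
    _ = F ^ (n + 2) / Real.exp 1 ^ (n + 1) := by
        rw [div_pow, div_div_eq_mul_div, div_one, pow_succ (Real.exp 1) (n + 1)]
        field_simp
    _ ≤ F ^ (n + 2) := div_le_self (by positivity) (one_le_pow₀ he)

theorem abs_tailRate_sub_linear_le {F : ℝ} (h0 : 0 ≤ F) (h1 : F ≤ Real.exp 1 - 1) :
    |tailRate F - F / Real.exp 1| ≤ F ^ 2 := by
  simpa using tailRate_expansion h0 h1 0

theorem abs_tailRate_sub_quadratic_le {F : ℝ} (h0 : 0 ≤ F) (h1 : F ≤ Real.exp 1 - 1) :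
    |tailRate F - F / Real.exp 1 - F ^ 2 / (2 * Real.exp 1 ^ 2)| ≤ F ^ 3 := by
  have h := tailRate_expansion h0 h1 1
  simp only [Finset.sum_range_succ, Finset.range_zero, Finset.sum_empty] at h
  convert h using 2
  have := (Real.exp_pos 1).ne'
  push_cast
  field_simp
  ring

theorem expIntSecond_nonneg {a : ℝ} (ha : 0 < a) : 0 ≤ expIntSecond a := by
  rw [← (expIntSecond_integral ha).2]
  refine setIntegral_Ioi_nonneg fun x hx => ?_
  have hx0 := ha.trans hx
  exact mul_nonneg (by positivity) (expIntTail_nonneg hx0)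

/-- `∫_τ^∞ (2 E₁(2ρ) - e^{-ρ} E₁(ρ)) dρ`. -/
noncomputable def expIntSecondTail (τ : ℝ) : ℝ := expIntTail (2 * τ) - expIntDamped τ

theorem expIntSecondTail_integral {a : ℝ} (ha : 0 < a) :
    IntegrableOn expIntSecond (Ioi a) ∧ ∫ x in Ioi a, expIntSecond x = expIntSecondTail a := by
  refine integrableOn_and_integral_eq_of_primitive (G := expIntSecondTail) (fun t ht => ?_)
    (fun _ ht => expIntSecond_nonneg ht) ?_ ha
  · have h1 := (hasDerivAt_expIntTail (t := 2 * t) (by positivity)).comp t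
      ((hasDerivAt_id t).const_mul 2)
    refine (h1.sub (hasDerivAt_expIntDamped ht)).congr_deriv ?_
    rw [expIntSecond]
    ring
  · have h1 := (tendsto_expIntTail_atTop.comp (tendsto_id.const_mul_atTop two_pos)).sub
      tendsto_expIntDamped_atTop
    rw [sub_zero] at h1
    exact h1

theorem abs_exp_neg_sub_le {x : ℝ} (hx : 0 ≤ x) :
    |Real.exp (-x) - 1 + x| ≤ x ^ 2 / 2 := by
  have h1 := Real.one_sub_le_exp_neg x
  rw [abs_of_nonneg (by linarith)]
  have hm : AntitoneOn (fun x => Real.exp (-x) - 1 + x - x ^ 2 / 2) (Ici 0) := by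
    refine antitoneOn_Ici_of_hasDerivAt_nonpos (by fun_prop)
      (fun y _ => (((hasDerivAt_exp_neg y).sub_const 1).add (hasDerivAt_id y)).sub
        (((hasDerivAt_id y).pow 2).div_const 2)) fun y _ => ?_
    have := Real.one_sub_le_exp_neg y
    simp only [id]
    norm_num
    linarith
  have := hm self_mem_Ici hx hx
  simp at this
  linarith

theorem abs_exp_neg_sub_quadratic_le {x : ℝ} (hx : 0 ≤ x) :
    |Real.exp (-x) - 1 + x - x ^ 2 / 2| ≤ x ^ 3 := by
  have h0 := (abs_le.1 (abs_exp_neg_sub_le hx)).2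
  rw [abs_of_nonpos (by linarith)]
  have hm : AntitoneOn (fun x => -(Real.exp (-x) - 1 + x - x ^ 2 / 2) - x ^ 3) (Ici 0) := by
    refine antitoneOn_Ici_of_hasDerivAt_nonpos (by fun_prop)
      (fun y _ => ((((hasDerivAt_exp_neg y).sub_const 1).add (hasDerivAt_id y)).sub
        (((hasDerivAt_id y).pow 2).div_const 2)).neg.sub ((hasDerivAt_id y).pow 3)) fun y hy => ?_
    have := (abs_le.1 (abs_exp_neg_sub_le (le_of_lt hy))).2
    simp only [id]
    norm_num
    nlinarith [sq_nonneg y]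
  have := hm self_mem_Ici hx hx
  simp at this
  linarith

namespace TailSolution

variable {ε C : ℝ} {F J : ℝ → ℝ}

/-- First step of the iteration: `0 ≤ J ≤ C` gives `|e^{-J} - 1| ≤ C` under the integral. Each later
step feeds the last bound for `F` through `tailRate`, then `J`, then `e^{-J}`, gaining one power of
`C`. -/
theorem abs_F_sub_le (h : TailSolution ε C F J) {ρ : ℝ} (hρ : ε ≤ ρ) :
    |F ρ - C * expIntE1 ρ| ≤ C ^ 2 * expIntE1 ρ := by
  have hρ0 := h.eps_pos.trans_le hρ
  have hi := integrableOn_exp_neg_div hρ0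
  rw [h.F_eq ρ hρ, ← mul_sub, expIntE1, abs_mul, abs_of_nonneg h.const_nonneg, sq, mul_assoc,
    ← integral_sub (h.integrableOn_integrand.mono_set (Ioi_subset_Ioi hρ)) hi]
  refine mul_le_mul_of_nonneg_left ?_ h.const_nonneg
  rw [← integral_const_mul]
  refine abs_setIntegral_Ioi_le (hi.const_mul C) fun x hx => ?_
  have hεx := hρ.trans hx.le
  have hx0 := h.eps_pos.trans_le hεx
  have h1 := h.exp_neg_J_le_one hεx
  have h2 := Real.one_sub_le_exp_neg (J x)
  have h3 := h.J_le_const hεx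
  rw [show Real.exp (-x) / x * Real.exp (-J x) - Real.exp (-x) / x
    = -(Real.exp (-x) / x * (1 - Real.exp (-J x))) by ring, abs_neg,
    abs_of_nonneg (mul_nonneg (by positivity) (by linarith)), mul_comm C]
  gcongr
  linarith

theorem abs_rate_sub_le (h : TailSolution ε C F J) (h1 : F ε ≤ Real.exp 1 - 1) {ρ : ℝ}
    (hρ : ε ≤ ρ) :
    |tailRate (F ρ) - C / Real.exp 1 * expIntE1 ρ|
      ≤ C ^ 2 * (expIntE1 ρ ^ 2 + expIntE1 ρ) := by
  have h2 := abs_tailRate_sub_linear_le (h.F_nonneg hρ) (h.F_le_of_left h1 hρ)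
  have h3 : F ρ ^ 2 ≤ (C * expIntE1 ρ) ^ 2 := pow_le_pow_left₀ (h.F_nonneg hρ) (h.F_le hρ) 2
  have h4 : |F ρ / Real.exp 1 - C / Real.exp 1 * expIntE1 ρ| ≤ C ^ 2 * expIntE1 ρ := by
    rw [show F ρ / Real.exp 1 - C / Real.exp 1 * expIntE1 ρ
      = (F ρ - C * expIntE1 ρ) / Real.exp 1 by ring, abs_div, abs_of_pos (Real.exp_pos 1)]
    exact (div_le_self (abs_nonneg _) (Real.one_le_exp zero_le_one)).trans (h.abs_F_sub_le hρ)
  have h5 := abs_sub_le (tailRate (F ρ)) (F ρ / Real.exp 1) (C / Real.exp 1 * expIntE1 ρ)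
  nlinarith

theorem abs_J_sub_le (h : TailSolution ε C F J) (h1 : F ε ≤ Real.exp 1 - 1) {τ : ℝ}
    (hτ : ε ≤ τ) : |J τ - C / Real.exp 1 * expIntTail τ| ≤ 3 * C ^ 2 := by
  have hτ0 := h.eps_pos.trans_le hτ
  obtain ⟨hi1, he1⟩ := expIntTail_integral hτ0
  obtain ⟨hi2, he2⟩ := expIntSq_integral hτ0
  have h2 := expIntTail_le_one hτ0
  have h3 := expIntSq_le_two hτ0
  rw [h.J_eq τ hτ, ← he1, ← integral_const_mul,
    ← integral_sub (h.integrable.mono_set (Ioi_subset_Ioi hτ)) (hi1.const_mul _)]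
  calc _ ≤ ∫ x in Ioi τ, C ^ 2 * (expIntE1 x ^ 2 + expIntE1 x) :=
        abs_setIntegral_Ioi_le ((Integrable.fun_add hi2 hi1).const_mul _)
          fun x hx => h.abs_rate_sub_le h1 (hτ.trans hx.le)
    _ = C ^ 2 * (expIntSq τ + expIntTail τ) := by
        rw [integral_const_mul, integral_add hi2 hi1, he1, he2]
    _ ≤ 3 * C ^ 2 := by nlinarith [sq_nonneg C]

theorem abs_exp_neg_J_sub_le (h : TailSolution ε C F J) (h1 : F ε ≤ Real.exp 1 - 1) {τ : ℝ}
    (hτ : ε ≤ τ) :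
    |Real.exp (-J τ) - (1 - C / Real.exp 1 * expIntTail τ)| ≤ 4 * C ^ 2 := by
  have h2 := abs_exp_neg_sub_le (h.J_nonneg hτ)
  have h3 := h.abs_J_sub_le h1 hτ
  have h4 : J τ ^ 2 ≤ C ^ 2 := pow_le_pow_left₀ (h.J_nonneg hτ) (h.J_le_const hτ) 2
  rw [abs_le] at *
  constructor <;> linarith

theorem abs_F_sub_second_le (h : TailSolution ε C F J) (h1 : F ε ≤ Real.exp 1 - 1) {ρ : ℝ}
    (hρ : ε ≤ ρ) :
    |F ρ - (C * expIntE1 ρ - C ^ 2 / Real.exp 1 * expIntSecond ρ)| ≤ 4 * C ^ 3 * expIntE1 ρ := by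
  have hρ0 := h.eps_pos.trans_le hρ
  have hi := integrableOn_exp_neg_div hρ0
  obtain ⟨hi2, he2⟩ := expIntSecond_integral hρ0
  have hi3 := h.integrableOn_integrand.mono_set (Ioi_subset_Ioi hρ)
  have h2 : F ρ - (C * expIntE1 ρ - C ^ 2 / Real.exp 1 * expIntSecond ρ)
      = C * ∫ x in Ioi ρ, (Real.exp (-x) / x * Real.exp (-J x) - (Real.exp (-x) / x
        - C / Real.exp 1 * (Real.exp (-x) / x * expIntTail x))) := by
    rw [integral_sub hi3 (IntegrableOn.fun_sub hi (hi2.const_mul _)),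
      integral_sub hi (hi2.const_mul _),
      integral_const_mul, he2, h.F_eq ρ hρ, expIntE1]
    ring
  rw [h2, abs_mul, abs_of_nonneg h.const_nonneg,
    show 4 * C ^ 3 * expIntE1 ρ = C * (4 * C ^ 2 * expIntE1 ρ) by ring]
  refine mul_le_mul_of_nonneg_left ?_ h.const_nonneg
  rw [expIntE1, ← integral_const_mul]
  refine abs_setIntegral_Ioi_le (hi.const_mul _) fun x hx => ?_
  have hεx := hρ.trans hx.le
  have hx0 := h.eps_pos.trans_le hεx
  have h3 := h.abs_exp_neg_J_sub_le h1 hεx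
  rw [show Real.exp (-x) / x * Real.exp (-J x) - (Real.exp (-x) / x
      - C / Real.exp 1 * (Real.exp (-x) / x * expIntTail x))
      = Real.exp (-x) / x * (Real.exp (-J x) - (1 - C / Real.exp 1 * expIntTail x)) by ring,
    abs_mul, abs_of_nonneg (by positivity), mul_comm (4 * C ^ 2)]
  gcongr

theorem abs_rate_sub_second_le (h : TailSolution ε C F J) (h1 : F ε ≤ Real.exp 1 - 1) {ρ : ℝ}
    (hρ : ε ≤ ρ) :
    |tailRate (F ρ) - (C / Real.exp 1 * expIntE1 ρ - C ^ 2 / Real.exp 1 ^ 2 * expIntSecond ρ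
        + C ^ 2 / (2 * Real.exp 1 ^ 2) * expIntE1 ρ ^ 2)|
      ≤ C ^ 3 * (expIntE1 ρ ^ 3 + expIntE1 ρ ^ 2 + 4 * expIntE1 ρ) := by
  have hρ0 := h.eps_pos.trans_le hρ
  have hE := expIntE1_nonneg hρ0
  have hC := h.const_nonneg
  have he : 1 ≤ Real.exp 1 := Real.one_le_exp zero_le_one
  have he0 := Real.exp_pos 1
  have hF0 := h.F_nonneg hρ
  have h2 := abs_tailRate_sub_quadratic_le hF0 (h.F_le_of_left h1 hρ)
  have h3 : F ρ ^ 3 ≤ (C * expIntE1 ρ) ^ 3 := pow_le_pow_left₀ hF0 (h.F_le hρ) 3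
  have h4 : |(F ρ - (C * expIntE1 ρ - C ^ 2 / Real.exp 1 * expIntSecond ρ)) / Real.exp 1|
      ≤ 4 * C ^ 3 * expIntE1 ρ := by
    rw [abs_div, abs_of_pos he0]
    exact (div_le_self (abs_nonneg _) he).trans (h.abs_F_sub_second_le h1 hρ)
  have h5 : |(F ρ ^ 2 - (C * expIntE1 ρ) ^ 2) / (2 * Real.exp 1 ^ 2)|
      ≤ C ^ 3 * expIntE1 ρ ^ 2 := by
    have h6 : |F ρ ^ 2 - (C * expIntE1 ρ) ^ 2|
        ≤ C ^ 2 * expIntE1 ρ * (2 * (C * expIntE1 ρ)) := by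
      rw [show F ρ ^ 2 - (C * expIntE1 ρ) ^ 2
        = (F ρ - C * expIntE1 ρ) * (F ρ + C * expIntE1 ρ) by ring, abs_mul]
      refine mul_le_mul (h.abs_F_sub_le hρ) ?_ (abs_nonneg _) (by positivity)
      have := h.F_le hρ
      rw [abs_of_nonneg (by positivity)]
      linarith
    rw [abs_div, abs_of_pos (by positivity : 0 < 2 * Real.exp 1 ^ 2), div_le_iff₀ (by positivity)]
    have h7 : 1 ≤ Real.exp 1 ^ 2 := one_le_pow₀ he
    have h8 : 0 ≤ C ^ 3 * expIntE1 ρ ^ 2 := by positivity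
    nlinarith
  have h6 : tailRate (F ρ) - (C / Real.exp 1 * expIntE1 ρ
        - C ^ 2 / Real.exp 1 ^ 2 * expIntSecond ρ + C ^ 2 / (2 * Real.exp 1 ^ 2) * expIntE1 ρ ^ 2)
      = (tailRate (F ρ) - F ρ / Real.exp 1 - F ρ ^ 2 / (2 * Real.exp 1 ^ 2))
        + (F ρ - (C * expIntE1 ρ - C ^ 2 / Real.exp 1 * expIntSecond ρ)) / Real.exp 1
        + (F ρ ^ 2 - (C * expIntE1 ρ) ^ 2) / (2 * Real.exp 1 ^ 2) := by
    field_simp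
    ring
  rw [h6]
  refine (abs_add_three _ _ _).trans ?_
  nlinarith

/-- The constant is `6 + 2 + 4`, from the bounds on `∫ E₁³`, `∫ E₁²` and `4 ∫ E₁`. -/
theorem abs_J_sub_second_le (h : TailSolution ε C F J) (h1 : F ε ≤ Real.exp 1 - 1) {τ : ℝ}
    (hτ : ε ≤ τ) :
    |J τ - (C / Real.exp 1 * expIntTail τ - C ^ 2 / Real.exp 1 ^ 2 * expIntSecondTail τ
        + C ^ 2 / (2 * Real.exp 1 ^ 2) * expIntSq τ)| ≤ 12 * C ^ 3 := by
  have hτ0 := h.eps_pos.trans_le hτ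
  obtain ⟨hi1, he1⟩ := expIntTail_integral hτ0
  obtain ⟨hi2, he2⟩ := expIntSq_integral hτ0
  obtain ⟨hi3, he3⟩ := expIntE1_cube_integral hτ0
  obtain ⟨hi4, he4⟩ := expIntSecondTail_integral hτ0
  have h2 := expIntTail_le_one hτ0
  have h3 := expIntSq_le_two hτ0
  have h4 : J τ - (C / Real.exp 1 * expIntTail τ - C ^ 2 / Real.exp 1 ^ 2 * expIntSecondTail τ
        + C ^ 2 / (2 * Real.exp 1 ^ 2) * expIntSq τ)
      = ∫ ρ in Ioi τ, (tailRate (F ρ) - (C / Real.exp 1 * expIntE1 ρ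
        - C ^ 2 / Real.exp 1 ^ 2 * expIntSecond ρ
        + C ^ 2 / (2 * Real.exp 1 ^ 2) * expIntE1 ρ ^ 2)) := by
    have hi5 := hi1.const_mul (C / Real.exp 1)
    have hi6 := hi4.const_mul (C ^ 2 / Real.exp 1 ^ 2)
    have hi7 := hi2.const_mul (C ^ 2 / (2 * Real.exp 1 ^ 2))
    rw [integral_sub (h.integrable.mono_set (Ioi_subset_Ioi hτ))
      (IntegrableOn.fun_add (IntegrableOn.fun_sub hi5 hi6) hi7),
      integral_add (IntegrableOn.fun_sub hi5 hi6) hi7, integral_sub hi5 hi6, integral_const_mul,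
      integral_const_mul, integral_const_mul, he1, he2, he4, ← h.J_eq τ hτ]
  rw [h4]
  calc _ ≤ ∫ x in Ioi τ, C ^ 3 * (expIntE1 x ^ 3 + expIntE1 x ^ 2 + 4 * expIntE1 x) :=
        abs_setIntegral_Ioi_le
          (((Integrable.fun_add hi3 hi2).fun_add (hi1.const_mul 4)).const_mul _)
          fun x hx => h.abs_rate_sub_second_le h1 (hτ.trans hx.le)
    _ = C ^ 3 * ((∫ x in Ioi τ, expIntE1 x ^ 3) + expIntSq τ + 4 * expIntTail τ) := by
        rw [integral_const_mul, integral_add (Integrable.fun_add hi3 hi2) (hi1.const_mul 4),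
          integral_add hi3 hi2, integral_const_mul, he1, he2]
    _ ≤ 12 * C ^ 3 := by
        have : 0 ≤ C ^ 3 := pow_nonneg h.const_nonneg 3
        nlinarith

/-- The bound of `abs_F_sub_second_le` has an error `C³ E₁(ε)`, of order `l⁻²` only. Integrating by
parts, `F(ε) = C E₁(ε) e^{-J(ε)} + C ∫ E₁ tailRate(F) e^{-J}`, isolates the large factor `E₁(ε)`
exactly. The remaining integral needs only leading order, with error `C³ (6 + 2·2)`. -/
theorem abs_F_sub_boundary_le (h : TailSolution ε C F J) (h1 : F ε ≤ Real.exp 1 - 1) :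
    |F ε - (C * expIntE1 ε * Real.exp (-J ε) + C ^ 2 / Real.exp 1 * expIntSq ε)|
      ≤ 10 * C ^ 3 := by
  have hε := h.eps_pos
  have hC := h.const_nonneg
  obtain ⟨hi2, he2⟩ := expIntSq_integral hε
  obtain ⟨hi3, he3⟩ := expIntE1_cube_integral hε
  have hE : ∀ x, ε < x → 0 ≤ expIntE1 x := fun x hx => expIntE1_nonneg (hε.trans hx)
  have hrate0 : ∀ x, ε < x → 0 ≤ tailRate (F x) := fun x hx => tailRate_nonneg (h.F_nonneg hx.le)
  have hrate1 : ∀ x, ε < x → tailRate (F x) ≤ C * expIntE1 x := fun x hx =>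
    (tailRate_le_self (h.F_nonneg hx.le)).trans (h.F_le hx.le)
  have hd : ∀ x, ε < x → HasDerivAt (fun x => F x - C * expIntE1 x * Real.exp (-J x))
      (-(C * (expIntE1 x * tailRate (F x) * Real.exp (-J x)))) x := by
    intro x hx
    have hx0 := hε.trans hx
    refine ((h.hasDerivAt_F hx).sub (((hasDerivAt_expIntE1 hx0).const_mul C).mul
      (h.hasDerivAt_J hx).neg.exp)).congr_deriv ?_
    simp only [flux, Pi.neg_apply]
    rw [neg_add, Real.exp_add]
    ring
  have hlim : Tendsto (fun x => F x - C * expIntE1 x * Real.exp (-J x)) atTop (𝓝 0) := by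
    have h2 := h.tendsto_F.sub ((tendsto_expIntE1_atTop.const_mul C).mul
      ((Real.continuous_exp.tendsto _).comp h.tendsto_J.neg))
    simpa using h2
  have hcont : ContinuousOn (fun x => F x - C * expIntE1 x * Real.exp (-J x)) (Ici ε) :=
    h.continuousOn_F.sub ((continuousOn_const.mul (continuousOn_expIntE1.mono
      fun x hx => hε.trans_le hx)).mul (Real.continuous_exp.comp_continuousOn h.continuousOn_J.neg))
  have hneg : ∀ x ∈ Ioi ε, -(C * (expIntE1 x * tailRate (F x) * Real.exp (-J x))) ≤ 0 :=
    fun x hx => neg_nonpos.2 (mul_nonneg hC (mul_nonneg (mul_nonneg (hE x hx) (hrate0 x hx))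
      (Real.exp_pos _).le))
  have hint := integrableOn_Ioi_deriv_of_nonpos (hcont ε self_mem_Ici) hd hneg hlim
  have heq := integral_Ioi_of_hasDerivAt_of_nonpos (hcont ε self_mem_Ici) hd hneg hlim
  have hi5 := hi2.const_mul (C ^ 2 / Real.exp 1)
  have h2 : F ε - (C * expIntE1 ε * Real.exp (-J ε) + C ^ 2 / Real.exp 1 * expIntSq ε)
      = -∫ x in Ioi ε, (-(C * (expIntE1 x * tailRate (F x) * Real.exp (-J x)))
        + C ^ 2 / Real.exp 1 * expIntE1 x ^ 2) := by
    rw [integral_add hint hi5, heq, integral_const_mul, he2]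
    ring
  rw [h2, abs_neg]
  calc _ ≤ ∫ x in Ioi ε, C ^ 3 * (expIntE1 x ^ 3 + 2 * expIntE1 x ^ 2) := by
        refine abs_setIntegral_Ioi_le ((Integrable.fun_add hi3 (hi2.const_mul 2)).const_mul _)
          fun x hx => ?_
        have h3 := h.abs_rate_sub_le h1 hx.le
        have h4 := hE x hx
        have h5 : |tailRate (F x) * (1 - Real.exp (-J x))| ≤ C * expIntE1 x * C := by
          have h6 := h.exp_neg_J_le_one hx.le
          have h7 := Real.one_sub_le_exp_neg (J x)
          have h8 := h.J_le_const hx.le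
          rw [abs_of_nonneg (mul_nonneg (hrate0 x hx) (by linarith))]
          exact mul_le_mul (hrate1 x hx) (by linarith) (by linarith) (by positivity)
        rw [show -(C * (expIntE1 x * tailRate (F x) * Real.exp (-J x)))
            + C ^ 2 / Real.exp 1 * expIntE1 x ^ 2
            = C * expIntE1 x * (tailRate (F x) * (1 - Real.exp (-J x))
              - (tailRate (F x) - C / Real.exp 1 * expIntE1 x)) by ring, abs_mul,
          abs_of_nonneg (by positivity)]
        calc _ ≤ C * expIntE1 x * (C * expIntE1 x * C
              + C ^ 2 * (expIntE1 x ^ 2 + expIntE1 x)) := by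
              refine mul_le_mul_of_nonneg_left ?_ (by positivity)
              exact (abs_sub _ _).trans (add_le_add h5 h3)
          _ = _ := by ring
    _ = C ^ 3 * ((∫ x in Ioi ε, expIntE1 x ^ 3) + 2 * expIntSq ε) := by
        rw [integral_const_mul, integral_add hi3 (hi2.const_mul 2), integral_const_mul, he2]
    _ ≤ 10 * C ^ 3 := by
        have h3 := expIntSq_le_two hε
        have : 0 ≤ C ^ 3 := pow_nonneg hC 3
        nlinarith

end TailSolution

end Estimates

/-! ### Asymptotic scales in `l = log (1/ε)`. -/

section SmallParameter

theorem tendsto_logInv : Tendsto logInv (𝓝[>] 0) atTop := by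
  refine Real.tendsto_log_atTop.comp ?_
  exact tendsto_inv_nhdsGT_zero.congr fun ε => (one_div ε).symm

theorem log_eq_neg_logInv (ε : ℝ) : Real.log ε = -logInv ε := by
  rw [logInv, one_div, Real.log_inv, neg_neg]

theorem eps_isBigO (n : ℕ) :
    (fun ε : ℝ => ε) =O[𝓝[>] 0] fun ε => (1 / logInv ε) ^ n := by
  have h1 : (fun ε : ℝ => logInv ε ^ n) =o[𝓝[>] 0] fun ε => 1 / ε := by
    have h2 : Tendsto (fun ε : ℝ => 1 / ε) (𝓝[>] 0) atTop := by
      simpa using tendsto_inv_nhdsGT_zero (𝕜 := ℝ)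
    exact Real.isLittleO_pow_log_id_atTop.comp_tendsto h2
  have h3 := h1.isBigO.inv_rev (by
    filter_upwards [tendsto_logInv.eventually_gt_atTop 0] with ε hε h0
    exact absurd h0 (pow_pos hε n).ne')
  refine h3.congr (fun ε => by simp) fun ε => by simp

theorem one_div_logInv_isBigO_one : (fun ε : ℝ => 1 / logInv ε) =O[𝓝[>] 0] fun _ => (1 : ℝ) := by
  refine IsBigO.of_bound 1 ?_
  filter_upwards [tendsto_logInv.eventually_ge_atTop 1] with ε hε
  rw [norm_one, mul_one, Real.norm_eq_abs, abs_of_nonneg (by positivity)]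
  exact (div_le_one (by linarith)).2 hε

theorem one_div_logInv_pow_isBigO {m n : ℕ} (hmn : m ≤ n) :
    (fun ε : ℝ => (1 / logInv ε) ^ n) =O[𝓝[>] 0] fun ε => (1 / logInv ε) ^ m := by
  obtain ⟨k, rfl⟩ := Nat.exists_eq_add_of_le hmn
  have h := (isBigO_refl (fun ε : ℝ => (1 / logInv ε) ^ m) (𝓝[>] 0)).mul
    (one_div_logInv_isBigO_one.pow k)
  exact h.congr (fun ε => by rw [pow_add]) fun ε => by simp

theorem eps_mul_sq_isBigO :
    (fun ε : ℝ => ε * logInv ε ^ 2) =O[𝓝[>] 0] fun ε => (1 / logInv ε) ^ 3 := by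
  -- The power `5` is `3 + 2`, to pay for `l²`.
  refine ((eps_isBigO 5).mul (isBigO_refl (fun ε => logInv ε ^ 2) _)).congr'
    EventuallyEq.rfl ?_
  filter_upwards [tendsto_logInv.eventually_gt_atTop 0] with ε hε
  field_simp

theorem eventually_expIntE1_le_logInv :
    ∀ᶠ ε in 𝓝[>] (0 : ℝ), 0 < ε ∧ 1 ≤ logInv ε ∧ |expIntE1 ε - (logInv ε
      - Real.eulerMascheroniConstant)| ≤ ε ∧ expIntE1 ε ≤ logInv ε := by
  filter_upwards [Ioo_mem_nhdsGT (show (0 : ℝ) < 1 / 2 by norm_num),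
    tendsto_logInv.eventually_ge_atTop 1] with ε hε hl
  have h1 := expIntE1_add_log_bounds hε.1
  rw [log_eq_neg_logInv] at h1
  have h2 := Real.one_half_lt_eulerMascheroniConstant
  refine ⟨hε.1, hl, ?_, by linarith [h1.2, hε.2]⟩
  rw [abs_le]
  constructor <;> linarith [h1.1, h1.2, hε.1]

theorem abs_expIntTail_sub_one_le {t : ℝ} (ht : 0 < t) :
    |expIntTail t - 1| ≤ t + t * expIntE1 t := by
  have h1 := Real.one_sub_le_exp_neg t
  have h2 := expIntTail_le_one ht
  rw [abs_of_nonpos (by linarith), expIntTail]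
  linarith

/-- The limit is that of `E₁(t) - E₁(2t)`, in which `γ` and `log t` cancel and `log 2` remains. -/
theorem abs_expIntDamped_sub_le {t : ℝ} (ht : 0 < t) :
    |expIntDamped t - Real.log 2| ≤ t * expIntE1 t + 3 * t := by
  have h1 := expIntE1_add_log_bounds ht
  have h2 := expIntE1_add_log_bounds (t := 2 * t) (by positivity)
  rw [Real.log_mul two_ne_zero ht.ne'] at h2
  have h3 := Real.one_sub_le_exp_neg t
  have h4 : Real.exp (-t) ≤ 1 := Real.exp_le_one_iff.2 (by linarith)
  have h5 := expIntE1_nonneg ht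
  have h6 : (1 - Real.exp (-t)) * expIntE1 t ≤ t * expIntE1 t :=
    mul_le_mul_of_nonneg_right (by linarith) h5
  have h7 : 0 ≤ (1 - Real.exp (-t)) * expIntE1 t := mul_nonneg (by linarith) h5
  rw [expIntDamped, abs_le]
  constructor <;> nlinarith [h1.1, h1.2, h2.1, h2.2]

theorem expInt_errors :
    ((fun ε => expIntTail ε - 1) =O[𝓝[>] 0] fun ε => (1 / logInv ε) ^ 3) ∧
    ((fun ε => expIntSq ε - 2 * Real.log 2) =O[𝓝[>] 0] fun ε => (1 / logInv ε) ^ 3) ∧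
    ((fun ε => expIntSecondTail ε - (1 - Real.log 2)) =O[𝓝[>] 0]
      fun ε => (1 / logInv ε) ^ 3) := by
  have key : ∀ᶠ ε in 𝓝[>] (0 : ℝ), |expIntTail ε - 1| ≤ 9 * (ε * logInv ε ^ 2) ∧
      |expIntSq ε - 2 * Real.log 2| ≤ 9 * (ε * logInv ε ^ 2) ∧
      |expIntSecondTail ε - (1 - Real.log 2)| ≤ 9 * (ε * logInv ε ^ 2) := by
    filter_upwards [eventually_expIntE1_le_logInv] with ε hε
    obtain ⟨h0, hl, -, hE⟩ := hε
    have hE0 := expIntE1_nonneg h0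
    have h1 := abs_expIntTail_sub_one_le h0
    have h2 := abs_expIntDamped_sub_le h0
    have h3 := abs_expIntTail_sub_one_le (t := 2 * ε) (by positivity)
    have h4 := expIntE1_antitone h0 (by linarith : ε ≤ 2 * ε)
    have h5 : ε * expIntE1 ε ≤ ε * logInv ε ^ 2 := by
      gcongr
      nlinarith
    have h6 : ε ≤ ε * logInv ε ^ 2 := le_mul_of_one_le_right h0.le (one_le_pow₀ hl)
    have h7 : ε * expIntE1 (2 * ε) ≤ ε * expIntE1 ε := by gcongr
    have h8 : ε * expIntE1 ε ^ 2 ≤ ε * logInv ε ^ 2 := by gcongr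
    have h9 : 0 ≤ ε * expIntE1 ε ^ 2 := by positivity
    rw [abs_le] at h2 h3
    refine ⟨by linarith, ?_, ?_⟩
    · rw [expIntSq, abs_le]
      constructor <;> linarith
    · rw [expIntSecondTail, abs_le]
      constructor <;> linarith
  refine ⟨?_, ?_, ?_⟩
  · refine (IsBigO.of_bound 9 ?_).trans eps_mul_sq_isBigO
    filter_upwards [key, self_mem_nhdsWithin] with ε h h0
    have : 0 ≤ ε * logInv ε ^ 2 := mul_nonneg (le_of_lt h0) (sq_nonneg _)
    rw [Real.norm_eq_abs, Real.norm_eq_abs, abs_of_nonneg this]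
    exact h.1
  · refine (IsBigO.of_bound 9 ?_).trans eps_mul_sq_isBigO
    filter_upwards [key, self_mem_nhdsWithin] with ε h h0
    have : 0 ≤ ε * logInv ε ^ 2 := mul_nonneg (le_of_lt h0) (sq_nonneg _)
    rw [Real.norm_eq_abs, Real.norm_eq_abs, abs_of_nonneg this]
    exact h.2.1
  · refine (IsBigO.of_bound 9 ?_).trans eps_mul_sq_isBigO
    filter_upwards [key, self_mem_nhdsWithin] with ε h h0
    have : 0 ≤ ε * logInv ε ^ 2 := mul_nonneg (le_of_lt h0) (sq_nonneg _)
    rw [Real.norm_eq_abs, Real.norm_eq_abs, abs_of_nonneg this]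
    exact h.2.2

end SmallParameter

/-! ### Inverting the equation for the constant. -/

section Bootstrap

/-- Solving `c = Y - x (γ Y + Y² / e) + x² (p Y² + q Y³) + r x³ Y³ + O(x³)` for bounded `Y`. -/
theorem expansion_of_perturbed_root {L : Filter ℝ} {x Y : ℝ → ℝ} {c g k p q r : ℝ}
    (hx : x =O[L] fun _ => (1 : ℝ)) (hY : Y =O[L] fun _ => (1 : ℝ))
    (h : (fun ε => c - (Y ε - x ε * (g * Y ε + k * Y ε ^ 2)
      + x ε ^ 2 * (p * Y ε ^ 2 + q * Y ε ^ 3) + r * x ε ^ 3 * Y ε ^ 3)) =O[L] fun ε => x ε ^ 3) :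
    (fun ε => Y ε - (c + (g * c + k * c ^ 2) * x ε
      + ((g + 2 * k * c) * (g * c + k * c ^ 2) - (p * c ^ 2 + q * c ^ 3)) * x ε ^ 2))
      =O[L] fun ε => x ε ^ 3 := by
  have hxx := isBigO_refl x L
  have hc : ∀ a : ℝ, (fun _ : ℝ => a) =O[L] fun _ => (1 : ℝ) := fun a =>
    isBigO_const_const a one_ne_zero L
  have hm : ∀ {f g : ℝ → ℝ}, f =O[L] (fun _ => (1 : ℝ)) → g =O[L] (fun _ => (1 : ℝ)) →
      (fun ε => f ε * g ε) =O[L] fun _ => (1 : ℝ) := fun hf hg => by simpa using hf.mul hg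
  have hY2 : (fun ε => Y ε ^ 2) =O[L] fun _ => (1 : ℝ) := by simpa using hY.pow 2
  have hY3 : (fun ε => Y ε ^ 3) =O[L] fun _ => (1 : ℝ) := by simpa using hY.pow 3
  have hx32 : (fun ε => x ε ^ 3) =O[L] fun ε => x ε ^ 2 :=
    ((hxx.pow 2).mul hx).congr (fun ε => by ring) fun ε => by ring
  have hx21 : (fun ε => x ε ^ 2) =O[L] x :=
    (hxx.mul hx).congr (fun ε => by ring) fun ε => by ring
  have hrest : (fun ε => r * x ε ^ 3 * Y ε ^ 3) =O[L] fun ε => x ε ^ 3 :=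
    (((hc r).mul (hxx.pow 3)).mul hY3).congr_right fun ε => by ring
  have h3 : (fun ε => c - (Y ε - x ε * (g * Y ε + k * Y ε ^ 2)
      + x ε ^ 2 * (p * Y ε ^ 2 + q * Y ε ^ 3))) =O[L] fun ε => x ε ^ 3 :=
    (h.add hrest).congr_left fun ε => by ring
  have hsq : (fun ε => x ε ^ 2 * (p * Y ε ^ 2 + q * Y ε ^ 3)) =O[L] fun ε => x ε ^ 2 :=
    ((hxx.pow 2).mul ((hm (hc p) hY2).add (hm (hc q) hY3))).congr_right fun ε => by ring
  have h2 : (fun ε => c - (Y ε - x ε * (g * Y ε + k * Y ε ^ 2))) =O[L] fun ε => x ε ^ 2 :=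
    ((h3.trans hx32).add hsq).congr_left fun ε => by ring
  have hlin : (fun ε => x ε * (g * Y ε + k * Y ε ^ 2)) =O[L] x :=
    (hxx.mul ((hm (hc g) hY).add (hm (hc k) hY2))).congr_right
      fun ε => by ring
  -- Bootstrap: the equation truncated at each order, with the previous approximation substituted in
  -- the terms carrying a factor `x`, gains one power of `x`. This is the first round; `h4` is the
  -- second and the last line the third.
  have h1 : (fun ε => Y ε - c) =O[L] x :=
    (hlin.sub (h2.trans hx21)).congr_left fun ε => by ring
  have hYc : (fun ε => Y ε + c) =O[L] fun _ => (1 : ℝ) := hY.add (hc c)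
  have h4 : (fun ε => Y ε - (c + (g * c + k * c ^ 2) * x ε)) =O[L] fun ε => x ε ^ 2 := by
    have h5 : (fun ε => x ε * ((Y ε - c) * (g + k * (Y ε + c)))) =O[L] fun ε => x ε ^ 2 :=
      (hxx.mul (h1.mul ((hc g).add (hm (hc k) hYc)))).congr_right fun ε => by ring
    exact (h5.sub h2).congr_left fun ε => by ring
  have h5 : (fun ε => x ε * ((Y ε - (c + (g * c + k * c ^ 2) * x ε)) * (g + k * (Y ε + c))))
      =O[L] fun ε => x ε ^ 3 :=
    (hxx.mul (h4.mul ((hc g).add (hm (hc k) hYc)))).congr_right fun ε => by ring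
  have h6 : (fun ε => (g * c + k * c ^ 2) * k * (x ε ^ 2 * (Y ε - c))) =O[L] fun ε => x ε ^ 3 :=
    ((hc _).mul ((hxx.pow 2).mul h1)).congr_right fun ε => by ring
  have h7 : (fun ε => x ε ^ 2 * ((Y ε - c) * (p * (Y ε + c) + q * (Y ε ^ 2 + c * Y ε + c ^ 2))))
      =O[L] fun ε => x ε ^ 3 := by
    have h8 : (fun ε => Y ε ^ 2 + c * Y ε + c ^ 2) =O[L] fun _ => (1 : ℝ) :=
      (hY2.add (hm (hc c) hY)).add (hc _)
    exact ((hxx.pow 2).mul (h1.mul ((hm (hc p) hYc).add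
      (hm (hc q) h8)))).congr_right fun ε => by ring
  exact (((h5.add h6).sub h7).sub h3).congr_left fun ε => by ring

end Bootstrap

/-! ### Expansion of the constant, and the outer and inner expansions. -/

section Expansions

/-- A family of solutions of the boundary value problem, one for each `ε > 0`. -/
structure TailFamily (C : ℝ → ℝ) (F J : ℝ → ℝ → ℝ) : Prop where
  sol : ∀ ε, 0 < ε → TailSolution ε (C ε) (F ε) (J ε)
  left : ∀ ε, 0 < ε → F ε ε = Real.exp 1 - 1

theorem coeffB_eq : coeffB = (Real.eulerMascheroniConstant + 2 * (1 / Real.exp 1)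
      * (Real.exp 1 - 1)) * coeffA
    - ((Real.eulerMascheroniConstant * (1 / Real.exp 1) + 2 * Real.log 2 * (1 / Real.exp 1))
        * (Real.exp 1 - 1) ^ 2
      + (-((2 * Real.log 2 - 3 / 2) / Real.exp 1 ^ 2)) * (Real.exp 1 - 1) ^ 3) := by
  have := (Real.exp_pos 1).ne'
  rw [coeffB]
  field_simp
  ring

theorem coeffA_eq : coeffA = Real.eulerMascheroniConstant * (Real.exp 1 - 1)
    + 1 / Real.exp 1 * (Real.exp 1 - 1) ^ 2 := by
  have := (Real.exp_pos 1).ne'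
  rw [coeffA]
  field_simp
  ring

namespace TailFamily

variable {C : ℝ → ℝ} {F J : ℝ → ℝ → ℝ}

theorem const_isBigO (h : TailFamily C F J) : C =O[𝓝[>] 0] fun ε => 1 / logInv ε := by
  refine IsBigO.of_bound ((Real.exp 1 - 1) * Real.exp (1 + (Real.exp 1 - 1))) ?_
  filter_upwards [Ioo_mem_nhdsGT one_pos, tendsto_logInv.eventually_ge_atTop 1] with ε hε hl
  have hsol := h.sol ε hε.1
  have h1 := hsol.const_le (h.left ε hε.1).le hε.2
  rw [← logInv] at h1
  have he : 0 ≤ Real.exp 1 - 1 := sub_nonneg.2 (Real.one_le_exp zero_le_one)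
  rw [Real.norm_eq_abs, Real.norm_eq_abs, abs_of_nonneg hsol.const_nonneg,
    abs_of_nonneg (by positivity)]
  refine h1.trans ?_
  have h2 : (Real.exp 1 - 1) / logInv ε ≤ Real.exp 1 - 1 := div_le_self he hl
  calc _ ≤ (Real.exp 1 - 1) / logInv ε * Real.exp (1 + (Real.exp 1 - 1)) := by gcongr
    _ = _ := by ring

theorem const_pow_isBigO (h : TailFamily C F J) (n : ℕ) :
    (fun ε => C ε ^ n) =O[𝓝[>] 0] fun ε => (1 / logInv ε) ^ n := h.const_isBigO.pow n

theorem const_isBigO_one (h : TailFamily C F J) : C =O[𝓝[>] 0] fun _ => (1 : ℝ) :=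
  h.const_isBigO.trans one_div_logInv_isBigO_one

theorem J_expansion (h : TailFamily C F J) :
    (fun ε => J ε ε - (C ε / Real.exp 1 + C ε ^ 2 * ((2 * Real.log 2 - 1) / Real.exp 1 ^ 2)))
      =O[𝓝[>] 0] fun ε => (1 / logInv ε) ^ 3 := by
  obtain ⟨h1, h2, h3⟩ := expInt_errors
  have h4 : (fun ε => J ε ε - (C ε / Real.exp 1 * expIntTail ε
      - C ε ^ 2 / Real.exp 1 ^ 2 * expIntSecondTail ε
      + C ε ^ 2 / (2 * Real.exp 1 ^ 2) * expIntSq ε))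
      =O[𝓝[>] 0] fun ε => (1 / logInv ε) ^ 3 := by
    refine IsBigO.trans (IsBigO.of_bound 12 ?_) (h.const_pow_isBigO 3)
    filter_upwards [self_mem_nhdsWithin] with ε hε
    have hsol := h.sol ε hε
    rw [Real.norm_eq_abs, Real.norm_eq_abs, abs_of_nonneg (pow_nonneg hsol.const_nonneg 3)]
    exact hsol.abs_J_sub_second_le (h.left ε hε).le le_rfl
  have hC1 := h.const_isBigO_one
  have hC2 : (fun ε => C ε ^ 2) =O[𝓝[>] 0] fun _ => (1 : ℝ) := by simpa using hC1.pow 2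
  have h5 := (hC1.mul h1).const_mul_left (1 / Real.exp 1)
  have h6 := (hC2.mul h3).const_mul_left (1 / Real.exp 1 ^ 2)
  have h7 := (hC2.mul h2).const_mul_left (1 / (2 * Real.exp 1 ^ 2))
  simp only [one_mul] at h5 h6 h7
  refine (((h4.add h5).sub h6).add h7).congr_left fun ε => ?_
  have := (Real.exp_pos 1).ne'
  field_simp
  ring

theorem J_isBigO (h : TailFamily C F J) :
    (fun ε => J ε ε) =O[𝓝[>] 0] fun ε => 1 / logInv ε := by
  refine IsBigO.trans (IsBigO.of_bound 1 ?_) h.const_isBigO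
  filter_upwards [self_mem_nhdsWithin] with ε hε
  have hsol := h.sol ε hε
  rw [Real.norm_eq_abs, Real.norm_eq_abs, abs_of_nonneg hsol.const_nonneg,
    abs_of_nonneg (hsol.J_nonneg le_rfl), one_mul]
  exact hsol.J_le_const le_rfl

theorem exp_neg_J_expansion (h : TailFamily C F J) :
    (fun ε => Real.exp (-J ε ε) - (1 - C ε * (1 / Real.exp 1)
        - C ε ^ 2 * ((2 * Real.log 2 - 3 / 2) / Real.exp 1 ^ 2)))
      =O[𝓝[>] 0] fun ε => (1 / logInv ε) ^ 3 := by
  have h1 : (fun ε => Real.exp (-J ε ε) - 1 + J ε ε - J ε ε ^ 2 / 2)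
      =O[𝓝[>] 0] fun ε => (1 / logInv ε) ^ 3 := by
    refine IsBigO.trans (IsBigO.of_bound 1 ?_) (h.J_isBigO.pow 3)
    filter_upwards [self_mem_nhdsWithin] with ε hε
    have h0 := (h.sol ε hε).J_nonneg le_rfl
    rw [Real.norm_eq_abs, Real.norm_eq_abs, one_mul, abs_of_nonneg (pow_nonneg h0 3)]
    exact abs_exp_neg_sub_quadratic_le h0
  have h2 := h.J_expansion
  have h3 : (fun ε => J ε ε - C ε / Real.exp 1) =O[𝓝[>] 0] fun ε => (1 / logInv ε) ^ 2 :=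
    ((h2.trans (one_div_logInv_pow_isBigO (by norm_num))).add ((h.const_pow_isBigO 2).const_mul_left
      ((2 * Real.log 2 - 1) / Real.exp 1 ^ 2))).congr_left fun ε => by ring
  have h4 : (fun ε => J ε ε + C ε / Real.exp 1) =O[𝓝[>] 0] fun ε => 1 / logInv ε :=
    (h.J_isBigO.add (h.const_isBigO.const_mul_left (1 / Real.exp 1))).congr_left
      fun ε => by ring
  have h5 : (fun ε => (J ε ε - C ε / Real.exp 1) * (J ε ε + C ε / Real.exp 1))
      =O[𝓝[>] 0] fun ε => (1 / logInv ε) ^ 3 := (h3.mul h4).congr_right fun ε => by ring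
  refine ((h1.sub h2).add (h5.const_mul_left (1 / 2))).congr_left fun ε => ?_
  have := (Real.exp_pos 1).ne'
  field_simp
  ring

/-- The boundary condition `F(ε) = e - 1` with each ingredient expanded. The error of `e^{-J}` is
harmless because its factor `C (l - γ)` is bounded. -/
theorem const_equation (h : TailFamily C F J) :
    (fun ε => Real.exp 1 - 1 - (C ε * (logInv ε - Real.eulerMascheroniConstant)
        * (1 - C ε * (1 / Real.exp 1) - C ε ^ 2 * ((2 * Real.log 2 - 3 / 2) / Real.exp 1 ^ 2))
        + C ε ^ 2 * (1 / Real.exp 1) * (2 * Real.log 2)))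
      =O[𝓝[>] 0] fun ε => (1 / logInv ε) ^ 3 := by
  obtain ⟨-, hsq, -⟩ := expInt_errors
  have hC1 := h.const_isBigO_one
  have hC2 : (fun ε => C ε ^ 2) =O[𝓝[>] 0] fun _ => (1 : ℝ) := by simpa using hC1.pow 2
  have h1 : (fun ε => Real.exp 1 - 1 - (C ε * expIntE1 ε * Real.exp (-J ε ε)
      + C ε ^ 2 / Real.exp 1 * expIntSq ε)) =O[𝓝[>] 0] fun ε => (1 / logInv ε) ^ 3 := by
    refine IsBigO.trans (IsBigO.of_bound 10 ?_) (h.const_pow_isBigO 3)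
    filter_upwards [self_mem_nhdsWithin] with ε hε
    have hsol := h.sol ε hε
    rw [Real.norm_eq_abs, Real.norm_eq_abs, abs_of_nonneg (pow_nonneg hsol.const_nonneg 3),
      ← h.left ε hε]
    exact hsol.abs_F_sub_boundary_le (h.left ε hε).le
  have h2 : (fun ε => expIntE1 ε - (logInv ε - Real.eulerMascheroniConstant))
      =O[𝓝[>] 0] fun ε => (1 / logInv ε) ^ 3 := by
    refine IsBigO.trans (IsBigO.of_bound 1 ?_) (eps_isBigO 3)
    filter_upwards [eventually_expIntE1_le_logInv] with ε hε
    rw [Real.norm_eq_abs, Real.norm_eq_abs, one_mul, abs_of_pos hε.1]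
    exact hε.2.2.1
  have h3 : (fun ε => Real.exp (-J ε ε)) =O[𝓝[>] 0] fun _ => (1 : ℝ) := by
    refine IsBigO.of_bound 1 ?_
    filter_upwards [self_mem_nhdsWithin] with ε hε
    rw [Real.norm_eq_abs, norm_one, mul_one, abs_of_pos (Real.exp_pos _)]
    exact (h.sol ε hε).exp_neg_J_le_one le_rfl
  have h4 : (fun ε => C ε * (logInv ε - Real.eulerMascheroniConstant))
      =O[𝓝[>] 0] fun _ => (1 : ℝ) := by
    have h5 : (fun ε => C ε * logInv ε) =O[𝓝[>] 0] fun _ => (1 : ℝ) := by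
      refine (h.const_isBigO.mul (isBigO_refl logInv _)).congr' EventuallyEq.rfl ?_
      filter_upwards [tendsto_logInv.eventually_gt_atTop 0] with ε hε
      field_simp
    exact (h5.sub (hC1.const_mul_left Real.eulerMascheroniConstant)).congr_left
      fun ε => by ring
  have h5 := (hC1.mul h2).mul h3
  have h6 := h4.mul h.exp_neg_J_expansion
  have h7 := (hC2.mul hsq).const_mul_left (1 / Real.exp 1)
  simp only [one_mul, mul_one] at h5 h6 h7
  exact (((h1.add h5).add h6).add h7).congr_left fun ε => by ring

theorem const_expansion (h : TailFamily C F J) :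
    (fun ε => C ε - ((Real.exp 1 - 1) / logInv ε + coeffA / logInv ε ^ 2
      + coeffB / logInv ε ^ 3)) =O[𝓝[>] 0] fun ε => 1 / logInv ε ^ 4 := by
  have hl : ∀ᶠ ε in 𝓝[>] (0 : ℝ), 0 < logInv ε := tendsto_logInv.eventually_gt_atTop 0
  have hY : (fun ε => C ε * logInv ε) =O[𝓝[>] 0] fun _ => (1 : ℝ) := by
    refine (h.const_isBigO.mul (isBigO_refl logInv _)).congr' EventuallyEq.rfl ?_
    filter_upwards [hl] with ε hε
    field_simp
  -- Here `Y = C l` and `x = 1/l`; `p`, `q`, `r` are read off from multiplying out `Y (1 - γ x)(1 -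
  -- k x Y - κ x² Y²) + 2 log 2 · k x² Y²`, with `κ = (2 log 2 - 3/2)/e²`.
  have key := expansion_of_perturbed_root (c := Real.exp 1 - 1)
    (g := Real.eulerMascheroniConstant) (k := 1 / Real.exp 1)
    (p := Real.eulerMascheroniConstant * (1 / Real.exp 1) + 2 * Real.log 2 * (1 / Real.exp 1))
    (q := -((2 * Real.log 2 - 3 / 2) / Real.exp 1 ^ 2))
    (r := Real.eulerMascheroniConstant * ((2 * Real.log 2 - 3 / 2) / Real.exp 1 ^ 2))
    one_div_logInv_isBigO_one hY (by
      refine h.const_equation.congr' ?_ EventuallyEq.rfl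
      filter_upwards [hl] with ε hε
      have hx : 1 / logInv ε * logInv ε = 1 := by field_simp
      generalize 1 / logInv ε = x at hx
      generalize (2 * Real.log 2 - 3 / 2) / Real.exp 1 ^ 2 = κ
      generalize 1 / Real.exp 1 = k
      have hC : C ε = C ε * logInv ε * x := by rw [mul_assoc, mul_comm _ x, hx, mul_one]
      have hC' : C ε * (logInv ε - Real.eulerMascheroniConstant)
          = C ε * logInv ε * (1 - Real.eulerMascheroniConstant * x) := by
        nth_rewrite 1 [hC]
        linear_combination C ε * logInv ε * hx
      rw [hC']
      generalize C ε * logInv ε = y at *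
      rw [hC]
      ring)
  rw [← coeffA_eq, ← coeffB_eq] at key
  refine (key.mul (isBigO_refl (fun ε => 1 / logInv ε) _)).congr' ?_ ?_
  · filter_upwards [hl] with ε hε
    field_simp
  · filter_upwards [hl] with ε hε
    field_simp

theorem const_expansion_two (h : TailFamily C F J) :
    (fun ε => C ε - ((Real.exp 1 - 1) * (1 / logInv ε) + coeffA * (1 / logInv ε) ^ 2))
      =O[𝓝[>] 0] fun ε => (1 / logInv ε) ^ 3 := by
  have h1 : (fun ε => 1 / logInv ε ^ 4) =O[𝓝[>] 0] fun ε : ℝ => (1 / logInv ε) ^ 3 := by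
    simpa [one_div, inv_pow] using one_div_logInv_pow_isBigO (show 3 ≤ 4 by norm_num)
  exact ((h.const_expansion.trans h1).add ((isBigO_refl (fun ε => (1 / logInv ε) ^ 3)
    (𝓝[>] 0)).const_mul_left coeffB)).congr_left fun ε => by
      rw [one_div]
      ring

theorem const_sq_expansion (h : TailFamily C F J) :
    (fun ε => C ε ^ 2 - ((Real.exp 1 - 1) * (1 / logInv ε)) ^ 2)
      =O[𝓝[>] 0] fun ε => (1 / logInv ε) ^ 3 := by
  have hx := isBigO_refl (fun ε : ℝ => 1 / logInv ε) (𝓝[>] 0)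
  have h1 : (fun ε => C ε - (Real.exp 1 - 1) * (1 / logInv ε))
      =O[𝓝[>] 0] fun ε => (1 / logInv ε) ^ 2 :=
    ((h.const_expansion_two.trans (one_div_logInv_pow_isBigO (by norm_num))).add
      ((hx.pow 2).const_mul_left coeffA)).congr_left fun ε => by ring
  have h2 : (fun ε => C ε + (Real.exp 1 - 1) * (1 / logInv ε))
      =O[𝓝[>] 0] fun ε => 1 / logInv ε := h.const_isBigO.add (hx.const_mul_left _)
  exact (h1.mul h2).congr (fun ε => by ring) fun ε => by ring

/-- Substitute the expansion of `C` in the second iterate. The coefficient `γ + 1 - 1/e` is `A/(e -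
1)`. -/
theorem outer_expansion (h : TailFamily C F J) {ρ : ℝ} (hρ : 0 < ρ) :
    (fun ε => -F ε ρ - outerExpansionExp ρ ε) =O[𝓝[>] 0] fun ε => (1 / logInv ε) ^ 3 := by
  have h1 : (fun ε => F ε ρ - (C ε * expIntE1 ρ - C ε ^ 2 / Real.exp 1 * expIntSecond ρ))
      =O[𝓝[>] 0] fun ε => (1 / logInv ε) ^ 3 := by
    refine IsBigO.trans (IsBigO.of_bound (4 * expIntE1 ρ) ?_) (h.const_pow_isBigO 3)
    filter_upwards [Ioo_mem_nhdsGT hρ] with ε hε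
    have hsol := h.sol ε hε.1
    rw [Real.norm_eq_abs, Real.norm_eq_abs, abs_of_nonneg (pow_nonneg hsol.const_nonneg 3)]
    exact (hsol.abs_F_sub_second_le (h.left ε hε.1).le hε.2.le).trans_eq (by ring)
  have h2 := h.const_expansion_two.const_mul_left (expIntE1 ρ)
  have h3 := h.const_sq_expansion.const_mul_left (1 / Real.exp 1 * expIntSecond ρ)
  refine ((h3.sub h2).sub h1).congr_left fun ε => ?_
  have := (Real.exp_pos 1).ne'
  rw [outerExpansionExp, expIntSecond, coeffA]
  -- The identity is needed at every real `ε`; where `l = 0`, division by zero gives `0` and both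
  -- sides still agree.
  by_cases hl : logInv ε = 0
  · simp only [hl]
    field_simp
    ring
  · field_simp
    ring

theorem F_isBigO (h : TailFamily C F J) {ρ : ℝ} (hρ : 0 < ρ) :
    (fun ε => F ε ρ) =O[𝓝[>] 0] fun ε => 1 / logInv ε := by
  refine IsBigO.trans (IsBigO.of_bound (expIntE1 ρ) ?_) h.const_isBigO
  filter_upwards [Ioo_mem_nhdsGT hρ] with ε hε
  have hsol := h.sol ε hε.1
  rw [Real.norm_eq_abs, Real.norm_eq_abs, abs_of_nonneg hsol.const_nonneg,
    abs_of_nonneg (hsol.F_nonneg hε.2.le), mul_comm]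
  exact hsol.F_le hε.2.le

theorem outer_expansion_rate (h : TailFamily C F J) {ρ : ℝ} (hρ : 0 < ρ) :
    (fun ε => -tailRate (F ε ρ)
        - outerExpansion (Real.eulerMascheroniConstant + 1 - 1 / Real.exp 1) ρ ε)
      =O[𝓝[>] 0] fun ε => (1 / logInv ε) ^ 3 := by
  have h1 : (fun ε => tailRate (F ε ρ) - F ε ρ / Real.exp 1 - F ε ρ ^ 2 / (2 * Real.exp 1 ^ 2))
      =O[𝓝[>] 0] fun ε => (1 / logInv ε) ^ 3 := by
    refine IsBigO.trans (IsBigO.of_bound 1 ?_) ((h.F_isBigO hρ).pow 3)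
    filter_upwards [Ioo_mem_nhdsGT hρ] with ε hε
    have hsol := h.sol ε hε.1
    have h0 := hsol.F_nonneg hε.2.le
    rw [Real.norm_eq_abs, Real.norm_eq_abs, one_mul, abs_of_nonneg (pow_nonneg h0 3)]
    exact abs_tailRate_sub_quadratic_le h0 (hsol.F_le_of_left (h.left ε hε.1).le hε.2.le)
  have h2 := h.outer_expansion hρ
  have h3 : (fun ε => F ε ρ - C ε * expIntE1 ρ) =O[𝓝[>] 0] fun ε => (1 / logInv ε) ^ 2 := by
    refine IsBigO.trans (IsBigO.of_bound (expIntE1 ρ) ?_) (h.const_pow_isBigO 2)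
    filter_upwards [Ioo_mem_nhdsGT hρ] with ε hε
    have hsol := h.sol ε hε.1
    rw [Real.norm_eq_abs, Real.norm_eq_abs, abs_of_nonneg (sq_nonneg (C ε)),
      mul_comm (expIntE1 ρ)]
    exact hsol.abs_F_sub_le hε.2.le
  have h4 : (fun ε => F ε ρ + C ε * expIntE1 ρ) =O[𝓝[>] 0] fun ε => 1 / logInv ε :=
    ((h.F_isBigO hρ).add (h.const_isBigO.const_mul_left (expIntE1 ρ))).congr_left
      fun ε => by ring
  have h5 : (fun ε => (F ε ρ - C ε * expIntE1 ρ) * (F ε ρ + C ε * expIntE1 ρ))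
      =O[𝓝[>] 0] fun ε => (1 / logInv ε) ^ 3 := (h3.mul h4).congr_right fun ε => by ring
  have h6 := h.const_sq_expansion.const_mul_left (expIntE1 ρ ^ 2)
  refine (((h2.const_mul_left (1 / Real.exp 1)).sub h1).sub
    ((h5.add h6).const_mul_left (1 / (2 * Real.exp 1 ^ 2)))).congr_left fun ε => ?_
  have := (Real.exp_pos 1).ne'
  rw [outerExpansionExp, outerExpansion]
  by_cases hl : logInv ε = 0
  · simp only [hl]
    field_simp
    ring
  · field_simp
    ring

/-- Only `F(ε) - F(εr) = C ∫_ε^{εr} τ⁻¹ e^{-τ} e^{-J}` matters. On this short range `e^{-τ} e^{-J}`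
is `1 - C/e` up to `O(C² + ε l²)`, so the integral is nearly `(1 - C/e) log r`. In `C - C²/e` the
`(e - 1)²/e` part of `A` cancels, leaving `γ (e - 1)`. -/
theorem inner_expansion (h : TailFamily C F J) {r : ℝ} (hr : 1 ≤ r) :
    (fun ε => -F ε (ε * r) - innerExpansion r ε) =O[𝓝[>] 0] fun ε => (1 / logInv ε) ^ 3 := by
  have hlr : 0 ≤ Real.log r := Real.log_nonneg hr
  have hr0 : 0 < r := one_pos.trans_le hr
  have key : ∀ᶠ ε in 𝓝[>] (0 : ℝ),
      |F ε ε - F ε (ε * r) - C ε * (1 - C ε / Real.exp 1) * Real.log r|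
        ≤ C ε * (4 * C ε ^ 2 + C ε * (2 * r * (ε * logInv ε ^ 2))
          + r * (ε * logInv ε ^ 2)) * Real.log r := by
    filter_upwards [eventually_expIntE1_le_logInv] with ε hε
    obtain ⟨h0, hl, -, hE⟩ := hε
    have hsol := h.sol ε h0
    have hC := hsol.const_nonneg
    have hεr : ε ≤ ε * r := le_mul_of_one_le_right h0.le hr
    set R := ε * logInv ε ^ 2 with hR
    have hεR : ε ≤ R := le_mul_of_one_le_right h0.le (one_le_pow₀ hl)
    have hlR : ε * logInv ε ≤ R := by
      rw [hR]
      gcongr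
      nlinarith
    -- The three terms bound the errors of the second-order form of `e^{-J}`, of replacing
    -- `expIntTail x` by `1`, and of replacing `e^{-x}` by `1`.
    set Δ := 4 * C ε ^ 2 + C ε * (2 * r * R) + r * R with hΔ
    have hpt : ∀ x, ε ≤ x → x ≤ ε * r →
        |Real.exp (-x) * Real.exp (-J ε x) - (1 - C ε / Real.exp 1)| ≤ Δ := by
      intro x hx1 hx2
      have hx0 := h0.trans_le hx1
      have h1 := hsol.abs_exp_neg_J_sub_le (h.left ε h0).le hx1
      have h2 := abs_expIntTail_sub_one_le hx0
      have h3 : x * expIntE1 x ≤ ε * r * logInv ε :=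
        mul_le_mul hx2 ((expIntE1_antitone h0 hx1).trans hE) (expIntE1_nonneg hx0) (by positivity)
      have h4 : |C ε / Real.exp 1 * (expIntTail x - 1)| ≤ C ε * (2 * r * R) := by
        rw [abs_mul, abs_of_nonneg (div_nonneg hC (Real.exp_pos 1).le)]
        refine mul_le_mul (div_le_self hC (Real.one_le_exp zero_le_one)) ?_ (abs_nonneg _) hC
        nlinarith
      have h5 := hsol.exp_neg_J_le_one hx1
      have h6 := Real.one_sub_le_exp_neg x
      have h7 : Real.exp (-x) ≤ 1 := Real.exp_le_one_iff.2 (by linarith)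
      have h8 : |(1 - Real.exp (-x)) * Real.exp (-J ε x)| ≤ r * R := by
        rw [abs_of_nonneg (mul_nonneg (by linarith) (Real.exp_pos _).le)]
        refine (mul_le_of_le_one_right (by linarith) h5).trans ?_
        nlinarith
      rw [show Real.exp (-x) * Real.exp (-J ε x) - (1 - C ε / Real.exp 1)
        = (Real.exp (-J ε x) - (1 - C ε / Real.exp 1 * expIntTail x))
          + (-(C ε / Real.exp 1 * (expIntTail x - 1)))
          + (-((1 - Real.exp (-x)) * Real.exp (-J ε x))) by ring]
      refine (abs_add_three _ _ _).trans ?_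
      rw [abs_neg, abs_neg]
      exact add_le_add (add_le_add h1 h4) h8
    have hsplit := setIntegral_Ioi_eq_interval_add hεr hsol.integrableOn_integrand
    have hii : IntervalIntegrable (fun τ => Real.exp (-τ) / τ * Real.exp (-J ε τ))
        MeasureTheory.volume ε (ε * r) :=
      (intervalIntegrable_iff_integrableOn_Ioc_of_le hεr).2
        (hsol.integrableOn_integrand.mono_set Ioc_subset_Ioi_self)
    have hinv : ∀ c : ℝ, IntervalIntegrable (fun τ : ℝ => c * τ⁻¹)
        MeasureTheory.volume ε (ε * r) := fun c =>
      (intervalIntegral.intervalIntegrable_inv (fun x hx => by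
        rw [uIcc_of_le hεr] at hx
        exact (h0.trans_le hx.1).ne') continuousOn_id).const_mul c
    have hlog : ∀ c : ℝ, ∫ τ in ε..(ε * r), c * τ⁻¹ = c * Real.log r := by
      intro c
      rw [intervalIntegral.integral_const_mul, integral_inv_of_pos h0 (by positivity),
        mul_div_cancel_left₀ _ h0.ne']
    have hdiff : F ε ε - F ε (ε * r) - C ε * (1 - C ε / Real.exp 1) * Real.log r
        = C ε * ∫ τ in ε..(ε * r), (Real.exp (-τ) / τ * Real.exp (-J ε τ)
          - (1 - C ε / Real.exp 1) * τ⁻¹) := by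
      rw [intervalIntegral.integral_sub hii (hinv _), hlog, hsol.F_eq ε le_rfl,
        hsol.F_eq _ hεr, hsplit]
      ring
    rw [hdiff, abs_mul, abs_of_nonneg hC, mul_assoc]
    refine mul_le_mul_of_nonneg_left ?_ hC
    rw [← hlog, ← Real.norm_eq_abs]
    refine intervalIntegral.norm_integral_le_of_norm_le hεr (MeasureTheory.ae_of_all _
      fun x hx => ?_) (hinv _)
    have hx0 := h0.trans hx.1
    rw [Real.norm_eq_abs, show Real.exp (-x) / x * Real.exp (-J ε x)
      - (1 - C ε / Real.exp 1) * x⁻¹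
      = (Real.exp (-x) * Real.exp (-J ε x) - (1 - C ε / Real.exp 1)) * x⁻¹ by ring,
      abs_mul, abs_of_pos (inv_pos.2 hx0)]
    exact mul_le_mul_of_nonneg_right (hpt x hx.1.le hx.2) (inv_pos.2 hx0).le
  have h1 : (fun ε => F ε ε - F ε (ε * r) - C ε * (1 - C ε / Real.exp 1) * Real.log r)
      =O[𝓝[>] 0] fun ε => (1 / logInv ε) ^ 3 := by
    have h2 : (fun ε => C ε * (4 * C ε ^ 2 + C ε * (2 * r * (ε * logInv ε ^ 2))
          + r * (ε * logInv ε ^ 2)) * Real.log r) =O[𝓝[>] 0] fun ε => (1 / logInv ε) ^ 3 := by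
      have hC1 := h.const_isBigO_one
      have h3 := (h.const_pow_isBigO 3).const_mul_left (4 * Real.log r)
      have h4 := ((hC1.pow 2).mul eps_mul_sq_isBigO).const_mul_left (2 * r * Real.log r)
      have h5 := (hC1.mul eps_mul_sq_isBigO).const_mul_left (r * Real.log r)
      simp only [one_pow, one_mul] at h4 h5
      exact ((h3.add h4).add h5).congr_left fun ε => by ring
    refine IsBigO.trans (IsBigO.of_bound 1 ?_) h2
    filter_upwards [key] with ε hε
    rw [one_mul, Real.norm_eq_abs, Real.norm_eq_abs]
    exact hε.trans (le_abs_self _)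
  have h2 := h.const_expansion_two.const_mul_left (Real.log r)
  have h3 := h.const_sq_expansion.const_mul_left (Real.log r / Real.exp 1)
  refine ((h1.add h2).sub h3).congr' ?_ EventuallyEq.rfl
  filter_upwards [self_mem_nhdsWithin, tendsto_logInv.eventually_gt_atTop 0] with ε hε hl
  have := (Real.exp_pos 1).ne'
  rw [innerExpansion, coeffA, h.left ε hε]
  field_simp
  ring

end TailFamily

end Expansions

/-! ### The integral equation and its exponential series for actual solutions. -/

section IntegralEquation
open MeasureTheory

namespace ScaledSolution

variable {ε C : ℝ} {U q : ℝ → ℝ}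

theorem exp_sub_neg (h : ScaledSolution ε U q) {ρ : ℝ} (hρ : ε ≤ ρ) :
    Real.exp (U ρ) - Real.exp 1 < 0 := sub_neg.2 (Real.exp_lt_exp.2 (h.lt_one hρ))

theorem ratio_mul (h : ScaledSolution ε U q) {ρ : ℝ} (hρ : ε ≤ ρ) :
    (U ρ - 1) / (Real.exp (U ρ) - Real.exp 1) * (Real.exp (U ρ) - Real.exp 1) = U ρ - 1 :=
  div_mul_cancel₀ _ (h.exp_sub_neg hρ).ne

/-- The ratio is `tailRate F / F` for `F = e - e^U > 0`. -/
theorem ratio_bounds (h : ScaledSolution ε U q) {ρ : ℝ} (hρ : ε ≤ ρ) :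
    0 ≤ (U ρ - 1) / (Real.exp (U ρ) - Real.exp 1) ∧
      (U ρ - 1) / (Real.exp (U ρ) - Real.exp 1) ≤ 1 := by
  have h1 := h.exp_sub_neg hρ
  have h2 := h.lt_one hρ
  have h3 := tailRate_le_self (F := Real.exp 1 - Real.exp (U ρ)) (by linarith)
  rw [h.tailRate_eq hρ] at h3
  exact ⟨div_nonneg_of_nonpos (by linarith) h1.le, (div_le_one_of_neg h1).2 (by linarith)⟩

theorem tailExponentExp_eq (h : ScaledSolution ε U q) {τ : ℝ} (hτ : ε ≤ τ) :
    tailExponentExp U τ = tailExponent U τ := by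
  rw [tailExponentExp, tailExponent, integralFromInfty, integralFromInfty]
  congr 1
  exact setIntegral_congr_fun measurableSet_Ioi fun x hx => h.ratio_mul (hτ.trans (le_of_lt hx))

theorem integrand_eq (h : ScaledSolution ε U q) {τ : ℝ} (hτ : ε ≤ τ) :
    1 / τ * Real.exp (-τ) * Real.exp (-tailExponentExp U τ)
      = Real.exp (-τ) / τ * Real.exp (-tailExponent U τ) := by
  rw [h.tailExponentExp_eq hτ]
  ring

theorem integralFromInfty_integrand (h : ScaledSolution ε U q) {ρ : ℝ} (hρ : ε ≤ ρ) :
    integralFromInfty (fun τ => 1 / τ * Real.exp (-τ) * Real.exp (-tailExponentExp U τ)) ρ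
      = -∫ τ in Ioi ρ, Real.exp (-τ) / τ * Real.exp (-tailExponent U τ) := by
  rw [integralFromInfty]
  congr 1
  exact setIntegral_congr_fun measurableSet_Ioi fun x hx =>
    h.integrand_eq (hρ.trans (le_of_lt hx))

theorem exp_sub_eq (h : ScaledSolution ε U q)
    (S : TailSolution ε C (fun ρ => Real.exp 1 - Real.exp (U ρ)) (tailExponent U))
    {ρ : ℝ} (hρ : ε ≤ ρ) :
    Real.exp (U ρ) - Real.exp 1 = C * integralFromInfty
      (fun τ => 1 / τ * Real.exp (-τ) * Real.exp (-tailExponentExp U τ)) ρ := by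
  have h1 := S.F_eq ρ hρ
  rw [h.integralFromInfty_integrand hρ]
  linarith

theorem integrableOn_integrand (h : ScaledSolution ε U q)
    (S : TailSolution ε C (fun ρ => Real.exp 1 - Real.exp (U ρ)) (tailExponent U)) :
    IntegrableOn (fun τ => 1 / τ * Real.exp (-τ) * Real.exp (-tailExponentExp U τ)) (Ioi ε) :=
  S.integrableOn_integrand.congr_fun (fun _ hx => (h.integrand_eq (le_of_lt hx)).symm)
    measurableSet_Ioi

theorem satisfiesIntegralEq (h : ScaledSolution ε U q)
    (S : TailSolution ε C (fun ρ => Real.exp 1 - Real.exp (U ρ)) (tailExponent U))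
    : SatisfiesIntegralEq ε C U := by
  refine ⟨?_, h.integrableOn_integrand S, fun ρ hρ => h.exp_sub_eq S hρ⟩
  have h1 : IntegrableOn (fun ρ => U ρ - 1) (Ioi ε) := by
    refine h.integrableOn_one_sub.neg.congr_fun (fun x _ => ?_) measurableSet_Ioi
    simp only [Pi.neg_apply, neg_sub]
  exact h1.congr_fun (fun x hx => (h.ratio_mul (le_of_lt hx)).symm) measurableSet_Ioi

/-- Evaluate at `ρ = ε`: the left side is nonzero, so the integral multiplying the constant is
nonzero and can be cancelled. -/
theorem eq_of_satisfiesIntegralEq (h : ScaledSolution ε U q)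
    (S : TailSolution ε C (fun ρ => Real.exp 1 - Real.exp (U ρ)) (tailExponent U))
    {C' : ℝ} (h' : SatisfiesIntegralEq ε C' U) : C' = C := by
  have h1 := h'.2.2 ε le_rfl
  have h2 := h.exp_sub_eq S le_rfl
  have h3 := h.exp_sub_neg le_rfl
  rw [h2] at h1 h3
  exact (mul_right_cancel₀ (fun h0 => by rw [h0, mul_zero] at h3; exact lt_irrefl _ h3) h1).symm

theorem abs_exp_sub_le (h : ScaledSolution ε U q)
    (S : TailSolution ε C (fun ρ => Real.exp 1 - Real.exp (U ρ)) (tailExponent U))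
    {ρ : ℝ} (hρ : ε ≤ ρ) :
    |Real.exp (U ρ) - Real.exp 1| ≤ C * expIntE1 ρ := by
  rw [abs_of_neg (h.exp_sub_neg hρ), neg_sub]
  exact S.F_le hρ

theorem abs_neg_tailExponentExp_le (h : ScaledSolution ε U q)
    (S : TailSolution ε C (fun ρ => Real.exp 1 - Real.exp (U ρ)) (tailExponent U))
    {τ : ℝ} (hτ : ε ≤ τ) : |-tailExponentExp U τ| ≤ C := by
  rw [abs_neg, h.tailExponentExp_eq hτ, abs_of_nonneg (S.J_nonneg hτ)]
  exact S.J_le_const hτ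

/-- Weierstrass test with majorant `C^m / m!`, from `|J| ≤ C`. -/
theorem tendstoUniformlyOn_exp_series (h : ScaledSolution ε U q)
    (S : TailSolution ε C (fun ρ => Real.exp 1 - Real.exp (U ρ)) (tailExponent U)) :
    TendstoUniformlyOn
      (fun (N : ℕ) (τ : ℝ) => ∑ m ∈ Finset.range N,
        (-tailExponentExp U τ) ^ m / (m.factorial : ℝ))
      (fun τ => Real.exp (-tailExponentExp U τ)) atTop (Ici ε) := by
  have h1 := tendstoUniformlyOn_tsum_nat
    (f := fun (m : ℕ) (τ : ℝ) => (-tailExponentExp U τ) ^ m / (m.factorial : ℝ))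
    (u := fun m => C ^ m / (m.factorial : ℝ)) (s := Ici ε)
    (Real.summable_pow_div_factorial C) fun m τ hτ => by
      rw [Real.norm_eq_abs, abs_div, abs_pow, Nat.abs_cast]
      have := h.abs_neg_tailExponentExp_le S hτ
      gcongr
  refine h1.congr_right fun τ _ => ?_
  simp only
  rw [Real.exp_eq_exp_ℝ, NormedSpace.exp_eq_tsum_div]

theorem continuousOn_tailExponentExp (h : ScaledSolution ε U q)
    (S : TailSolution ε C (fun ρ => Real.exp 1 - Real.exp (U ρ)) (tailExponent U))
    : ContinuousOn (tailExponentExp U) (Ici ε) :=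
  S.continuousOn_J.congr fun _ hτ => h.tailExponentExp_eq hτ

theorem integrableOn_series_term (h : ScaledSolution ε U q)
    (S : TailSolution ε C (fun ρ => Real.exp 1 - Real.exp (U ρ)) (tailExponent U)) (m : ℕ) :
    IntegrableOn (fun τ => 1 / τ * Real.exp (-τ) *
      ((-tailExponentExp U τ) ^ m / (m.factorial : ℝ))) (Ioi ε) := by
  refine IntegrableOn.of_continuousOn_abs_le
    ((integrableOn_exp_neg_div S.eps_pos).mul_const (C ^ m / (m.factorial : ℝ))) ?_ fun x hx => ?_
  · have h1 : ContinuousOn (fun τ : ℝ => 1 / τ * Real.exp (-τ)) (Ioi ε) :=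
      (continuousOn_exp_neg_div.mono (Ioi_subset_Ioi S.eps_pos.le)).congr fun x _ => by
        simp only
        ring
    exact h1.mul
      ((((h.continuousOn_tailExponentExp S).mono Ioi_subset_Ici_self).neg.pow m).div_const _)
  · have hx0 := S.eps_pos.trans hx
    have := h.abs_neg_tailExponentExp_le S hx.le
    rw [abs_mul, abs_div, abs_pow, Nat.abs_cast, abs_of_nonneg (by positivity),
      one_div_mul_eq_div]
    gcongr

/-- Uniform convergence of the exponential series is integrated against `e^{-τ}/τ`, whose mass on
`(ρ, ∞)` is at most `E₁(ε)` for all `ρ ≥ ε`. -/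
theorem tendstoUniformlyOn_integral_series (h : ScaledSolution ε U q)
    (S : TailSolution ε C (fun ρ => Real.exp 1 - Real.exp (U ρ)) (tailExponent U)) :
    TendstoUniformlyOn
      (fun (N : ℕ) (ρ : ℝ) => ∑ m ∈ Finset.range N,
        C * integralFromInfty (fun τ => 1 / τ * Real.exp (-τ) *
          ((-tailExponentExp U τ) ^ m / (m.factorial : ℝ))) ρ)
      (fun ρ => Real.exp (U ρ) - Real.exp 1) atTop (Ici ε) := by
  have hε := S.eps_pos
  have hE := expIntE1_nonneg hε
  have hC := S.const_nonneg
  rw [Metric.tendstoUniformlyOn_iff]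
  intro δ hδ
  have hpos : 0 < C * expIntE1 ε + 1 := by positivity
  filter_upwards [Metric.tendstoUniformlyOn_iff.1 (h.tendstoUniformlyOn_exp_series S)
    (δ / (C * expIntE1 ε + 1)) (by positivity)] with N hN ρ hρ
  have hρ' : ε ≤ ρ := hρ
  have hρ0 := hε.trans_le hρ'
  have hint := (h.integrableOn_integrand S).mono_set (Ioi_subset_Ioi hρ')
  have hterm := fun m => (h.integrableOn_series_term S m).mono_set (Ioi_subset_Ioi hρ')
  have h1 : ∑ m ∈ Finset.range N, C * integralFromInfty (fun τ => 1 / τ * Real.exp (-τ) *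
        ((-tailExponentExp U τ) ^ m / (m.factorial : ℝ))) ρ
      = C * -∫ τ in Ioi ρ, ∑ m ∈ Finset.range N, 1 / τ * Real.exp (-τ) *
        ((-tailExponentExp U τ) ^ m / (m.factorial : ℝ)) := by
    rw [integral_finsetSum _ fun m _ => hterm m, ← Finset.mul_sum, ← Finset.sum_neg_distrib]
    rfl
  have h2 : Real.exp (U ρ) - Real.exp 1 - ∑ m ∈ Finset.range N, C * integralFromInfty
        (fun τ => 1 / τ * Real.exp (-τ) * ((-tailExponentExp U τ) ^ m / (m.factorial : ℝ))) ρ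
      = C * -∫ τ in Ioi ρ, (1 / τ * Real.exp (-τ) * Real.exp (-tailExponentExp U τ)
        - ∑ m ∈ Finset.range N, 1 / τ * Real.exp (-τ) *
          ((-tailExponentExp U τ) ^ m / (m.factorial : ℝ))) := by
    rw [h1, integral_sub hint (integrable_finsetSum _ fun m _ => hterm m),
      h.exp_sub_eq S hρ', integralFromInfty]
    ring
  have h3 : |∫ τ in Ioi ρ, (1 / τ * Real.exp (-τ) * Real.exp (-tailExponentExp U τ)
        - ∑ m ∈ Finset.range N, 1 / τ * Real.exp (-τ) *
          ((-tailExponentExp U τ) ^ m / (m.factorial : ℝ)))|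
      ≤ expIntE1 ρ * (δ / (C * expIntE1 ε + 1)) := by
    rw [expIntE1, ← integral_mul_const]
    refine abs_setIntegral_Ioi_le ((integrableOn_exp_neg_div hρ0).mul_const _) fun x hx => ?_
    have hx0 := hρ0.trans hx
    have h4 := hN x (hρ'.trans hx.le)
    rw [Real.dist_eq] at h4
    rw [← Finset.mul_sum, ← mul_sub, abs_mul, abs_of_nonneg (by positivity), one_div_mul_eq_div]
    gcongr
  rw [Real.dist_eq, h2, abs_mul, abs_neg, abs_of_nonneg hC]
  calc _ ≤ C * (expIntE1 ε * (δ / (C * expIntE1 ε + 1))) := by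
        refine mul_le_mul_of_nonneg_left (h3.trans ?_) hC
        have := expIntE1_antitone hε hρ'
        gcongr
    _ = δ * (C * expIntE1 ε / (C * expIntE1 ε + 1)) := by ring
    _ < δ := mul_lt_of_lt_one_right hδ ((div_lt_one hpos).2 (lt_add_one _))

end ScaledSolution

end IntegralEquation

/-! ### Assembly of the theorem. -/

section Main

theorem exists_unique_lagerstrom {ε : ℝ} (hε : 0 < ε) :
    ∃ v : ℝ → ℝ, IsLagerstromSolution 1 2 ε v ∧
      ∀ w : ℝ → ℝ, IsLagerstromSolution 1 2 ε w → EqOn w v (Ici 1) := by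
  obtain ⟨C, F, J, hsol, hF⟩ := exists_tailSolution hε
  refine ⟨_, hsol.isLagerstromSolution hF, fun w hw r hr => ?_⟩
  have hv := (hsol.isLagerstromSolution hF).scaledSolution hε
  have hw' := hw.scaledSolution hε
  obtain ⟨C₁, -, S₁⟩ := hw'.exists_tailSolution
  obtain ⟨C₂, -, S₂⟩ := hv.exists_tailSolution
  have hr' : ε ≤ ε * r := le_mul_of_one_le_right hε.le hr
  have h1 := S₁.F_eq_of_eq_left S₂ (by simp only [hw'.left, Real.exp_zero])
    (by simp only [hv.left, Real.exp_zero]) hr'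
  have h2 := Real.exp_injective (sub_right_injective h1)
  simpa only [rescale, mul_div_cancel_left₀ r hε.ne'] using h2

theorem outerExpansion_sub (a b ρ ε : ℝ) :
    outerExpansion a ρ ε - outerExpansion b ρ ε
      = -((Real.exp 1 - 1) / Real.exp 1 * (a - b) * expIntE1 ρ) * (1 / logInv ε) ^ 2 := by
  rw [outerExpansion, outerExpansion]
  ring

/-- A bound `l⁻² ≤ K l⁻³` fails as soon as `l > K`. -/
theorem const_mul_sq_not_isBigO {k : ℝ} (hk : k ≠ 0) :
    ¬ (fun ε : ℝ => k * (1 / logInv ε) ^ 2) =O[𝓝[>] 0] fun ε => (1 / logInv ε) ^ 3 := by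
  intro h
  have h1 := (isBigO_const_mul_left_iff hk).1 h
  obtain ⟨K, hK⟩ := h1.bound
  obtain ⟨ε, h2, h3, h4⟩ := (hK.and ((tendsto_logInv.eventually_gt_atTop 0).and
    (tendsto_logInv.eventually_gt_atTop K))).exists
  rw [Real.norm_eq_abs, Real.norm_eq_abs, abs_of_nonneg (by positivity),
    abs_of_nonneg (by positivity)] at h2
  have h5 : K * (1 / logInv ε) ^ 3 < logInv ε * (1 / logInv ε) ^ 3 := by gcongr
  have h6 : logInv ε * (1 / logInv ε) ^ 3 = (1 / logInv ε) ^ 2 := by field_simp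
  linarith

theorem mainTheorem5 :
    -- for every `ε > 0` the problem has exactly one solution on `[1, ∞)`
    (∀ ε : ℝ, 0 < ε → ∃ v : ℝ → ℝ, IsLagerstromSolution 1 2 ε v ∧
      ∀ w : ℝ → ℝ, IsLagerstromSolution 1 2 ε w → EqOn w v (Ici 1)) ∧
    ∀ u : ℝ → ℝ → ℝ, (∀ ε : ℝ, 0 < ε → IsLagerstromSolution 1 2 ε (u ε)) →
    ∃ C : ℝ → ℝ,
      -- the integral equation, which determines `C`, and the convergent series
      (∀ ε : ℝ, 0 < ε →
        0 < C ε ∧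
        SatisfiesIntegralEq ε (C ε) (rescale ε (u ε)) ∧
        (∀ C' : ℝ, SatisfiesIntegralEq ε C' (rescale ε (u ε)) → C' = C ε) ∧
        (∀ ρ : ℝ, ε ≤ ρ →
          tailExponentExp (rescale ε (u ε)) ρ = tailExponent (rescale ε (u ε)) ρ ∧
          0 ≤ rescale ε (u ε) ρ ∧ rescale ε (u ε) ρ < 1 ∧
          0 ≤ (rescale ε (u ε) ρ - 1) / (Real.exp (rescale ε (u ε) ρ) - Real.exp 1) ∧
          (rescale ε (u ε) ρ - 1) / (Real.exp (rescale ε (u ε) ρ) - Real.exp 1) ≤ 1 ∧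
          |Real.exp (rescale ε (u ε) ρ) - Real.exp 1| ≤ C ε * expIntE1 ρ) ∧
        TendstoUniformlyOn
          (fun (N : ℕ) (τ : ℝ) => ∑ m ∈ Finset.range N,
            (-tailExponentExp (rescale ε (u ε)) τ) ^ m / (m.factorial : ℝ))
          (fun τ => Real.exp (-tailExponentExp (rescale ε (u ε)) τ)) atTop (Ici ε) ∧
        (∀ m : ℕ, MeasureTheory.IntegrableOn
          (fun τ => 1 / τ * Real.exp (-τ) *
            ((-tailExponentExp (rescale ε (u ε)) τ) ^ m / (m.factorial : ℝ))) (Ioi ε)) ∧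
        TendstoUniformlyOn
          (fun (N : ℕ) (ρ : ℝ) => ∑ m ∈ Finset.range N,
            C ε * integralFromInfty (fun τ => 1 / τ * Real.exp (-τ) *
              ((-tailExponentExp (rescale ε (u ε)) τ) ^ m / (m.factorial : ℝ))) ρ)
          (fun ρ => Real.exp (rescale ε (u ε) ρ) - Real.exp 1) atTop (Ici ε)) ∧
      -- the expansion of the constant
      ((fun ε => C ε - ((Real.exp 1 - 1) / logInv ε + coeffA / logInv ε ^ 2
          + coeffB / logInv ε ^ 3)) =O[𝓝[>] 0] fun ε => 1 / logInv ε ^ 4) ∧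
      -- the inner expansion, for fixed `r`
      (∀ r : ℝ, 1 ≤ r →
        ((fun ε => (Real.exp (u ε r) - Real.exp 1) - innerExpansion r ε)
          =O[𝓝[>] 0] fun ε => 1 / logInv ε ^ 3) ∧
        ((fun ε => u ε r - Real.log (1 + (Real.exp 1 - 1) / logInv ε * Real.log r
            + Real.eulerMascheroniConstant * (Real.exp 1 - 1) / logInv ε ^ 2 * Real.log r))
          =O[𝓝[>] 0] fun ε => 1 / logInv ε ^ 3)) ∧
      -- the outer expansion, for fixed `ρ = ε r`
      (∀ ρ : ℝ, 0 < ρ →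
        ((fun ε => (Real.exp (rescale ε (u ε) ρ) - Real.exp 1) - outerExpansionExp ρ ε)
          =O[𝓝[>] 0] fun ε => 1 / logInv ε ^ 3) ∧
        ((fun ε => (rescale ε (u ε) ρ - 1)
            - outerExpansion (Real.eulerMascheroniConstant + 1 - 1 / Real.exp 1) ρ ε)
          =O[𝓝[>] 0] fun ε => 1 / logInv ε ^ 3) ∧
        -- with Hinch's coefficient `γ - 1 + 1/e` the expansion is wrong at order `l⁻²`
        ¬ ((fun ε => (rescale ε (u ε) ρ - 1)
            - outerExpansion (Real.eulerMascheroniConstant - 1 + 1 / Real.exp 1) ρ ε)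
          =O[𝓝[>] 0] fun ε => 1 / logInv ε ^ 3)) := by
  refine ⟨fun ε hε => exists_unique_lagerstrom hε, fun u hu => ?_⟩
  have hS := fun ε hε => (hu ε hε).scaledSolution hε
  -- `C` must be a function on all of `ℝ`; for `ε ≤ 0` its value is irrelevant.
  have hex : ∀ ε, ∃ C : ℝ, 0 < ε → 0 < C ∧ TailSolution ε C
      (fun ρ => Real.exp 1 - Real.exp (rescale ε (u ε) ρ)) (tailExponent (rescale ε (u ε))) := by
    intro ε
    by_cases hε : 0 < ε
    · obtain ⟨C, hC⟩ := (hS ε hε).exists_tailSolution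
      exact ⟨C, fun _ => hC⟩
    · exact ⟨0, fun h => absurd h hε⟩
  choose C hC using hex
  have hfam : TailFamily C (fun ε ρ => Real.exp 1 - Real.exp (rescale ε (u ε) ρ))
      (fun ε => tailExponent (rescale ε (u ε))) :=
    ⟨fun ε hε => (hC ε hε).2, fun ε hε => by rw [(hS ε hε).left, Real.exp_zero]⟩
  have hpow : (fun ε => (1 / logInv ε) ^ 3) = fun ε => 1 / logInv ε ^ 3 :=
    funext fun ε => one_div_pow _ _
  refine ⟨C, fun ε hε => ?_, hfam.const_expansion, fun r hr => ?_, fun ρ hρ => ?_⟩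
  · have h := hS ε hε
    obtain ⟨hC0, S⟩ := hC ε hε
    exact ⟨hC0, h.satisfiesIntegralEq S, fun C' h' => h.eq_of_satisfiesIntegralEq S h',
      fun ρ hρ => ⟨h.tailExponentExp_eq hρ, h.nonneg hρ, h.lt_one hρ, (h.ratio_bounds hρ).1,
        (h.ratio_bounds hρ).2, h.abs_exp_sub_le S hρ⟩,
      h.tendstoUniformlyOn_exp_series S, h.integrableOn_series_term S,
      h.tendstoUniformlyOn_integral_series S⟩
  · have hrescale : ∀ ε, 0 < ε → rescale ε (u ε) (ε * r) = u ε r := fun ε hε => by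
      rw [rescale, mul_div_cancel_left₀ r hε.ne']
    have h1 : (fun ε => (Real.exp (u ε r) - Real.exp 1) - innerExpansion r ε)
        =O[𝓝[>] 0] fun ε => 1 / logInv ε ^ 3 := by
      rw [← hpow]
      refine (hfam.inner_expansion hr).congr' ?_ EventuallyEq.rfl
      filter_upwards [self_mem_nhdsWithin] with ε hε
      rw [hrescale ε hε]
      ring
    refine ⟨h1, IsBigO.trans (IsBigO.of_bound 1 ?_) h1⟩
    filter_upwards [self_mem_nhdsWithin, tendsto_logInv.eventually_gt_atTop 0] with ε hε hl
    have h2 : 0 ≤ u ε r := by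
      rw [← hrescale ε hε]
      exact (hS ε hε).nonneg (le_mul_of_one_le_right (le_of_lt hε) hr)
    have he : 0 ≤ Real.exp 1 - 1 := sub_nonneg.2 (Real.one_le_exp zero_le_one)
    have hlr := Real.log_nonneg hr
    have hg : 0 ≤ Real.eulerMascheroniConstant := by
      linarith [Real.one_half_lt_eulerMascheroniConstant]
    -- Both `e^u` and the approximation are at least `1` (here `γ ≥ 0` is used), where `log` is
    -- 1-Lipschitz, so the error for `e^u` carries over to `u`.
    have h3 : 1 ≤ 1 + (Real.exp 1 - 1) / logInv ε * Real.log r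
        + Real.eulerMascheroniConstant * (Real.exp 1 - 1) / logInv ε ^ 2 * Real.log r := by
      rw [add_assoc]
      exact le_add_of_nonneg_right (by positivity)
    have h4 := abs_log_sub_log_le (Real.one_le_exp h2) h3
    rw [Real.log_exp] at h4
    rw [one_mul, Real.norm_eq_abs, Real.norm_eq_abs]
    refine h4.trans_eq ?_
    congr 1
    rw [innerExpansion]
    ring
  · rw [← hpow]
    have h1 : (fun ε => (rescale ε (u ε) ρ - 1)
        - outerExpansion (Real.eulerMascheroniConstant + 1 - 1 / Real.exp 1) ρ ε)
          =O[𝓝[>] 0] fun ε => (1 / logInv ε) ^ 3 := by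
      refine (hfam.outer_expansion_rate hρ).congr' ?_ EventuallyEq.rfl
      filter_upwards [Ioo_mem_nhdsGT hρ] with ε hε
      rw [(hS ε hε.1).tailRate_eq hε.2.le]
      ring
    refine ⟨(hfam.outer_expansion hρ).congr_left fun ε => by ring, h1, fun h2 => ?_⟩
    have he : 1 < Real.exp 1 := Real.one_lt_exp_iff.2 one_pos
    have hE := expIntE1_pos hρ
    -- The two candidate coefficients differ by `2 (1 - 1/e)`. If both expansions held, their
    -- difference, this constant times `l⁻²`, would be `O(l⁻³)`.
    have hne : (Real.exp 1 - 1) / Real.exp 1 * (2 * (1 - 1 / Real.exp 1)) * expIntE1 ρ ≠ 0 := by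
      have h3 : 0 < 1 - 1 / Real.exp 1 := sub_pos.2 ((div_lt_one (by linarith)).2 he)
      have h4 : 0 < (Real.exp 1 - 1) / Real.exp 1 := div_pos (by linarith) (by linarith)
      positivity
    refine const_mul_sq_not_isBigO hne ((h1.sub h2).congr_left fun ε => ?_)
    have h3 := outerExpansion_sub (Real.eulerMascheroniConstant + 1 - 1 / Real.exp 1)
      (Real.eulerMascheroniConstant - 1 + 1 / Real.exp 1) ρ ε
    linear_combination -h3

end Main
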